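/- Let $P_1,P_2$ be probability distributions on $[0,\infty)$, neither of them concentrated at $0$. Given integers $m\ge 1$, $n\ge 2$, let $X_1,\dots,X_m,Y_1,\dots,Y_n$ be independent random variables, every $X_i$ with distribution $P_1$ and every $Y_j$ with distribution $P_2$. Given these weights, let every pair $(w_i,v_j)$, $1\le i\le m$, $1\le j\le n$, be linked with probability $\min\{1,\,X_iY_j/\sqrt{nm}\}$, independently of the other pairs. The inhomogeneous random intersection graph $G=G(P_1,P_2,n,m)$ has vertex set $\{v_1,\dots,v_n\}$, and two distinct vertices $u,v$ are adjacent ($u\sim v$) whenever some $w_i$ is linked to both. Let $d(v)$ be the degree of $v$ in $G$ and, for $k_1,k_2=0,1,\dots$, $$p(k_1,k_2)=\mathbf P\bigl(d(v_1)=k_1+1,\ d(v_2)=k_2+1\,\big|\,v_1\sim v_2\bigr).$$ Write $a_i=\mathbf E X_1^i$ and $b_j=\mathbf E Y_1^j$. For $\beta\in(0,\infty)$ let $\Lambda_0$ and $\Lambda_3$ be integer valued random variables with the mixed Poisson distributions $$\mathbf P(\Lambda_i=r)=\mathbf E\,e^{-\lambda_i}\frac{\lambda_i^r}{r!},\qquad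 r=0,1,\dots,\qquad \lambda_0=X_1b_1\beta^{-1/2},\qquad \lambda_3=Y_1a_2b_1 .$$ Let $\tau_1,\tau_2,\dots$ be independent with $\mathbf P(\tau_j=r)=\frac{r+1}{\mathbf E\Lambda_0}\mathbf P(\Lambda_0=r+1)$, $r=0,1,\dots$; for $y\ge 0$ let $d^*_y=\sum_{j=1}^{N_y}\tau_j$, where $N_y$ is a Poisson random variable with mean $ya_1\beta^{1/2}$ that is independent of $(\tau_j)_{j\ge1}$. Let $q_r=\int y\,\mathbf P(d^*_y=r)\,P_2(dy)$ and $$p_\beta(k_1,k_2)=\frac{\beta}{b_1^4a_2}\sum_{r=0}^{\min(k_1,k_2)}(r+1)(r+2)\,\mathbf P(\Lambda_0=r+2)\,q_{k_1-r}\,q_{k_2-r},$$ $$\tilde p(r)=\frac{r\,\mathbf P(\Lambda_3=r)}{\mathbf E\Lambda_3},\qquad p_\infty(k_1,k_2)=\tilde p(k_1+1)\,\tilde p(k_2+1).$$ Theorem. Suppose that $\mathbf E X_1^2<\infty$ and $\mathbf E Y_1<\infty$, and let $m,n\to\infty$. (i) If $m/n\to\beta$ for some $\beta\in(0,\infty)$,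 then for every $k_1,k_2\ge 0$ we have $p(k_1,k_2)=p_\beta(k_1,k_2)+o(1)$. (ii) If $m/n\to+\infty$, then for every $k_1,k_2\ge 0$ we have $p(k_1,k_2)=p_\infty(k_1,k_2)+o(1)$. -/

import Mathlib

open MeasureTheory ProbabilityTheory Filter Topology
open scoped BigOperators Nat

noncomputable section

namespace RandomIntersection

/-! ### The random bipartite graph and the random intersection graph -/

/-- A bipartite graph on `{w_1, …, w_m} ∪ {v_1, …, v_n}`: `h i j = true` means that the
attribute `w_i` is linked to the actor `v_j`. -/
abbrev Bipartite (m n : ℕ) : Type := Fin m → Fin n → Bool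

/-- The intersection graph on the actors: two distinct actors are adjacent whenever they have a
common neighbour among the attributes. -/
def intersectionGraph {m n : ℕ} (h : Bipartite m n) : SimpleGraph (Fin n) where
  Adj u v := u ≠ v ∧ ∃ i, h i u = true ∧ h i v = true
  symm := ⟨fun _ _ ⟨hne, i, hu, hv⟩ => ⟨hne.symm, i, hv, hu⟩⟩
  loopless := ⟨fun _ ⟨hne, _⟩ => hne rfl⟩

/-- The degree `d(v)` of the actor `v` in the intersection graph. -/
def deg {m n : ℕ} (h : Bipartite m n) (v : Fin n) : ℕ :=
  ((intersectionGraph h).neighborSet v).ncard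

/-- The linking probability `min {1, x y / √(n m)}` for weights `x, y ≥ 0`. It is moreover cut
off at `0`, so as to be a number of the unit interval also for negative weights, which have
probability zero. -/
def linkProb (m n : ℕ) (x y : ℝ) : unitInterval :=
  ⟨max 0 (min 1 (x * y / √((n : ℝ) * (m : ℝ)))),
    le_max_left _ _, max_le zero_le_one (min_le_left _ _)⟩

/-- The law of the random bipartite graph for given weights `x_1, …, x_m`, `y_1, …, y_n`: the
pairs `(w_i, v_j)` are linked independently, with probabilities `linkProb m n (x i) (y j)`. -/
def linkMeasure (m n : ℕ) (x : Fin m → ℝ) (y : Fin n → ℝ) : Measure (Bipartite m n) :=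
  Measure.pi fun i => Measure.pi fun j => bernoulliMeasure true false (linkProb m n (x i) (y j))

instance instIsProbabilityMeasureLinkMeasure (m n : ℕ) (x : Fin m → ℝ) (y : Fin n → ℝ) :
    IsProbabilityMeasure (linkMeasure m n x y) := by
  unfold linkMeasure
  infer_instance

theorem measurable_linkProb (m n : ℕ) :
    Measurable fun z : ℝ × ℝ => linkProb m n z.1 z.2 := by
  unfold linkProb
  refine Measurable.subtype_mk ?_
  fun_prop

theorem measurable_linkMeasure (m n : ℕ) :
    Measurable fun z : (Fin m → ℝ) × (Fin n → ℝ) => linkMeasure m n z.1 z.2 := by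
  have key : ∀ h : Bipartite m n, Measurable fun z : (Fin m → ℝ) × (Fin n → ℝ) =>
      linkMeasure m n z.1 z.2 {h} := by
    intro h
    simp only [linkMeasure, Measure.pi_singleton]
    refine Finset.measurable_prod _ fun i _ => Finset.measurable_prod _ fun j _ => ?_
    have hm : Measurable fun z : (Fin m → ℝ) × (Fin n → ℝ) =>
        linkProb m n (z.1 i) (z.2 j) :=
      Measurable.comp (g := fun w : ℝ × ℝ => linkProb m n w.1 w.2)
        (f := fun z : (Fin m → ℝ) × (Fin n → ℝ) => (z.1 i, z.2 j)) (measurable_linkProb m n)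
        (((measurable_pi_apply i).comp measurable_fst).prodMk
          ((measurable_pi_apply j).comp measurable_snd))
    have hv : Measurable fun z : (Fin m → ℝ) × (Fin n → ℝ) =>
        ((linkProb m n (z.1 i) (z.2 j) : unitInterval) : ℝ) := measurable_subtype_coe.comp hm
    cases hb : h i j
    · have : ∀ p : unitInterval, bernoulliMeasure true false p {false}
          = ENNReal.ofReal (1 - (p : ℝ)) := by
        intro p
        rw [← ENNReal.ofReal_toReal (measure_ne_top (bernoulliMeasure true false p) {false}),
          ← measureReal_def, bernoulliMeasure_real_apply_of_notMem_of_mem] <;> simp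
      simp only [this]
      fun_prop
    · have : ∀ p : unitInterval, bernoulliMeasure true false p {true}
          = ENNReal.ofReal (p : ℝ) := by
        intro p
        rw [← ENNReal.ofReal_toReal (measure_ne_top (bernoulliMeasure true false p) {true}),
          ← measureReal_def, bernoulliMeasure_real_apply_of_mem_of_notMem] <;> simp
      simp only [this]
      fun_prop
  refine Measure.measurable_of_measurable_coe _ fun s _ => ?_
  classical
  have hs : ∀ z : (Fin m → ℝ) × (Fin n → ℝ), linkMeasure m n z.1 z.2 s
      = ∑ h ∈ s.toFinite.toFinset, linkMeasure m n z.1 z.2 {h} := by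
    intro z
    rw [sum_measure_singleton]
    simp
  simp only [hs]
  exact Finset.measurable_sum _ fun h _ => key h

/-- The conditional law of the random bipartite graph given the weights, as a Markov kernel. -/
def linkKernel (m n : ℕ) : Kernel ((Fin m → ℝ) × (Fin n → ℝ)) (Bipartite m n) where
  toFun z := linkMeasure m n z.1 z.2
  measurable' := measurable_linkMeasure m n

instance instIsMarkovKernelLinkKernel (m n : ℕ) : IsMarkovKernel (linkKernel m n) :=
  ⟨fun z => instIsProbabilityMeasureLinkMeasure m n z.1 z.2⟩

/-- The law of the weights: `X_1, …, X_m, Y_1, …, Y_n` are independent, every `X_i` has law `P₁`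
and every `Y_j` has law `P₂`. -/
def weightLaw (P₁ P₂ : Measure ℝ) (m n : ℕ) : Measure ((Fin m → ℝ) × (Fin n → ℝ)) :=
  (Measure.pi fun _ : Fin m => P₁).prod (Measure.pi fun _ : Fin n => P₂)

/-- The (unconditional) law of the random bipartite graph `H_{X,Y}`. -/
def bipartiteLaw (P₁ P₂ : Measure ℝ) (m n : ℕ) : Measure (Bipartite m n) :=
  (weightLaw P₁ P₂ m n).bind (linkKernel m n)

instance instIsProbabilityMeasureBipartiteLaw (P₁ P₂ : Measure ℝ) [IsProbabilityMeasure P₁]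
    [IsProbabilityMeasure P₂] (m n : ℕ) : IsProbabilityMeasure (bipartiteLaw P₁ P₂ m n) := by
  have : IsProbabilityMeasure (weightLaw P₁ P₂ m n) := by unfold weightLaw; infer_instance
  unfold bipartiteLaw
  infer_instance

/-- The degree-degree probability
`p(k₁, k₂) = P(d(u) = k₁ + 1, d(v) = k₂ + 1 | u ∼ v)` of two actors `u, v`. -/
def degreeDegree (P₁ P₂ : Measure ℝ) (m n : ℕ) (u v : Fin n) (k₁ k₂ : ℕ) : ℝ :=
  (cond (bipartiteLaw P₁ P₂ m n) {h | (intersectionGraph h).Adj u v}).real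
    {h | deg h u = k₁ + 1 ∧ deg h v = k₂ + 1}

/-! ### The limiting probabilities -/

/-- The moment `∫ x ^ i dP`. -/
def moment (P : Measure ℝ) (i : ℕ) : ℝ := ∫ x, x ^ i ∂P

/-- The probability `e^{-t} t^r / r!` of the Poisson distribution with mean `t ≥ 0`. -/
def poissonProb (t : ℝ) (r : ℕ) : ℝ := Real.exp (-t) * t ^ r / (r ! : ℝ)

/-- `P(Λ = r) = E e^{-λ} λ^r / r!` for the mixed Poisson variable `Λ` with random intensity
`λ = c Z`, where `Z` has law `P`. -/
def mixedPoisson (P : Measure ℝ) (c : ℝ) (r : ℕ) : ℝ := ∫ z, poissonProb (c * z) r ∂P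

/-- The expectation of an integer valued variable with probabilities `f 0, f 1, …`. -/
def mean (f : ℕ → ℝ) : ℝ := ∑' r : ℕ, (r : ℝ) * f r

/-- `P(Λ₀ = r)`, where `Λ₀` is mixed Poisson with intensity `λ₀ = X₁ b₁ β^{-1/2}`. -/
def probΛ₀ (P₁ P₂ : Measure ℝ) (β : ℝ) : ℕ → ℝ := mixedPoisson P₁ (moment P₂ 1 / √β)

/-- `P(Λ₃ = r)`, where `Λ₃` is mixed Poisson with intensity `λ₃ = Y₁ a₂ b₁`. -/
def probΛ₃ (P₁ P₂ : Measure ℝ) : ℕ → ℝ := mixedPoisson P₂ (moment P₁ 2 * moment P₂ 1)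

/-- `P(τ₁ = r) = (r + 1) P(Λ₀ = r + 1) / E Λ₀`. -/
def probτ (P₁ P₂ : Measure ℝ) (β : ℝ) (r : ℕ) : ℝ :=
  ((r : ℝ) + 1) / mean (probΛ₀ P₁ P₂ β) * probΛ₀ P₁ P₂ β (r + 1)

/-- `P(τ₁ + ⋯ + τ_k = r)` for independent integer valued `τ_j` with `P(τ_j = s) = f s`. -/
def sumProb (f : ℕ → ℝ) (k r : ℕ) : ℝ :=
  ∑ t ∈ Finset.piAntidiag (Finset.univ : Finset (Fin k)) r, ∏ j, f (t j)

/-- The compound Poisson probability `P(τ₁ + ⋯ + τ_N = r)`, where `P(τ_j = s) = f s`, `N` is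
Poisson with mean `t`, and `N, τ₁, τ₂, …` are independent. -/
def compoundPoisson (f : ℕ → ℝ) (t : ℝ) (r : ℕ) : ℝ :=
  ∑' k : ℕ, poissonProb t k * sumProb f k r

/-- `P(d*_y = r)`, with `N = N_y` of mean `y a₁ β^{1/2}`. -/
def probDStar (P₁ P₂ : Measure ℝ) (β y : ℝ) (r : ℕ) : ℝ :=
  compoundPoisson (probτ P₁ P₂ β) (y * moment P₁ 1 * √β) r

/-- `q_r = E (Y₁ P(d*_{Y₁} = r))`. -/
def q (P₁ P₂ : Measure ℝ) (β : ℝ) (r : ℕ) : ℝ := ∫ y, y * probDStar P₁ P₂ β y r ∂P₂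

/-- The limiting probabilities `p_β(k₁, k₂)` in the case `m / n → β ∈ (0, ∞)`. -/
def pBeta (P₁ P₂ : Measure ℝ) (β : ℝ) (k₁ k₂ : ℕ) : ℝ :=
  β / (moment P₂ 1 ^ 4 * moment P₁ 2) *
    ∑ r ∈ Finset.range (min k₁ k₂ + 1),
      ((r : ℝ) + 1) * ((r : ℝ) + 2) * probΛ₀ P₁ P₂ β (r + 2) *
        q P₁ P₂ β (k₁ - r) * q P₁ P₂ β (k₂ - r)

/-- The size biased law `p̃(r) = r P(Λ₃ = r) / E Λ₃`. -/
def pTilde (P₁ P₂ : Measure ℝ) (r : ℕ) : ℝ :=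
  (r : ℝ) * probΛ₃ P₁ P₂ r / mean (probΛ₃ P₁ P₂)

/-- The limiting probabilities `p_∞(k₁, k₂) = p̃(k₁ + 1) p̃(k₂ + 1)` in the case
`m / n → ∞`. -/
def pInfty (P₁ P₂ : Measure ℝ) (k₁ k₂ : ℕ) : ℝ :=
  pTilde P₁ P₂ (k₁ + 1) * pTilde P₁ P₂ (k₂ + 1)

end RandomIntersection

end

/-!
The joint generating function of the numbers of further neighbours of two adjacent actors can be
computed exactly for finite `n` and `m`, and its limit is the generating function of the limiting
probabilities.

Let `N = √(nm)`, and fix the weights `y₀, y₁` of the two actors. Record for every attribute its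
weight and its two links to these actors. These triples are independent, with law `attrLaw`, and
given them the other `n - 2` actors contribute independent factors with one and the same mean
`meanGF`. Hence (`integral_bipartiteLaw_hitGF`)

  `n E [1{v₁ ∼ v₂} s ^ (d(v₁) - 1) t ^ (d(v₂) - 1)]`

is an integral over `y₀, y₁` of `n E [common * meanGF ^ (n - 2)]`. An actor of weight `y` meets no
attribute linked to `v₁` with probability close to `exp (-y/N * ∑ x i)`, the sum running over these
attributes. Two estimates give the limit:

* the event `common` has probability of order `1 / n`, and up to a smaller error it is the sum over
  `i` of the events that the `i`-th attribute is linked to both actors, which have probability about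
  `y₀ y₁ E X² / N²` each and bias the law of `x i` by the square of its value;
* `1 - meanGF` is close to `E Y / N` times a sum over the attributes linked to `v₁` or `v₂` of their
  weights, with the factors `1 - s`, `1 - t`, `1 - s t` that depend on these links. Hence
  `meanGF ^ (n - 2)` is close to an exponential which factorizes over the attributes. The
  coefficient `n / N * E Y` of the weights in the exponent tends to `b₁ / √β`, or to `0` if
  `m / n → ∞`. As `X` has two moments only, the error is estimated after truncating the weight of
  the linked attributes (`mul_sum_integral_both_mul_abs_le`).

Thus (`tendsto_mul_integral_common`) the limit is
`y₀ y₁ * limA (s t) * exp (-(y₀ * limRate s + y₁ * limRate t))`, where `limA` comes from the one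
common attribute, whose other actors are neighbours of both `v₁` and `v₂`, and `limRate` comes from
the many attributes linked to one of the two actors only. Since
`n E [common * f] ≤ y₀ y₁ E X²` for `0 ≤ f ≤ 1` (`mul_integral_common_mul_le`), dominated
convergence needs only `E Y < ∞`, and yields the limit `limA (s t) * limB s * limB t`. For
`s = t = 1` this is `a₂ b₁²`, the limit of `n P(v₁ ∼ v₂)`.

Convergence of the generating functions on `(0, 1)²` gives convergence of the coefficients
(`tendsto_coeff_of_tendsto_tsum_tsum`), and the product form turns the limiting coefficients into
the sum over `r` in `pBeta`. It remains to identify the series: `limA` is the generating function of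
`(r + 1) (r + 2) P(Λ₀ = r + 2)`, up to a factor, and `limB` that of `q_r` (`hasSum_probΛ₀`,
`hasSum_q`). If `m / n → ∞`, then `limA` is constant and `limB` generates `b₁ p̃(r + 1)`
(`hasSum_pTilde`).
-/

namespace RandomIntersection

/-! ### Elementary inequalities -/

theorem one_sub_sum_le_prod_one_sub {ι : Type*} (S : Finset ι) (p : ι → ℝ)
    (h0 : ∀ i ∈ S, 0 ≤ p i) (h1 : ∀ i ∈ S, p i ≤ 1) :
    1 - ∑ i ∈ S, p i ≤ ∏ i ∈ S, (1 - p i) := by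
  classical
  induction S using Finset.induction_on with
  | empty => simp
  | insert a S ha ih =>
    rw [Finset.sum_insert ha, Finset.prod_insert ha]
    have ih' := ih (fun i hi => h0 i (Finset.mem_insert_of_mem hi))
      (fun i hi => h1 i (Finset.mem_insert_of_mem hi))
    have ha0 := h0 a (Finset.mem_insert_self _ _)
    have ha1 := h1 a (Finset.mem_insert_self _ _)
    have hs : 0 ≤ ∑ i ∈ S, p i :=
      Finset.sum_nonneg fun i hi => h0 i (Finset.mem_insert_of_mem hi)
    nlinarith [mul_le_mul_of_nonneg_left ih' (sub_nonneg.2 ha1), mul_nonneg ha0 hs]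

theorem exp_neg_le_one_sub_add_sq {x : ℝ} (hx : 0 ≤ x) : Real.exp (-x) ≤ 1 - x + x ^ 2 := by
  rcases le_or_gt x 1 with h | h
  · have := Real.abs_exp_sub_one_sub_id_le (x := -x) (by rwa [abs_neg, abs_of_nonneg hx])
    rw [abs_le] at this
    nlinarith [this.2]
  · have : Real.exp (-x) ≤ 1 := Real.exp_le_one_iff.2 (by linarith)
    nlinarith

theorem prod_one_sub_le_one_sub_sum_add_sq {ι : Type*} (S : Finset ι) (p : ι → ℝ)
    (h0 : ∀ i ∈ S, 0 ≤ p i) (h1 : ∀ i ∈ S, p i ≤ 1) :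
    ∏ i ∈ S, (1 - p i) ≤ 1 - ∑ i ∈ S, p i + (∑ i ∈ S, p i) ^ 2 := by
  calc ∏ i ∈ S, (1 - p i) ≤ ∏ i ∈ S, Real.exp (-p i) :=
        Finset.prod_le_prod (fun i hi => sub_nonneg.2 (h1 i hi))
          fun i _ => Real.one_sub_le_exp_neg _
    _ = Real.exp (-∑ i ∈ S, p i) := by rw [← Real.exp_sum, Finset.sum_neg_distrib]
    _ ≤ _ := exp_neg_le_one_sub_add_sq (Finset.sum_nonneg h0)

theorem abs_pow_sub_pow_le_mul {a b : ℝ} (ha0 : 0 ≤ a) (ha : a ≤ 1) (hb0 : 0 ≤ b) (hb : b ≤ 1)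
    (k : ℕ) : |a ^ k - b ^ k| ≤ k * |a - b| := by
  refine (abs_pow_sub_pow_le a b k).trans ?_
  have : max |a| |b| ^ (k - 1) ≤ 1 :=
    pow_le_one₀ (le_max_of_le_left (abs_nonneg _))
      (max_le (by rwa [abs_of_nonneg ha0]) (by rwa [abs_of_nonneg hb0]))
  calc |a - b| * k * max |a| |b| ^ (k - 1) ≤ |a - b| * k * 1 := by gcongr
    _ = _ := by ring

theorem abs_pow_sub_exp_le {a x : ℝ} (ha0 : 0 ≤ a) (ha : a ≤ 1) (hx : 0 ≤ x) (k : ℕ) :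
    |a ^ k - Real.exp (-(k * x))| ≤ k * (|1 - a - x| + x ^ 2) := by
  have h : Real.exp (-(k * x)) = Real.exp (-x) ^ k := by
    rw [← Real.exp_nat_mul]; congr 1; ring
  rw [h]
  refine (abs_pow_sub_pow_le_mul ha0 ha (Real.exp_pos _).le
    (Real.exp_le_one_iff.2 (by linarith)) k).trans ?_
  gcongr
  have h1 := exp_neg_le_one_sub_add_sq hx
  have h2 := Real.one_sub_le_exp_neg x
  have h3 := abs_le.1 (le_refl |1 - a - x|)
  rw [abs_le]
  constructor <;> linarith [h3.1, h3.2]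

/-- The Poisson limit `(1 - u / m) ^ (m - 1) → e ^ (-c)` for `u → c`, along any sequence. -/
theorem tendsto_pow_pred_exp {ι : Type*} {F : Filter ι} {m : ι → ℕ} (hm : Tendsto m F atTop)
    {a : ι → ℝ} (ha0 : ∀ l, 0 ≤ a l) (ha1 : ∀ l, a l ≤ 1) {c : ℝ}
    (h : Tendsto (fun l => (m l : ℝ) * (1 - a l)) F (𝓝 c)) :
    Tendsto (fun l => a l ^ (m l - 1)) F (𝓝 (Real.exp (-c))) := by
  have hmR : Tendsto (fun l => (m l : ℝ)) F atTop := tendsto_natCast_atTop_atTop.comp hm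
  have hinv : Tendsto (fun l => ((m l : ℝ))⁻¹) F (𝓝 0) := tendsto_inv_atTop_zero.comp hmR
  have hev : ∀ᶠ l in F, 1 ≤ m l := hm.eventually_ge_atTop 1
  have h1 : Tendsto (fun l => ((m l - 1 : ℕ) : ℝ) * (1 - a l)) F (𝓝 c) := by
    have : Tendsto (fun l => (m l : ℝ) * (1 - a l) - ((m l : ℝ) * (1 - a l)) * (m l : ℝ)⁻¹) F
        (𝓝 (c - c * 0)) := h.sub (h.mul hinv)
    rw [mul_zero, sub_zero] at this
    refine this.congr' ?_
    filter_upwards [hev] with l hl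
    have : (m l : ℝ) ≠ 0 := by positivity
    push_cast [Nat.cast_sub hl]
    field_simp
  have h2 : Tendsto (fun l => Real.exp (-(((m l - 1 : ℕ) : ℝ) * (1 - a l)))) F
      (𝓝 (Real.exp (-c))) := (Real.continuous_exp.tendsto _).comp h1.neg
  have h3 : Tendsto (fun l => a l ^ (m l - 1) - Real.exp (-(((m l - 1 : ℕ) : ℝ) * (1 - a l)))) F
      (𝓝 0) := by
    have hb : Tendsto (fun l => ((m l : ℝ) * (1 - a l)) ^ 2 * (m l : ℝ)⁻¹) F (𝓝 (c ^ 2 * 0)) :=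
      (h.pow 2).mul hinv
    rw [mul_zero] at hb
    refine squeeze_zero_norm' ?_ hb
    filter_upwards [hev] with l hl
    rw [Real.norm_eq_abs]
    refine (abs_pow_sub_exp_le (ha0 l) (ha1 l) (sub_nonneg.2 (ha1 l)) _).trans ?_
    have hp : (0 : ℝ) < m l := by exact_mod_cast hl
    have hle : ((m l - 1 : ℕ) : ℝ) ≤ m l := by exact_mod_cast Nat.sub_le _ _
    have hr : ((m l : ℝ) * (1 - a l)) ^ 2 * (m l : ℝ)⁻¹ = m l * (1 - a l) ^ 2 := by field_simp
    rw [hr]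
    simp only [sub_self, abs_zero, zero_add]
    gcongr
  simpa using h3.add h2

/-! ### Convergence of coefficients from convergence of generating functions -/

theorem summable_mul_pow {f : ℕ → ℝ} {C s : ℝ} (hf : ∀ k, |f k| ≤ C) (h0 : 0 ≤ s) (h1 : s < 1) :
    Summable fun k => f k * s ^ k := by
  refine Summable.of_norm_bounded ((summable_geometric_of_lt_one h0 h1).mul_left C) fun k => ?_
  rw [norm_mul, norm_pow, Real.norm_eq_abs, Real.norm_of_nonneg h0]
  exact mul_le_mul_of_nonneg_right (hf k) (pow_nonneg h0 k)

/-- The case of limit zero. The constant coefficient is recovered by letting `s` tend to `0`, the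
tail of the series being bounded uniformly; the next coefficient follows after dividing by `s`. -/
theorem tendsto_coeff_zero_of_tendsto_tsum {ι : Type*} {F : Filter ι} {C : ℝ} (k : ℕ) :
    ∀ f : ι → ℕ → ℝ, (∀ l k, |f l k| ≤ C) →
      (∀ s : ℝ, 0 < s → s < 1 → Tendsto (fun l => ∑' k, f l k * s ^ k) F (𝓝 0)) →
      Tendsto (fun l => f l k) F (𝓝 0) := by
  have hsplit : ∀ f : ι → ℕ → ℝ, (∀ l k, |f l k| ≤ C) → ∀ s : ℝ, 0 < s → s < 1 → ∀ l,
      ∑' k, f l k * s ^ k = f l 0 + s * ∑' k, f l (k + 1) * s ^ k := by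
    intro f hf s h0 h1 l
    rw [(summable_mul_pow (hf l) h0.le h1).tsum_eq_zero_add, ← tsum_mul_left]
    congr 1
    · simp
    · exact tsum_congr fun k => by ring
  have hzero : ∀ f : ι → ℕ → ℝ, (∀ l k, |f l k| ≤ C) →
      (∀ s : ℝ, 0 < s → s < 1 → Tendsto (fun l => ∑' k, f l k * s ^ k) F (𝓝 0)) →
      Tendsto (fun l => f l 0) F (𝓝 0) := by
    intro f hf h
    rw [Metric.tendsto_nhds]
    intro ε hε
    rcases F.eq_or_neBot with rfl | hne
    · simp
    obtain ⟨l₀⟩ : Nonempty ι := F.nonempty_of_neBot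
    have hC : 0 ≤ C := (abs_nonneg _).trans (hf l₀ 0)
    -- the tail of the series is at most `2 C s ≤ ε / 2`
    set s : ℝ := min (1 / 2) (ε / (4 * (C + 1))) with hs
    have hs0 : 0 < s := lt_min (by norm_num) (by positivity)
    have hs2 : s ≤ 1 / 2 := min_le_left _ _
    have hs1 : s < 1 := by linarith
    have hsε : s * (2 * C) ≤ ε / 2 := by
      have : s ≤ ε / (4 * (C + 1)) := min_le_right _ _
      calc s * (2 * C) ≤ ε / (4 * (C + 1)) * (2 * (C + 1)) := by gcongr; linarith
        _ = ε / 2 := by field_simp; norm_num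
    have h' := (Metric.tendsto_nhds.1 (h s hs0 hs1)) (ε / 2) (by positivity)
    filter_upwards [h'] with l hl
    rw [Real.dist_eq, sub_zero] at hl ⊢
    rw [hsplit f hf s hs0 hs1 l] at hl
    have htail : |∑' k, f l (k + 1) * s ^ k| ≤ 2 * C := by
      have hsum := summable_mul_pow (f := fun _ => C) (C := C)
        (fun _ => (abs_of_nonneg hC).le) hs0.le hs1
      have := tsum_of_norm_bounded (f := fun k => f l (k + 1) * s ^ k) hsum.hasSum fun k => by
        rw [norm_mul, norm_pow, Real.norm_eq_abs, Real.norm_of_nonneg hs0.le]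
        exact mul_le_mul_of_nonneg_right (hf l _) (pow_nonneg hs0.le k)
      rw [Real.norm_eq_abs, tsum_mul_left, tsum_geometric_of_lt_one hs0.le hs1] at this
      refine this.trans ?_
      rw [mul_comm 2 C]
      gcongr
      rw [inv_le_comm₀ (by linarith) (by norm_num)]
      linarith
    have h2 : |s * ∑' k, f l (k + 1) * s ^ k| ≤ ε / 2 := by
      rw [abs_mul, abs_of_pos hs0]
      exact (mul_le_mul_of_nonneg_left htail hs0.le).trans hsε
    rw [abs_lt] at hl ⊢
    rw [abs_le] at h2
    constructor <;> linarith [hl.1, hl.2, h2.1, h2.2]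
  induction k with
  | zero => exact hzero
  | succ k ih =>
    intro f hf h
    refine ih (fun l j => f l (j + 1)) (fun l j => hf l (j + 1)) fun s h0 h1 => ?_
    have := ((h s h0 h1).sub (hzero f hf h)).const_mul s⁻¹
    rw [sub_zero, mul_zero] at this
    refine this.congr fun l => ?_
    rw [hsplit f hf s h0 h1 l]
    field_simp
    ring

/-- The continuity theorem for generating functions: for uniformly bounded coefficients, pointwise
convergence of the power series on `(0, 1)` forces convergence of every coefficient. -/
theorem tendsto_coeff_of_tendsto_tsum {ι : Type*} {F : Filter ι} {C : ℝ} {f : ι → ℕ → ℝ}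
    {g : ℕ → ℝ} (hf : ∀ l k, |f l k| ≤ C) (hg : ∀ k, |g k| ≤ C)
    (h : ∀ s : ℝ, 0 < s → s < 1 →
      Tendsto (fun l => ∑' k, f l k * s ^ k) F (𝓝 (∑' k, g k * s ^ k))) (k : ℕ) :
    Tendsto (fun l => f l k) F (𝓝 (g k)) := by
  have := tendsto_coeff_zero_of_tendsto_tsum (F := F) (C := C + C) k (fun l k => f l k - g k)
    (fun l k => (abs_sub _ _).trans (add_le_add (hf l k) (hg k))) fun s h0 h1 => by
      have h2 := (h s h0 h1).sub_const (∑' k, g k * s ^ k)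
      rw [sub_self] at h2
      refine h2.congr fun l => ?_
      rw [← (summable_mul_pow (hf l) h0.le h1).tsum_sub (summable_mul_pow hg h0.le h1)]
      exact tsum_congr fun k => by ring
  simpa using this.add_const (g k)

/-! ### Generating functions of mixed and compound Poisson probabilities -/

theorem poissonProb_nonneg {t : ℝ} (ht : 0 ≤ t) (r : ℕ) : 0 ≤ poissonProb t r := by
  unfold poissonProb; positivity

theorem hasSum_poissonProb (t s : ℝ) :
    HasSum (fun r => poissonProb t r * s ^ r) (Real.exp (-(t * (1 - s)))) := by
  have h : HasSum (fun r : ℕ => (t * s) ^ r / (r ! : ℝ)) (Real.exp (t * s)) := by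
    rw [Real.exp_eq_exp_ℝ]
    exact NormedSpace.expSeries_div_hasSum_exp (t * s)
  have h2 := h.mul_left (Real.exp (-t))
  rw [← Real.exp_add] at h2
  have he : -(t * (1 - s)) = -t + t * s := by ring
  rw [he]
  refine h2.congr_fun fun r => ?_
  simp only [poissonProb, mul_pow]
  ring

theorem add_one_mul_poissonProb (t : ℝ) (r : ℕ) :
    ((r : ℝ) + 1) * poissonProb t (r + 1) = t * poissonProb t r := by
  unfold poissonProb
  rw [Nat.factorial_succ]
  have : (r ! : ℝ) ≠ 0 := by positivity
  push_cast
  field_simp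
  ring

theorem measurable_poissonProb {α : Type*} [MeasurableSpace α] {f : α → ℝ} (hf : Measurable f)
    (r : ℕ) : Measurable fun z => poissonProb (f z) r := by
  unfold poissonProb; fun_prop

/-- Summation against `s ^ r` commutes with integration, for nonnegative coefficients `g r z`
whose generating function `G z` is at most one. -/
theorem hasSum_integral_mul {P : Measure ℝ} {w : ℝ → ℝ} (hw : Integrable w P)
    (hw0 : ∀ᵐ z ∂P, 0 ≤ w z) {g : ℕ → ℝ → ℝ} (hgm : ∀ r, Measurable (g r))
    (hg0 : ∀ᵐ z ∂P, ∀ r, 0 ≤ g r z) {s : ℝ} (hs : 0 ≤ s) {G : ℝ → ℝ}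
    (hGm : Measurable G) (hG : ∀ᵐ z ∂P, HasSum (fun r => g r z * s ^ r) (G z))
    (hG1 : ∀ᵐ z ∂P, G z ≤ 1) :
    HasSum (fun r => (∫ z, w z * g r z ∂P) * s ^ r) (∫ z, w z * G z ∂P) := by
  have hterm : ∀ᵐ z ∂P, HasSum (fun r => w z * g r z * s ^ r) (w z * G z) := by
    filter_upwards [hG] with z hz
    simpa only [mul_assoc] using hz.mul_left (w z)
  have key := hasSum_integral_of_dominated_convergence (μ := P)
    (F := fun r z => w z * g r z * s ^ r) (f := fun z => w z * G z)
    (fun r z => w z * g r z * s ^ r)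
    (fun r => (hw.aestronglyMeasurable.mul (hgm r).aestronglyMeasurable).mul_const _)
    (fun r => by
      filter_upwards [hw0, hg0] with z h1 h2
      rw [Real.norm_of_nonneg (mul_nonneg (mul_nonneg h1 (h2 r)) (pow_nonneg hs r))])
    (by filter_upwards [hterm] with z hz using hz.summable)
    (by
      have : (fun z => ∑' r, w z * g r z * s ^ r) =ᵐ[P] fun z => w z * G z := by
        filter_upwards [hterm] with z hz using hz.tsum_eq
      rw [integrable_congr this]
      refine hw.mono (hw.aestronglyMeasurable.mul hGm.aestronglyMeasurable) ?_
      filter_upwards [hG, hG1, hg0] with z h1 h2 h3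
      have : 0 ≤ G z := h1.nonneg fun r => mul_nonneg (h3 r) (pow_nonneg hs r)
      rw [norm_mul, Real.norm_of_nonneg this]
      exact mul_le_of_le_one_right (norm_nonneg _) h2)
    hterm
  refine key.congr_fun fun r => ?_
  rw [integral_mul_const]

/-- The generating function of the mixed Poisson coefficients, weighted by `w`. -/
theorem hasSum_integral_mul_poissonProb {P : Measure ℝ} (hP : ∀ᵐ z ∂P, 0 ≤ z) {w : ℝ → ℝ}
    (hw : Integrable w P) (hw0 : ∀ᵐ z ∂P, 0 ≤ w z) {c : ℝ} (hc : 0 ≤ c) {s : ℝ} (hs : 0 ≤ s)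
    (hs1 : s ≤ 1) :
    HasSum (fun r => (∫ z, w z * poissonProb (c * z) r ∂P) * s ^ r)
      (∫ z, w z * Real.exp (-(c * z * (1 - s))) ∂P) := by
  refine hasSum_integral_mul hw hw0 (fun r => measurable_poissonProb (by fun_prop) r) ?_ hs
    (by fun_prop) (Eventually.of_forall fun z => hasSum_poissonProb _ _) ?_
  · filter_upwards [hP] with z hz r using poissonProb_nonneg (mul_nonneg hc hz) r
  · filter_upwards [hP] with z hz
    exact Real.exp_le_one_iff.2
      (neg_nonpos.2 (mul_nonneg (mul_nonneg hc hz) (sub_nonneg.2 hs1)))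

theorem integral_mul_poissonProb_nonneg {P : Measure ℝ} (hP : ∀ᵐ z ∂P, 0 ≤ z) {w : ℝ → ℝ}
    (hw0 : ∀ᵐ z ∂P, 0 ≤ w z) {c : ℝ} (hc : 0 ≤ c) (r : ℕ) :
    0 ≤ ∫ z, w z * poissonProb (c * z) r ∂P := by
  refine integral_nonneg_of_ae ?_
  filter_upwards [hP, hw0] with z hz hwz
  exact mul_nonneg hwz (poissonProb_nonneg (mul_nonneg hc hz) r)

theorem add_one_mul_mixedPoisson (P : Measure ℝ) (c : ℝ) (r : ℕ) :
    ((r : ℝ) + 1) * mixedPoisson P c (r + 1) = c * ∫ z, z * poissonProb (c * z) r ∂P := by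
  unfold mixedPoisson
  rw [← integral_const_mul, ← integral_const_mul]
  refine integral_congr_ae (Eventually.of_forall fun z => ?_)
  simp only
  rw [add_one_mul_poissonProb]
  ring

theorem add_one_mul_add_two_mul_mixedPoisson (P : Measure ℝ) (c : ℝ) (r : ℕ) :
    ((r : ℝ) + 1) * ((r : ℝ) + 2) * mixedPoisson P c (r + 2) =
      c ^ 2 * ∫ z, z ^ 2 * poissonProb (c * z) r ∂P := by
  unfold mixedPoisson
  rw [← integral_const_mul, ← integral_const_mul]
  refine integral_congr_ae (Eventually.of_forall fun z => ?_)
  simp only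
  have h1 := add_one_mul_poissonProb (c * z) (r + 1)
  have h2 := add_one_mul_poissonProb (c * z) r
  push_cast at h1
  calc ((r : ℝ) + 1) * ((r : ℝ) + 2) * poissonProb (c * z) (r + 2)
      = ((r : ℝ) + 1) * ((r + 1 + 1) * poissonProb (c * z) (r + 1 + 1)) := by ring
    _ = c * z * (((r : ℝ) + 1) * poissonProb (c * z) (r + 1)) := by rw [h1]; ring
    _ = _ := by rw [h2]; ring

theorem mean_mixedPoisson {P : Measure ℝ} (hP : ∀ᵐ z ∂P, 0 ≤ z)
    (hint : Integrable (fun z => z) P) {c : ℝ} (hc : 0 ≤ c) :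
    mean (mixedPoisson P c) = c * moment P 1 := by
  have h : HasSum (fun r => c * ((∫ z, z * poissonProb (c * z) r ∂P) * 1 ^ r))
      (c * ∫ z, z * Real.exp (-(c * z * (1 - 1))) ∂P) :=
    (hasSum_integral_mul_poissonProb hP hint hP hc (s := 1) zero_le_one le_rfl).mul_left c
  have he : ∫ z, z * Real.exp (-(c * z * (1 - 1))) ∂P = moment P 1 := by
    unfold moment
    refine integral_congr_ae (Eventually.of_forall fun z => ?_)
    simp
  rw [he] at h
  have h2 : HasSum (fun r : ℕ => ((r + 1 : ℕ) : ℝ) * mixedPoisson P c (r + 1))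
      (c * moment P 1) := by
    refine h.congr_fun fun r => ?_
    rw [Nat.cast_add, Nat.cast_one, add_one_mul_mixedPoisson, one_pow, mul_one]
  unfold mean
  rw [tsum_eq_zero_add' (f := fun r : ℕ => (r : ℝ) * mixedPoisson P c r) h2.summable, h2.tsum_eq,
    Nat.cast_zero, zero_mul, zero_add]

/-- `τ` is mixed Poisson with the same intensity as `Λ₀`, under the law of the weight of an
attribute biased by its value. -/
theorem probτ_eq {P₁ P₂ : Measure ℝ} (hP : ∀ᵐ z ∂P₁, 0 ≤ z) (hint : Integrable (fun z => z) P₁)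
    {β : ℝ} (hc : 0 < moment P₂ 1 / √β) (r : ℕ) :
    probτ P₁ P₂ β r =
      (moment P₁ 1)⁻¹ * ∫ z, z * poissonProb (moment P₂ 1 / √β * z) r ∂P₁ := by
  unfold probτ probΛ₀
  rw [mean_mixedPoisson hP hint hc.le, div_mul_eq_mul_div, add_one_mul_mixedPoisson,
    mul_div_mul_left _ _ hc.ne']
  ring

/-! #### Compound Poisson probabilities -/

theorem sumProb_zero (f : ℕ → ℝ) (r : ℕ) : sumProb f 0 r = if r = 0 then 1 else 0 := by
  unfold sumProb
  rw [Finset.univ_eq_empty, Finset.piAntidiag_empty]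
  split_ifs <;> simp

theorem sumProb_succ (f : ℕ → ℝ) (k r : ℕ) :
    sumProb f (k + 1) r = ∑ j ∈ Finset.range (r + 1), f j * sumProb f k (r - j) := by
  unfold sumProb
  simp only [Finset.mul_sum]
  rw [Finset.sum_sigma']
  refine Finset.sum_bij' (fun t _ => ⟨t 0, fun i => t i.succ⟩)
    (fun p _ => Fin.cons p.1 p.2) ?_ ?_ ?_ ?_ ?_
  · intro t ht
    simp only [Finset.mem_piAntidiag, Fin.sum_univ_succ] at ht
    simp only [Finset.mem_sigma, Finset.mem_range, Finset.mem_piAntidiag, Finset.mem_univ,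
      implies_true, and_true]
    omega
  · intro p hp
    simp only [Finset.mem_sigma, Finset.mem_range, Finset.mem_piAntidiag, Finset.mem_univ,
      implies_true, and_true] at hp
    simp only [Finset.mem_piAntidiag, Fin.sum_univ_succ, Fin.cons_zero, Fin.cons_succ,
      Finset.mem_univ, implies_true, and_true]
    rw [hp.2]
    omega
  · intro t _
    funext i
    refine Fin.cases ?_ (fun i => ?_) i <;> simp
  · intro p _
    simp
  · intro t _
    simp [Fin.prod_univ_succ]

theorem sumProb_nonneg {f : ℕ → ℝ} (hf : ∀ r, 0 ≤ f r) (k r : ℕ) : 0 ≤ sumProb f k r :=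
  Finset.sum_nonneg fun _ _ => Finset.prod_nonneg fun _ _ => hf _

theorem hasSum_sumProb {f : ℕ → ℝ} (hf : ∀ r, 0 ≤ f r) {s G : ℝ}
    (h : HasSum (fun r => f r * s ^ r) G) (k : ℕ) :
    HasSum (fun r => sumProb f k r * s ^ r) (G ^ k) := by
  induction k with
  | zero =>
    rw [pow_zero]
    refine (hasSum_ite_eq 0 (1 : ℝ)).congr_fun fun r => ?_
    rw [sumProb_zero]
    split_ifs with hr <;> simp [hr]
  | succ k ih =>
    have hn : ∀ g : ℕ → ℝ, (∀ r, 0 ≤ g r) → (Summable fun r => g r * s ^ r) →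
        Summable fun r => ‖g r * s ^ r‖ := fun g _ hg => hg.norm
    have := hasSum_sum_range_mul_of_summable_norm (hn f hf h.summable)
      (hn _ (sumProb_nonneg hf k) ih.summable)
    rw [h.tsum_eq, ih.tsum_eq, ← pow_succ'] at this
    refine this.congr_fun fun r => ?_
    rw [sumProb_succ, Finset.sum_mul]
    refine Finset.sum_congr rfl fun j hj => ?_
    have hj' : j ≤ r := Nat.lt_succ_iff.1 (Finset.mem_range.1 hj)
    have : s ^ r = s ^ j * s ^ (r - j) := by rw [← pow_add, Nat.add_sub_cancel' hj']
    rw [this]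
    ring

theorem compoundPoisson_nonneg {f : ℕ → ℝ} (hf : ∀ r, 0 ≤ f r) {t : ℝ} (ht : 0 ≤ t) (r : ℕ) :
    0 ≤ compoundPoisson f t r :=
  tsum_nonneg fun k => mul_nonneg (poissonProb_nonneg ht k) (sumProb_nonneg hf k r)

theorem hasSum_compoundPoisson {f : ℕ → ℝ} (hf : ∀ r, 0 ≤ f r) {s G : ℝ} (hs : 0 < s)
    (h : HasSum (fun r => f r * s ^ r) G) {t : ℝ} (ht : 0 ≤ t) :
    HasSum (fun r => compoundPoisson f t r * s ^ r) (Real.exp (-(t * (1 - G)))) := by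
  set F : ℕ × ℕ → ℝ := fun p => poissonProb t p.1 * sumProb f p.1 p.2 * s ^ p.2 with hF
  have hF0 : 0 ≤ F := fun p => mul_nonneg
    (mul_nonneg (poissonProb_nonneg ht _) (sumProb_nonneg hf _ _)) (pow_nonneg hs.le _)
  have hrow : ∀ k, HasSum (fun r => F (k, r)) (poissonProb t k * G ^ k) := fun k => by
    simpa only [hF, mul_assoc] using (hasSum_sumProb hf h k).mul_left (poissonProb t k)
  have hsum : Summable F := by
    rw [summable_prod_of_nonneg hF0]
    refine ⟨fun k => (hrow k).summable, ?_⟩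
    simp only [(hrow _).tsum_eq]
    exact (hasSum_poissonProb t G).summable
  have htot : HasSum F (Real.exp (-(t * (1 - G)))) := by
    have h1 := hsum.hasSum.prod_fiberwise hrow
    rw [(hasSum_poissonProb t G).unique h1]
    exact hsum.hasSum
  have hsw : HasSum (F ∘ Prod.swap) (Real.exp (-(t * (1 - G)))) :=
    (Equiv.prodComm ℕ ℕ).hasSum_iff.2 htot
  refine hsw.prod_fiberwise fun r => ?_
  have h2 : Summable fun k => (F ∘ Prod.swap) (r, k) := hsw.summable.prod_factor r
  have h3 : (fun k => (F ∘ Prod.swap) (r, k)) =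
      fun k => poissonProb t k * sumProb f k r * s ^ r := rfl
  rw [h3] at h2 ⊢
  have hne : s ^ r ≠ 0 := (pow_pos hs r).ne'
  exact ((summable_mul_right_iff hne).1 h2).hasSum.mul_right _

theorem measurable_compoundPoisson (f : ℕ → ℝ) (r : ℕ) :
    Measurable fun t => compoundPoisson f t r :=
  Measurable.tsum fun k => (measurable_poissonProb measurable_id k).mul_const _

/-! ### Two-variable generating functions -/

/-- A family `u l j k` whose two-variable generating functions converge to `A (s t) B (s) B (t)`
converges coefficientwise. The continuity theorem is applied first in `s`, then in `t`. -/
theorem tendsto_coeff_of_tendsto_tsum_tsum {ι : Type*} {F : Filter ι} {C : ℝ} {u : ι → ℕ → ℕ → ℝ}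
    (hu0 : ∀ l j k, 0 ≤ u l j k) (hu : ∀ l j k, u l j k ≤ C) {α θ : ℕ → ℝ} {A B : ℝ → ℝ}
    (hα0 : ∀ r, 0 ≤ α r) (hθ0 : ∀ r, 0 ≤ θ r)
    (hα : ∀ s : ℝ, 0 < s → s ≤ 1 → HasSum (fun r => α r * s ^ r) (A s))
    (hθ : ∀ s : ℝ, 0 < s → s ≤ 1 → HasSum (fun r => θ r * s ^ r) (B s))
    (h : ∀ s t : ℝ, 0 < s → s < 1 → 0 < t → t < 1 →
      Tendsto (fun l => ∑' j, (∑' k, u l j k * t ^ k) * s ^ j) F (𝓝 (A (s * t) * B s * B t)))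
    (j k : ℕ) :
    Tendsto (fun l => u l j k) F
      (𝓝 (∑ r ∈ Finset.range (min j k + 1), α r * θ (j - r) * θ (k - r))) := by
  have hB0 : ∀ s : ℝ, 0 < s → s ≤ 1 → 0 ≤ B s := fun s h0 h1 =>
    (hθ s h0 h1).nonneg fun r => mul_nonneg (hθ0 r) (pow_nonneg h0.le r)
  -- the coefficient of `s ^ j` in `A (s t) B (s) B (t)`
  set g : ℝ → ℕ → ℝ := fun t j =>
    (∑ r ∈ Finset.range (j + 1), α r * t ^ r * θ (j - r)) * B t with hg
  have hg0 : ∀ t : ℝ, 0 < t → t ≤ 1 → ∀ j, 0 ≤ g t j := fun t h0 h1 j =>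
    mul_nonneg (Finset.sum_nonneg fun r _ =>
      mul_nonneg (mul_nonneg (hα0 r) (pow_nonneg h0.le r)) (hθ0 _)) (hB0 t h0 h1)
  have hgs : ∀ s t : ℝ, 0 < s → s ≤ 1 → 0 < t → t ≤ 1 →
      HasSum (fun j => g t j * s ^ j) (A (s * t) * B s * B t) := by
    intro s t hs hs1 ht ht1
    have h1 := hα (s * t) (mul_pos hs ht) (mul_le_one₀ hs1 ht.le ht1)
    have h2 := hθ s hs hs1
    have h3 := (hasSum_sum_range_mul_of_summable_norm h1.summable.norm
      h2.summable.norm).mul_right (B t)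
    rw [h1.tsum_eq, h2.tsum_eq] at h3
    refine h3.congr_fun fun j => ?_
    simp only [hg]
    rw [mul_right_comm, Finset.sum_mul]
    congr 1
    refine Finset.sum_congr rfl fun r hr => ?_
    have hj' : r ≤ j := Nat.lt_succ_iff.1 (Finset.mem_range.1 hr)
    have : s ^ j = s ^ r * s ^ (j - r) := by rw [← pow_add, Nat.add_sub_cancel' hj']
    rw [this, mul_pow]
    ring
  -- the coefficient of `t ^ k` in `g t j`
  set v : ℕ → ℕ → ℝ := fun j k =>
    ∑ r ∈ Finset.range (min j k + 1), α r * θ (j - r) * θ (k - r) with hv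
  have hvs : ∀ t : ℝ, 0 < t → t ≤ 1 → ∀ j, HasSum (fun k => v j k * t ^ k) (g t j) := by
    intro t ht ht1 j
    set a : ℕ → ℝ := fun r => if r ∈ Finset.range (j + 1) then α r * θ (j - r) else 0 with ha
    have h1 : HasSum (fun r => a r * t ^ r)
        (∑ r ∈ Finset.range (j + 1), α r * t ^ r * θ (j - r)) := by
      have : ∑ r ∈ Finset.range (j + 1), α r * t ^ r * θ (j - r) =
          ∑ r ∈ Finset.range (j + 1), a r * t ^ r :=
        Finset.sum_congr rfl fun r hr => by simp only [ha, if_pos hr]; ring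
      rw [this]
      refine hasSum_sum_of_ne_finset_zero fun r hr => ?_
      simp only [ha, if_neg hr, zero_mul]
    have h2 := hθ t ht ht1
    have h3 := hasSum_sum_range_mul_of_summable_norm h1.summable.norm h2.summable.norm
    rw [h1.tsum_eq, h2.tsum_eq] at h3
    refine h3.congr_fun fun k => ?_
    simp only [hv]
    have hfil : Finset.range (min j k + 1) =
        (Finset.range (k + 1)).filter fun r => r ∈ Finset.range (j + 1) := by
      ext r
      simp only [Finset.mem_range, Finset.mem_filter]
      omega
    rw [hfil, Finset.sum_filter, Finset.sum_mul]
    refine Finset.sum_congr rfl fun r hr => ?_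
    have hj' : r ≤ k := Nat.lt_succ_iff.1 (Finset.mem_range.1 hr)
    have : t ^ k = t ^ r * t ^ (k - r) := by rw [← pow_add, Nat.add_sub_cancel' hj']
    simp only [ha, this]
    split_ifs <;> ring
  have hv0 : ∀ j k, 0 ≤ v j k := fun j k => Finset.sum_nonneg fun r _ =>
    mul_nonneg (mul_nonneg (hα0 r) (hθ0 _)) (hθ0 _)
  rcases F.eq_or_neBot with rfl | hne
  · simp
  obtain ⟨l₀⟩ : Nonempty ι := F.nonempty_of_neBot
  have hC : 0 ≤ C := (hu0 l₀ 0 0).trans (hu l₀ 0 0)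
  have habs : ∀ l j k, |u l j k| ≤ C := fun l j k => by
    rw [abs_of_nonneg (hu0 l j k)]; exact hu l j k
  have step : ∀ t : ℝ, 0 < t → t < 1 → ∀ j,
      Tendsto (fun l => ∑' k, u l j k * t ^ k) F (𝓝 (g t j)) := by
    intro t ht ht1 j
    refine tendsto_coeff_of_tendsto_tsum (f := fun l j => ∑' k, u l j k * t ^ k)
      (C := max (C * (1 - t)⁻¹) (A (1 * t) * B 1 * B t)) (fun l j => ?_) (fun j => ?_)
      (fun s hs hs1 => ?_) j
    · refine le_max_of_le_left ?_
      have hgeo : HasSum (fun k => C * t ^ k) (C * (1 - t)⁻¹) :=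
        (hasSum_geometric_of_lt_one ht.le ht1).mul_left C
      rw [← Real.norm_eq_abs]
      refine tsum_of_norm_bounded hgeo fun k => ?_
      rw [norm_mul, norm_pow, Real.norm_eq_abs, Real.norm_of_nonneg ht.le]
      exact mul_le_mul_of_nonneg_right (habs l j k) (pow_nonneg ht.le k)
    · refine le_max_of_le_right ?_
      rw [abs_of_nonneg (hg0 t ht ht1.le j)]
      have := hgs 1 t one_pos le_rfl ht ht1.le
      simp only [one_pow, mul_one] at this
      exact le_hasSum this j fun i _ => hg0 t ht ht1.le i
    · rw [(hgs s t hs hs1.le ht ht1.le).tsum_eq]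
      exact h s t hs hs1 ht ht1
  refine tendsto_coeff_of_tendsto_tsum (f := fun l k => u l j k) (g := v j)
    (C := max C (g 1 j)) (fun l k => le_max_of_le_left (habs l j k)) (fun k => ?_)
    (fun t ht ht1 => ?_) k
  · refine le_max_of_le_right ?_
    rw [abs_of_nonneg (hv0 j k)]
    have := hvs 1 one_pos le_rfl j
    simp only [one_pow, mul_one] at this
    exact le_hasSum this k fun i _ => hv0 j i
  · rw [(hvs t ht ht1.le j).tsum_eq]
    exact step t ht ht1 j

/-! ### The limiting generating function -/

/-- The function `(1 - e ^ (-v)) / v`, with value `1` at `v = 0`. -/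
noncomputable def expQuot (v : ℝ) : ℝ := dslope (fun v => 1 - Real.exp (-v)) 0 v

theorem mul_expQuot (v : ℝ) : v * expQuot v = 1 - Real.exp (-v) := by
  have := sub_smul_dslope (fun v => 1 - Real.exp (-v)) 0 v
  simpa [expQuot] using this

theorem expQuot_zero : expQuot 0 = 1 := by
  have : HasDerivAt (fun v : ℝ => 1 - Real.exp (-v)) 1 0 := by
    have := ((hasDerivAt_neg (0 : ℝ)).exp).const_sub 1
    simpa using this
  rw [expQuot, dslope_same, this.deriv]

theorem continuous_expQuot : Continuous expQuot := by
  rw [← continuousOn_univ]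
  refine (continuousOn_dslope (by simp)).2 ⟨by fun_prop, by fun_prop⟩

theorem expQuot_nonneg {v : ℝ} (hv : 0 ≤ v) : 0 ≤ expQuot v := by
  rcases hv.eq_or_lt with rfl | hv
  · rw [expQuot_zero]; exact zero_le_one
  · have h := mul_expQuot v
    have : Real.exp (-v) ≤ 1 := Real.exp_le_one_iff.2 (by linarith)
    by_contra hcon
    push Not at hcon
    nlinarith

theorem expQuot_le_one {v : ℝ} (hv : 0 ≤ v) : expQuot v ≤ 1 := by
  rcases hv.eq_or_lt with rfl | hv
  · rw [expQuot_zero]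
  · have h := mul_expQuot v
    have := Real.one_sub_le_exp_neg v
    by_contra hcon
    push Not at hcon
    nlinarith

/-- The generating function at `u` of the number of further actors linked to an attribute of weight
`X₁`, where `X₁` is biased by its square and each actor is linked at the rate `κ X₁`. -/
noncomputable def limA (P₁ : Measure ℝ) (κ u : ℝ) : ℝ :=
  ∫ x, x ^ 2 * Real.exp (-(κ * x * (1 - u))) ∂P₁

/-- The limit, per unit weight of an actor, of minus the logarithm of the generating function at
`s` of the number of neighbours of that actor. -/
noncomputable def limRate (P₁ : Measure ℝ) (b κ s : ℝ) : ℝ :=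
  (1 - s) * b * ∫ x, x ^ 2 * expQuot (κ * x * (1 - s)) ∂P₁

/-- The limiting generating function at `s` of the degree of an actor, biased by its weight. -/
noncomputable def limB (P₁ P₂ : Measure ℝ) (b κ s : ℝ) : ℝ :=
  ∫ y, y * Real.exp (-(y * limRate P₁ b κ s)) ∂P₂

theorem probτ_nonneg {P₁ P₂ : Measure ℝ} (hP : ∀ᵐ z ∂P₁, 0 ≤ z)
    (hint : Integrable (fun z => z) P₁) {β : ℝ} (hc : 0 < moment P₂ 1 / √β) (r : ℕ) :
    0 ≤ probτ P₁ P₂ β r := by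
  rw [probτ_eq hP hint hc]
  refine mul_nonneg (inv_nonneg.2 ?_) (integral_mul_poissonProb_nonneg hP hP hc.le r)
  refine integral_nonneg_of_ae ?_
  filter_upwards [hP] with z hz
  simpa using hz

theorem q_nonneg {P₁ P₂ : Measure ℝ} (hP₁ : ∀ᵐ z ∂P₁, 0 ≤ z) (hP₂ : ∀ᵐ z ∂P₂, 0 ≤ z)
    (hint : Integrable (fun z => z) P₁) {β : ℝ} (hc : 0 < moment P₂ 1 / √β)
    (ha : 0 < moment P₁ 1) (r : ℕ) : 0 ≤ q P₁ P₂ β r := by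
  refine integral_nonneg_of_ae ?_
  filter_upwards [hP₂] with z hz
  exact mul_nonneg hz (compoundPoisson_nonneg (probτ_nonneg hP₁ hint hc)
    (mul_nonneg (mul_nonneg hz ha.le) (Real.sqrt_nonneg _)) r)

/-- At `κ = b / √β` the rate is the mean `a₁ √β` of the Poisson number of summands `τ_j` per unit
weight, times one minus the generating function of `τ`. -/
theorem limRate_eq {P₁ : Measure ℝ} [IsProbabilityMeasure P₁] (hint : Integrable (fun z => z) P₁)
    {β b s : ℝ} (hP₁ : ∀ᵐ z ∂P₁, 0 ≤ z) (hβ : 0 < β) (hb : 0 < b) (hs1 : s ≤ 1)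
    (ha : 0 < moment P₁ 1) :
    limRate P₁ b (b / √β) s = moment P₁ 1 * √β *
      (1 - (moment P₁ 1)⁻¹ * ∫ x, x * Real.exp (-(b / √β * x * (1 - s))) ∂P₁) := by
  have hsq : 0 < √β := Real.sqrt_pos.2 hβ
  have hexp : Integrable (fun x => x * Real.exp (-(b / √β * x * (1 - s)))) P₁ := by
    refine hint.mono (by fun_prop) ?_
    filter_upwards [hP₁] with x hx
    rw [norm_mul]
    refine mul_le_of_le_one_right (norm_nonneg _) ?_
    rw [Real.norm_of_nonneg (Real.exp_pos _).le]
    exact Real.exp_le_one_iff.2 (neg_nonpos.2 (mul_nonneg (mul_nonneg (by positivity) hx)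
      (sub_nonneg.2 hs1)))
  have h1 : moment P₁ 1 * √β *
      (1 - (moment P₁ 1)⁻¹ * ∫ x, x * Real.exp (-(b / √β * x * (1 - s))) ∂P₁) =
      √β * ∫ x, (x - x * Real.exp (-(b / √β * x * (1 - s)))) ∂P₁ := by
    rw [integral_sub hint hexp]
    have : moment P₁ 1 = ∫ x, x ∂P₁ := by simp [moment]
    rw [← this, mul_right_comm, mul_sub, mul_inv_cancel_left₀ ha.ne', mul_one, mul_comm]
  rw [h1, limRate, ← integral_const_mul, ← integral_const_mul]
  refine integral_congr_ae (Eventually.of_forall fun x => ?_)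
  have := mul_expQuot (b / √β * x * (1 - s))
  have e : x - x * Real.exp (-(b / √β * x * (1 - s))) =
      x * (1 - Real.exp (-(b / √β * x * (1 - s)))) := by ring
  simp only
  rw [e, ← this]
  field_simp

/-- `limB` is the generating function of the weights `q_r`, the law of `d*_y` being compound
Poisson. -/
theorem hasSum_q {P₁ P₂ : Measure ℝ} [IsProbabilityMeasure P₁]
    (hP₁ : ∀ᵐ z ∂P₁, 0 ≤ z) (hP₂ : ∀ᵐ z ∂P₂, 0 ≤ z) (hint₁ : Integrable (fun z => z) P₁)
    (hint₂ : Integrable (fun z => z) P₂) {β : ℝ} (hβ : 0 < β) (ha : 0 < moment P₁ 1)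
    (hb : 0 < moment P₂ 1) {s : ℝ} (hs : 0 < s) (hs1 : s ≤ 1) :
    HasSum (fun r => q P₁ P₂ β r * s ^ r)
      (limB P₁ P₂ (moment P₂ 1) (moment P₂ 1 / √β) s) := by
  have hc : 0 < moment P₂ 1 / √β := div_pos hb (Real.sqrt_pos.2 hβ)
  have hτ : HasSum (fun r => probτ P₁ P₂ β r * s ^ r) ((moment P₁ 1)⁻¹ *
      ∫ x, x * Real.exp (-(moment P₂ 1 / √β * x * (1 - s))) ∂P₁) := by
    refine ((hasSum_integral_mul_poissonProb hP₁ hint₁ hP₁ hc.le hs.le hs1).mul_left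
      (moment P₁ 1)⁻¹).congr_fun fun r => ?_
    rw [probτ_eq hP₁ hint₁ hc, mul_assoc]
  have hR0 : 0 ≤ limRate P₁ (moment P₂ 1) (moment P₂ 1 / √β) s := by
    refine mul_nonneg (mul_nonneg (sub_nonneg.2 hs1) hb.le) (integral_nonneg_of_ae ?_)
    filter_upwards [hP₁] with x hx
    exact mul_nonneg (sq_nonneg x) (expQuot_nonneg (mul_nonneg (mul_nonneg hc.le hx)
      (sub_nonneg.2 hs1)))
  refine hasSum_integral_mul (g := fun r y => probDStar P₁ P₂ β y r)
    (G := fun y => Real.exp (-(y * limRate P₁ (moment P₂ 1) (moment P₂ 1 / √β) s))) hint₂ hP₂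
    (fun r => ?_) ?_ hs.le (by fun_prop) ?_ ?_
  · exact (measurable_compoundPoisson _ r).comp (by fun_prop)
  · filter_upwards [hP₂] with y hy r
    exact compoundPoisson_nonneg (probτ_nonneg hP₁ hint₁ hc)
      (mul_nonneg (mul_nonneg hy ha.le) (Real.sqrt_nonneg _)) r
  · filter_upwards [hP₂] with y hy
    have := hasSum_compoundPoisson (probτ_nonneg hP₁ hint₁ hc) hs hτ
      (t := y * moment P₁ 1 * √β) (mul_nonneg (mul_nonneg hy ha.le) (Real.sqrt_nonneg _))
    rw [limRate_eq hint₁ hP₁ hβ hb hs1 ha, ← mul_assoc, ← mul_assoc]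
    exact this
  · filter_upwards [hP₂] with y hy
    exact Real.exp_le_one_iff.2 (neg_nonpos.2 (mul_nonneg hy hR0))

/-- `limA` is the generating function of the law of `Λ₀` biased by `Λ₀ (Λ₀ - 1)` and shifted by `2`:
the common attribute has two of its actors distinguished. -/
theorem hasSum_probΛ₀ {P₁ P₂ : Measure ℝ} (hP₁ : ∀ᵐ z ∂P₁, 0 ≤ z)
    (hsq : Integrable (fun z => z ^ 2) P₁) {β : ℝ} (hβ : 0 < β) (hb : 0 < moment P₂ 1)
    {s : ℝ} (hs : 0 < s) (hs1 : s ≤ 1) :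
    HasSum (fun r : ℕ => β / moment P₂ 1 ^ 2 *
      (((r : ℝ) + 1) * ((r : ℝ) + 2) * probΛ₀ P₁ P₂ β (r + 2)) * s ^ r)
      (limA P₁ (moment P₂ 1 / √β) s) := by
  have hc : 0 < moment P₂ 1 / √β := div_pos hb (Real.sqrt_pos.2 hβ)
  refine (hasSum_integral_mul_poissonProb hP₁ hsq (Eventually.of_forall fun z => sq_nonneg z)
    hc.le hs.le hs1).congr_fun fun r => ?_
  rw [probΛ₀, add_one_mul_add_two_mul_mixedPoisson, div_pow, Real.sq_sqrt hβ.le]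
  congr 1
  field_simp

theorem probΛ₀_nonneg {P₁ P₂ : Measure ℝ} (hP₁ : ∀ᵐ z ∂P₁, 0 ≤ z) {β : ℝ}
    (hb : 0 < moment P₂ 1) (r : ℕ) : 0 ≤ probΛ₀ P₁ P₂ β r := by
  have := integral_mul_poissonProb_nonneg hP₁ (w := fun _ => 1)
    (Eventually.of_forall fun _ => zero_le_one) (div_nonneg hb.le (Real.sqrt_nonneg β)) r
  simp only [one_mul] at this
  exact this

theorem pTilde_succ {P₁ P₂ : Measure ℝ} (hP₂ : ∀ᵐ z ∂P₂, 0 ≤ z)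
    (hint : Integrable (fun z => z) P₂) (hc : 0 < moment P₁ 2 * moment P₂ 1)
    (hb : 0 < moment P₂ 1) (r : ℕ) :
    moment P₂ 1 * pTilde P₁ P₂ (r + 1) =
      ∫ y, y * poissonProb (moment P₁ 2 * moment P₂ 1 * y) r ∂P₂ := by
  unfold pTilde probΛ₃
  rw [mean_mixedPoisson hP₂ hint hc.le]
  push_cast
  rw [add_one_mul_mixedPoisson, mul_div_mul_left _ _ hc.ne', mul_div_cancel₀ _ hb.ne']

theorem limA_zero (P₁ : Measure ℝ) (u : ℝ) : limA P₁ 0 u = moment P₁ 2 := by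
  simp [limA, moment]

/-- For `κ = 0` the rate is linear in `1 - s`, so that `limB` becomes the generating function of a
mixed Poisson law. -/
theorem hasSum_pTilde {P₁ P₂ : Measure ℝ} (hP₂ : ∀ᵐ z ∂P₂, 0 ≤ z)
    (hint : Integrable (fun z => z) P₂) (ha : 0 < moment P₁ 2)
    (hb : 0 < moment P₂ 1) {s : ℝ} (hs : 0 < s) (hs1 : s ≤ 1) :
    HasSum (fun r => moment P₂ 1 * pTilde P₁ P₂ (r + 1) * s ^ r)
      (limB P₁ P₂ (moment P₂ 1) 0 s) := by
  have hc := mul_pos ha hb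
  have h := hasSum_integral_mul_poissonProb hP₂ hint hP₂ hc.le hs.le hs1
  have he : limB P₁ P₂ (moment P₂ 1) 0 s =
      ∫ y, y * Real.exp (-(moment P₁ 2 * moment P₂ 1 * y * (1 - s))) ∂P₂ := by
    have : limRate P₁ (moment P₂ 1) 0 s = (1 - s) * moment P₂ 1 * moment P₁ 2 := by
      simp [limRate, expQuot_zero, moment]
    rw [limB, this]
    refine integral_congr_ae (Eventually.of_forall fun y => ?_)
    simp only
    congr 3
    ring
  rw [he]
  refine h.congr_fun fun r => ?_
  rw [pTilde_succ hP₂ hint hc hb]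

/-! ### Products of probability measures -/

theorem lintegral_pi_prod {m : ℕ} {E : Type*} [MeasurableSpace E] (μ : Measure E)
    [IsProbabilityMeasure μ] {g : Fin m → E → ENNReal} (hg : ∀ i, Measurable (g i)) :
    ∫⁻ x, ∏ i, g i (x i) ∂(Measure.pi fun _ : Fin m => μ) = ∏ i, ∫⁻ x, g i x ∂μ := by
  have hind := iIndepFun_pi (μ := fun _ : Fin m => μ) (X := g) fun i => (hg i).aemeasurable
  refine (lintegral_prod_eq_prod_lintegral_of_indepFun Finset.univ
    (fun i (x : Fin m → E) => g i (x i)) hind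
    fun i => (hg i).comp (measurable_pi_apply i)).trans ?_
  refine Finset.prod_congr rfl fun i _ => ?_
  exact (measurePreserving_eval (fun _ : Fin m => μ) i).lintegral_comp (hg i)

theorem integral_pi_eval {m : ℕ} {E : Type*} [MeasurableSpace E] (μ : Measure E)
    [IsProbabilityMeasure μ] {f : E → ℝ} (hf : AEStronglyMeasurable f μ) (i : Fin m) :
    ∫ T, f (T i) ∂(Measure.pi fun _ : Fin m => μ) = ∫ x, f x ∂μ := by
  have h := measurePreserving_eval (fun _ : Fin m => μ) i
  have hf' := hf
  rw [← h.map_eq] at hf'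
  rw [← integral_map h.measurable.aemeasurable hf', h.map_eq]

theorem integrable_pi_eval {m : ℕ} {E : Type*} [MeasurableSpace E] {μ : Measure E}
    [IsProbabilityMeasure μ] {f : E → ℝ} (hf : Integrable f μ) (i : Fin m) :
    Integrable (fun T : Fin m → E => f (T i)) (Measure.pi fun _ : Fin m => μ) :=
  (measurePreserving_eval (fun _ : Fin m => μ) i).integrable_comp_of_integrable hf

theorem indepFun_pi_eval {m : ℕ} {E : Type*} [MeasurableSpace E] {μ : Measure E}
    [IsProbabilityMeasure μ] {f g : E → ℝ} (hf : Measurable f) (hg : Measurable g) {i j : Fin m}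
    (hij : i ≠ j) :
    IndepFun (fun T : Fin m → E => f (T i)) (fun T => g (T j))
      (Measure.pi fun _ : Fin m => μ) := by
  have hind := iIndepFun_pi (μ := fun _ : Fin m => μ) (X := fun _ : Fin m => (id : E → E))
    fun i => aemeasurable_id
  exact (hind.indepFun hij).comp hf hg

theorem integral_pi_eval_mul_eval {m : ℕ} {E : Type*} [MeasurableSpace E] (μ : Measure E)
    [IsProbabilityMeasure μ] {f g : E → ℝ} (hf : Measurable f) (hg : Measurable g) {i j : Fin m}
    (hij : i ≠ j) :
    ∫ T, f (T i) * g (T j) ∂(Measure.pi fun _ : Fin m => μ) = (∫ x, f x ∂μ) * ∫ x, g x ∂μ := by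
  rw [(indepFun_pi_eval hf hg hij).integral_fun_mul_eq_mul_integral
    (hf.comp (measurable_pi_apply i)).aestronglyMeasurable
    (hg.comp (measurable_pi_apply j)).aestronglyMeasurable,
    integral_pi_eval μ hf.aestronglyMeasurable, integral_pi_eval μ hg.aestronglyMeasurable]

theorem integrable_pi_eval_mul_eval {m : ℕ} {E : Type*} [MeasurableSpace E] {μ : Measure E}
    [IsProbabilityMeasure μ] {f g : E → ℝ} (hf : Measurable f) (hg : Measurable g)
    (hfi : Integrable f μ) (hgi : Integrable g μ) {i j : Fin m} (hij : i ≠ j) :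
    Integrable (fun T : Fin m → E => f (T i) * g (T j)) (Measure.pi fun _ : Fin m => μ) :=
  (indepFun_pi_eval hf hg hij).integrable_mul (integrable_pi_eval hfi i) (integrable_pi_eval hgi j)

/-! ### Attaching a random tag with values in a finite type -/

section Tag

theorem sum_prod_tag_eq_one {α β : Type*} [Fintype β] {w : α → β → ℝ} {m : ℕ}
    (hw1 : ∀ x, ∑ b, w x b = 1) (x : Fin m → α) :
    ∑ D : Fin m → β, ∏ i, w (x i) (D i) = 1 := by
  classical
  have := Finset.prod_univ_sum (fun _ : Fin m => (Finset.univ : Finset β)) fun i b => w (x i) b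
  rw [Fintype.piFinset_univ] at this
  rw [← this]
  simp [hw1]

variable {α β : Type*} [MeasurableSpace α] [MeasurableSpace β] [Fintype β]

/-- The law of `(x, b)`, where `x` has law `μ` and, given `x`, the tag `b` has probabilities
`w x b`. -/
noncomputable def tagLaw (μ : Measure α) (w : α → β → ℝ) : Measure (α × β) :=
  ∑ b, (μ.withDensity fun x => ENNReal.ofReal (w x b)).map fun x => (x, b)

variable {μ : Measure α} {w : α → β → ℝ}

theorem lintegral_tagLaw (hw : ∀ b, Measurable fun x => w x b) {f : α × β → ENNReal}
    (hf : Measurable f) :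
    ∫⁻ z, f z ∂(tagLaw μ w) = ∑ b, ∫⁻ x, ENNReal.ofReal (w x b) * f (x, b) ∂μ := by
  unfold tagLaw
  rw [lintegral_finsetSum_measure]
  refine Finset.sum_congr rfl fun b _ => ?_
  rw [lintegral_map hf (by fun_prop), lintegral_withDensity_eq_lintegral_mul _
    (hw b).ennreal_ofReal (by fun_prop)]
  rfl

theorem integral_tagLaw (hw : ∀ b, Measurable fun x => w x b) (hw0 : ∀ x b, 0 ≤ w x b)
    {f : α × β → ℝ} (hf : Measurable f) (hi : ∀ b, Integrable (fun x => w x b * f (x, b)) μ) :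
    ∫ z, f z ∂(tagLaw μ w) = ∑ b, ∫ x, w x b * f (x, b) ∂μ := by
  unfold tagLaw
  rw [integral_finsetSum_measure]
  · refine Finset.sum_congr rfl fun b _ => ?_
    rw [integral_map (by fun_prop) hf.aestronglyMeasurable,
      integral_withDensity_eq_integral_toReal_smul (hw b).ennreal_ofReal
        (Eventually.of_forall fun _ => ENNReal.ofReal_lt_top)]
    simp only [ENNReal.toReal_ofReal (hw0 _ _), smul_eq_mul]
  · intro b _
    rw [integrable_map_measure hf.aestronglyMeasurable (by fun_prop),
      integrable_withDensity_iff_integrable_smul' (hw b).ennreal_ofReal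
        (Eventually.of_forall fun _ => ENNReal.ofReal_lt_top)]
    simpa only [ENNReal.toReal_ofReal (hw0 _ _), smul_eq_mul, Function.comp_apply] using hi b

theorem isProbabilityMeasure_tagLaw [IsProbabilityMeasure μ] (hw : ∀ b, Measurable fun x => w x b)
    (hw0 : ∀ x b, 0 ≤ w x b) (hw1 : ∀ x, ∑ b, w x b = 1) :
    IsProbabilityMeasure (tagLaw μ w) := by
  constructor
  have := lintegral_tagLaw (μ := μ) hw (f := fun _ => 1) measurable_const
  rw [lintegral_const, one_mul] at this
  rw [this]
  simp only [mul_one]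
  rw [← lintegral_finsetSum _ fun b _ => (hw b).ennreal_ofReal]
  simp only [← ENNReal.ofReal_sum_of_nonneg fun b _ => hw0 _ b, hw1]
  simp

/-- Independent tagged variables are an independent sample, tagged independently given its
values. -/
theorem pi_tagLaw {m : ℕ} [IsProbabilityMeasure μ] (hw : ∀ b, Measurable fun x => w x b)
    (hw0 : ∀ x b, 0 ≤ w x b) (hw1 : ∀ x, ∑ b, w x b = 1) :
    Measure.pi (fun _ : Fin m => tagLaw μ w) =
      (tagLaw (Measure.pi fun _ : Fin m => μ) fun x (D : Fin m → β) => ∏ i, w (x i) (D i)).map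
        fun z i => (z.1 i, z.2 i) := by
  classical
  have := isProbabilityMeasure_tagLaw (μ := μ) hw hw0 hw1
  refine Measure.pi_eq fun S hS => ?_
  have hzip : Measurable fun (z : (Fin m → α) × (Fin m → β)) i => (z.1 i, z.2 i) := by fun_prop
  have hbox : MeasurableSet (Set.univ.pi S) := MeasurableSet.univ_pi hS
  have hW : ∀ D : Fin m → β, Measurable fun x : Fin m → α => ∏ i, w (x i) (D i) := fun D =>
    Finset.measurable_prod _ fun i _ => (hw (D i)).comp (measurable_pi_apply i)
  rw [Measure.map_apply hzip hbox, ← lintegral_indicator_one (hzip hbox),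
    lintegral_tagLaw hW (measurable_one.indicator (hzip hbox))]
  have hfac : ∀ D : Fin m → β, ∫⁻ x : Fin m → α, ENNReal.ofReal (∏ i, w (x i) (D i)) *
      ((fun (z : (Fin m → α) × (Fin m → β)) i => (z.1 i, z.2 i)) ⁻¹' Set.univ.pi S).indicator
        1 (x, D) ∂(Measure.pi fun _ : Fin m => μ) =
      ∏ i, ∫⁻ x, ENNReal.ofReal (w x (D i)) * (S i).indicator 1 (x, D i) ∂μ := by
    intro D
    rw [← lintegral_pi_prod μ (g := fun i x =>
      ENNReal.ofReal (w x (D i)) * (S i).indicator 1 (x, D i)) fun i =>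
        (hw (D i)).ennreal_ofReal.mul ((measurable_one.indicator (hS i)).comp (by fun_prop))]
    refine lintegral_congr fun x => ?_
    rw [Finset.prod_mul_distrib, ENNReal.ofReal_prod_of_nonneg fun i _ => hw0 _ _]
    congr 1
    simp only [Set.indicator_apply, Pi.one_apply]
    rw [Finset.prod_ite_zero]
    simp [Set.mem_preimage]
  simp only [hfac]
  have := Finset.prod_univ_sum (fun _ : Fin m => (Finset.univ : Finset β)) fun i b =>
    ∫⁻ x, ENNReal.ofReal (w x b) * (S i).indicator 1 (x, b) ∂μ
  rw [Fintype.piFinset_univ] at this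
  rw [← this]
  refine Finset.prod_congr rfl fun i _ => ?_
  rw [← lintegral_indicator_one (hS i), lintegral_tagLaw hw (measurable_one.indicator (hS i))]

theorem integral_pi_tagLaw {m : ℕ} [IsProbabilityMeasure μ] (hw : ∀ b, Measurable fun x => w x b)
    (hw0 : ∀ x b, 0 ≤ w x b) (hw1 : ∀ x, ∑ b, w x b = 1) {f : (Fin m → α × β) → ℝ}
    (hf : Measurable f) {C : ℝ} (hC : ∀ T, |f T| ≤ C) :
    ∫ T, f T ∂(Measure.pi fun _ : Fin m => tagLaw μ w) =
      ∫ x, ∑ D : Fin m → β, (∏ i, w (x i) (D i)) * f (fun i => (x i, D i))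
        ∂(Measure.pi fun _ : Fin m => μ) := by
  classical
  have hzip : Measurable fun (z : (Fin m → α) × (Fin m → β)) i => (z.1 i, z.2 i) := by fun_prop
  have hW : ∀ D : Fin m → β, Measurable fun x : Fin m → α => ∏ i, w (x i) (D i) := fun D =>
    Finset.measurable_prod _ fun i _ => (hw (D i)).comp (measurable_pi_apply i)
  have hW0 : ∀ (x : Fin m → α) (D : Fin m → β), 0 ≤ ∏ i, w (x i) (D i) := fun x D =>
    Finset.prod_nonneg fun i _ => hw0 _ _
  have hw_le : ∀ x b, w x b ≤ 1 := fun x b => by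
    rw [← hw1 x]; exact Finset.single_le_sum (fun b _ => hw0 x b) (Finset.mem_univ b)
  have hint : ∀ D : Fin m → β, Integrable (fun x : Fin m → α =>
      (∏ i, w (x i) (D i)) * f (fun i => (x i, D i))) (Measure.pi fun _ : Fin m => μ) := by
    intro D
    refine Integrable.of_bound ((hW D).mul (hf.comp (by fun_prop))).aestronglyMeasurable C
      (Eventually.of_forall fun x => ?_)
    rw [norm_mul, Real.norm_of_nonneg (hW0 x D)]
    calc _ ≤ 1 * C := mul_le_mul (Finset.prod_le_one (fun i _ => hw0 _ _) fun i _ => hw_le _ _)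
          (hC _) (abs_nonneg _) zero_le_one
      _ = C := one_mul C
  rw [pi_tagLaw hw hw0 hw1, integral_map hzip.aemeasurable hf.aestronglyMeasurable,
    integral_tagLaw hW hW0 (f := fun z => f fun i => (z.1 i, z.2 i)) (hf.comp hzip) hint,
    integral_finsetSum _ fun D _ => hint D]

end Tag

/-! ### An exact formula for the joint generating function of two degrees -/

/-- The real number `linkProb m n x y`, as a function of the normalization `N = √(n m)`. -/
noncomputable def linkP (N x y : ℝ) : ℝ := max 0 (min 1 (x * y / N))

theorem linkP_nonneg (N x y : ℝ) : 0 ≤ linkP N x y := le_max_left _ _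

theorem linkP_le_one (N x y : ℝ) : linkP N x y ≤ 1 := max_le zero_le_one (min_le_left _ _)

@[fun_prop]
theorem measurable_linkP {α : Type*} [MeasurableSpace α] {N : ℝ} {f g : α → ℝ}
    (hf : Measurable f) (hg : Measurable g) : Measurable fun z => linkP N (f z) (g z) := by
  unfold linkP; fun_prop

/-- The probability that a Bernoulli variable of parameter `p` takes the value `b`. -/
def wt (p : ℝ) (b : Bool) : ℝ := bif b then p else 1 - p

theorem wt_nonneg {p : ℝ} (h0 : 0 ≤ p) (h1 : p ≤ 1) (b : Bool) : 0 ≤ wt p b := by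
  cases b <;> simp [wt, h0, h1]

theorem wt_le_one {p : ℝ} (h0 : 0 ≤ p) (h1 : p ≤ 1) (b : Bool) : wt p b ≤ 1 := by
  cases b <;> simp [wt, h0, h1]

theorem wt_linkP_nonneg (N x y : ℝ) (b : Bool) : 0 ≤ wt (linkP N x y) b :=
  wt_nonneg (linkP_nonneg _ _ _) (linkP_le_one _ _ _) b

theorem wt_linkP_le_one (N x y : ℝ) (b : Bool) : wt (linkP N x y) b ≤ 1 :=
  wt_le_one (linkP_nonneg _ _ _) (linkP_le_one _ _ _) b

theorem sum_wt (p : ℝ) : ∑ b, wt p b = 1 := by simp [wt]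

@[fun_prop]
theorem measurable_wt {α : Type*} [MeasurableSpace α] {f : α → ℝ} (hf : Measurable f) (b : Bool) :
    Measurable fun z => wt (f z) b := by
  cases b <;> simp only [wt, cond_true, cond_false] <;> fun_prop

theorem bernoulliMeasure_real_singleton (p : unitInterval) (b : Bool) :
    (bernoulliMeasure true false p).real {b} = wt p b := by
  cases b
  · rw [bernoulliMeasure_real_apply_of_notMem_of_mem] <;> simp [wt]
  · rw [bernoulliMeasure_real_apply_of_mem_of_notMem] <;> simp [wt]

theorem linkMeasure_singleton {m n : ℕ} (x : Fin m → ℝ) (y : Fin n → ℝ) (h : Bipartite m n) :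
    linkMeasure m n x y {h} =
      ENNReal.ofReal (∏ j, ∏ i, wt (linkP √((n : ℝ) * m) (x i) (y j)) (h i j)) := by
  simp only [linkMeasure, Measure.pi_singleton]
  rw [Finset.prod_comm, ENNReal.ofReal_prod_of_nonneg fun i _ =>
    Finset.prod_nonneg fun j _ => wt_linkP_nonneg _ _ _ _]
  refine Finset.prod_congr rfl fun j _ => ?_
  rw [ENNReal.ofReal_prod_of_nonneg fun i _ => wt_linkP_nonneg _ _ _ _]
  refine Finset.prod_congr rfl fun i _ => ?_
  rw [← ENNReal.ofReal_toReal (measure_ne_top (bernoulliMeasure true false _) {h i j}),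
    ← measureReal_def, bernoulliMeasure_real_singleton]
  rfl

/-- The probability that an actor with a random weight has the set `D` of attributes, given the
weights `x` of the attributes. -/
noncomputable def avgWt (P₂ : Measure ℝ) (N : ℝ) {m : ℕ} (x : Fin m → ℝ) (D : Fin m → Bool) : ℝ :=
  ∫ y, ∏ i, wt (linkP N (x i) y) (D i) ∂P₂

theorem prod_wt_nonneg (N : ℝ) {m : ℕ} (x : Fin m → ℝ) (y : ℝ) (D : Fin m → Bool) :
    0 ≤ ∏ i, wt (linkP N (x i) y) (D i) :=
  Finset.prod_nonneg fun _ _ => wt_linkP_nonneg _ _ _ _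

theorem prod_wt_le_one (N : ℝ) {m : ℕ} (x : Fin m → ℝ) (y : ℝ) (D : Fin m → Bool) :
    ∏ i, wt (linkP N (x i) y) (D i) ≤ 1 :=
  Finset.prod_le_one (fun _ _ => wt_linkP_nonneg _ _ _ _) fun _ _ => wt_linkP_le_one _ _ _ _

theorem measurable_prod_wt (N : ℝ) {m : ℕ} (D : Fin m → Bool) :
    Measurable fun z : (Fin m → ℝ) × ℝ => ∏ i, wt (linkP N (z.1 i) z.2) (D i) := by
  fun_prop

theorem integrable_of_measurable_of_bound {α : Type*} [MeasurableSpace α] {μ : Measure α}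
    [IsFiniteMeasure μ] {f : α → ℝ} (hf : Measurable f) {C : ℝ} (h : ∀ x, |f x| ≤ C) :
    Integrable f μ :=
  Integrable.of_bound hf.aestronglyMeasurable C (Eventually.of_forall h)

theorem integrable_prod_wt {P₂ : Measure ℝ} [IsProbabilityMeasure P₂] (N : ℝ) {m : ℕ}
    (x : Fin m → ℝ) (D : Fin m → Bool) :
    Integrable (fun y => ∏ i, wt (linkP N (x i) y) (D i)) P₂ :=
  integrable_of_measurable_of_bound (by fun_prop) (C := 1) fun y => by
    rw [abs_of_nonneg (prod_wt_nonneg _ _ _ _)]; exact prod_wt_le_one _ _ _ _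

theorem avgWt_nonneg (P₂ : Measure ℝ) (N : ℝ) {m : ℕ} (x : Fin m → ℝ) (D : Fin m → Bool) :
    0 ≤ avgWt P₂ N x D :=
  integral_nonneg fun _ => prod_wt_nonneg _ _ _ _

theorem avgWt_le_one (P₂ : Measure ℝ) [IsProbabilityMeasure P₂] (N : ℝ) {m : ℕ} (x : Fin m → ℝ)
    (D : Fin m → Bool) : avgWt P₂ N x D ≤ 1 := by
  calc avgWt P₂ N x D ≤ ∫ _, (1 : ℝ) ∂P₂ :=
        integral_mono (integrable_prod_wt N x D) (integrable_const _) fun y =>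
          prod_wt_le_one _ _ _ _
    _ = 1 := by simp

theorem measurable_avgWt (P₂ : Measure ℝ) [IsProbabilityMeasure P₂] (N : ℝ) {m : ℕ}
    (D : Fin m → Bool) :
    Measurable fun x : Fin m → ℝ => avgWt P₂ N x D :=
  ((measurable_prod_wt N D).stronglyMeasurable.integral_prod_right (ν := P₂)).measurable

theorem bipartiteLaw_real_singleton {P₁ P₂ : Measure ℝ} [IsProbabilityMeasure P₁]
    [IsProbabilityMeasure P₂]
    {m n : ℕ} (h : Bipartite m n) :
    (bipartiteLaw P₁ P₂ m n).real {h} =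
      ∫ x, ∏ j, avgWt P₂ √((n : ℝ) * m) x (fun i => h i j) ∂(Measure.pi fun _ : Fin m => P₁) := by
  have hmeas : Measurable fun z : (Fin m → ℝ) × (Fin n → ℝ) =>
      ∏ j, ∏ i, wt (linkP √((n : ℝ) * m) (z.1 i) (z.2 j)) (h i j) := by fun_prop
  have h0 : ∀ z : (Fin m → ℝ) × (Fin n → ℝ),
      0 ≤ ∏ j, ∏ i, wt (linkP √((n : ℝ) * m) (z.1 i) (z.2 j)) (h i j) := fun z =>
    Finset.prod_nonneg fun j _ => prod_wt_nonneg _ _ _ _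
  have hint : Integrable (fun z : (Fin m → ℝ) × (Fin n → ℝ) =>
      ∏ j, ∏ i, wt (linkP √((n : ℝ) * m) (z.1 i) (z.2 j)) (h i j))
      ((Measure.pi fun _ : Fin m => P₁).prod (Measure.pi fun _ : Fin n => P₂)) :=
    integrable_of_measurable_of_bound hmeas (C := 1) fun z => by
      rw [abs_of_nonneg (h0 z)]
      exact Finset.prod_le_one (fun j _ => prod_wt_nonneg _ _ _ _) fun j _ => prod_wt_le_one _ _ _ _
  rw [measureReal_def, bipartiteLaw, Measure.bind_apply (MeasurableSet.singleton h)
    (linkKernel m n).measurable.aemeasurable]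
  have : ∀ z, linkKernel m n z {h} = ENNReal.ofReal
      (∏ j, ∏ i, wt (linkP √((n : ℝ) * m) (z.1 i) (z.2 j)) (h i j)) := fun z =>
    linkMeasure_singleton z.1 z.2 h
  simp only [this]
  rw [weightLaw, ← ofReal_integral_eq_lintegral_ofReal hint (Eventually.of_forall h0),
    ENNReal.toReal_ofReal (integral_nonneg h0), integral_prod _ hint]
  refine integral_congr_ae (Eventually.of_forall fun x => ?_)
  exact integral_fintype_prod_eq_prod (𝕜 := ℝ) (μ := fun _ : Fin n => P₂)
    (fun (j : Fin n) y => ∏ i, wt (linkP √((n : ℝ) * m) (x i) y) (h i j))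

/-- The set of attributes linked to the actor `v_j`. -/
def col {m n : ℕ} (h : Bipartite m n) (j : Fin n) : Fin m → Bool := fun i => h i j

theorem sum_fin_succ_fun {E : Type*} [Fintype E] {k : ℕ} (f : (Fin (k + 1) → E) → ℝ) :
    ∑ H, f H = ∑ a, ∑ H : Fin k → E, f (Fin.cons a H) := by
  rw [← (Fin.consEquiv fun _ : Fin (k + 1) => E).sum_comp, Fintype.sum_prod_type]
  rfl

/-- Given the weights of the attributes, the attribute sets of different actors are independent and
identically distributed, with probabilities `avgWt`. -/
theorem integral_bipartiteLaw {P₁ P₂ : Measure ℝ} [IsProbabilityMeasure P₁]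
    [IsProbabilityMeasure P₂]
    {m k : ℕ} (F : (Fin m → Bool) → (Fin m → Bool) → ℝ)
    (g : (Fin m → Bool) → (Fin m → Bool) → (Fin m → Bool) → ℝ) :
    ∫ h, F (col h 0) (col h 1) * ∏ j : Fin k, g (col h 0) (col h 1) (col h j.succ.succ)
        ∂(bipartiteLaw P₁ P₂ m (k + 2)) =
      ∫ x, ∑ D₀, ∑ D₁, avgWt P₂ √(((k + 2 : ℕ) : ℝ) * m) x D₀ *
          avgWt P₂ √(((k + 2 : ℕ) : ℝ) * m) x D₁ * (F D₀ D₁ *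
          (∑ D, avgWt P₂ √(((k + 2 : ℕ) : ℝ) * m) x D * g D₀ D₁ D) ^ k)
        ∂(Measure.pi fun _ : Fin m => P₁) := by
  set N := √(((k + 2 : ℕ) : ℝ) * m) with hN
  have hint : ∀ h : Bipartite m (k + 2), Integrable (fun x : Fin m → ℝ =>
      ∏ j, avgWt P₂ N x (fun i => h i j)) (Measure.pi fun _ : Fin m => P₁) := fun h =>
    integrable_of_measurable_of_bound
      (Finset.measurable_prod _ fun j _ => measurable_avgWt P₂ N _) (C := 1) fun x => by
      rw [abs_of_nonneg (Finset.prod_nonneg fun j _ => avgWt_nonneg _ _ _ _)]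
      exact Finset.prod_le_one (fun j _ => avgWt_nonneg _ _ _ _) fun j _ => avgWt_le_one _ _ _ _
  rw [integral_fintype (Integrable.of_finite)]
  simp only [bipartiteLaw_real_singleton, smul_eq_mul]
  simp only [← hN, ← integral_mul_const]
  rw [← integral_finsetSum _ fun h _ => (hint h).mul_const _]
  refine integral_congr_ae (Eventually.of_forall fun x => ?_)
  simp only
  rw [← (Equiv.piComm fun (_ : Fin (k + 2)) (_ : Fin m) => Bool).sum_comp, sum_fin_succ_fun]
  refine Finset.sum_congr rfl fun D₀ _ => ?_
  rw [sum_fin_succ_fun]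
  refine Finset.sum_congr rfl fun D₁ _ => ?_
  rw [Fintype.sum_pow, Finset.mul_sum, Finset.mul_sum]
  refine Finset.sum_congr rfl fun H _ => ?_
  rw [Finset.prod_mul_distrib, Fin.prod_univ_succ, Fin.prod_univ_succ]
  have e : ∀ j : Fin (k + 2), (fun i => (Equiv.piComm fun (_ : Fin (k + 2)) (_ : Fin m) => Bool)
      (Fin.cons D₀ (Fin.cons D₁ H : Fin (k + 1) → Fin m → Bool)) i j) =
      (Fin.cons D₀ (Fin.cons D₁ H : Fin (k + 1) → Fin m → Bool) : Fin (k + 2) → _) j :=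
    fun _ => rfl
  have e' : ∀ j : Fin (k + 2), col ((Equiv.piComm fun (_ : Fin (k + 2)) (_ : Fin m) => Bool)
      (Fin.cons D₀ (Fin.cons D₁ H : Fin (k + 1) → Fin m → Bool))) j =
      (Fin.cons D₀ (Fin.cons D₁ H : Fin (k + 1) → Fin m → Bool) : Fin (k + 2) → _) j :=
    fun _ => rfl
  have e1 : (1 : Fin (k + 2)) = Fin.succ 0 := rfl
  simp only [e, e', e1, Fin.cons_zero, Fin.cons_succ]
  ring

/-- The contribution of an actor with attributes `D` to the monomial counting neighbours of two
actors with attributes `D₀` and `D₁`: a factor `s` if `D` meets `D₀` and a factor `t` if `D` meets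
`D₁`. -/
def hitGF (s t : ℝ) {m : ℕ} (D₀ D₁ D : Fin m → Bool) : ℝ :=
  (if ∃ i, D₀ i = true ∧ D i = true then s else 1) *
    (if ∃ i, D₁ i = true ∧ D i = true then t else 1)

/-- The probability that an actor of weight `y` is linked to none of the attributes whose tag
satisfies `χ`. -/
noncomputable def missProb (N : ℝ) {m : ℕ} (T : Fin m → ℝ × Bool × Bool) (y : ℝ)
    (χ : Bool × Bool → Bool) : ℝ :=
  ∏ i, (if χ (T i).2 = true then 1 - linkP N (T i).1 y else 1)

/-- The expectation of `hitGF s t` for an actor of weight `y`. The attributes are listed as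
`T i = (x i, a i, b i)`, where `x i` is the weight of the attribute `w_i`, and the Boolean values
`a i`, `b i` tell whether it is linked to the first and to the second distinguished actor. -/
noncomputable def condGF (N s t : ℝ) {m : ℕ} (T : Fin m → ℝ × Bool × Bool) (y : ℝ) : ℝ :=
  s * t + s * (1 - t) * missProb N T y (fun d => d.2) +
    (1 - s) * t * missProb N T y (fun d => d.1) +
    (1 - s) * (1 - t) * missProb N T y (fun d => d.1 || d.2)

/-- The expectation of `hitGF s t` for an actor of random weight. -/
noncomputable def meanGF (P₂ : Measure ℝ) (N s t : ℝ) {m : ℕ} (T : Fin m → ℝ × Bool × Bool) : ℝ :=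
  ∫ y, condGF N s t T y ∂P₂

/-- The law of `(x, a, b)` for a single attribute, where `x` is its weight and `a`, `b` tell whether
it is linked to two actors of weights `y₀`, `y₁`. -/
noncomputable def attrLaw (P₁ : Measure ℝ) (N y₀ y₁ : ℝ) : Measure (ℝ × Bool × Bool) :=
  tagLaw P₁ fun x d => wt (linkP N x y₀) d.1 * wt (linkP N x y₁) d.2

/-- A random set with inclusion probabilities `p i` misses `c` with probability `∏ (1 - p i)`, over
the elements `i` of `c`. -/
theorem sum_prod_wt_mul {m : ℕ} (p : Fin m → ℝ) (c : Fin m → Bool) :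
    ∑ D : Fin m → Bool, (∏ i, wt (p i) (D i)) *
      (if ∃ i, c i = true ∧ D i = true then (0 : ℝ) else 1) =
      ∏ i, (if c i = true then 1 - p i else 1) := by
  have h : ∀ i, (if c i = true then 1 - p i else 1) =
      ∑ b, wt (p i) b * (if ¬ (c i = true ∧ b = true) then 1 else 0) := by
    intro i
    cases hc : c i <;> simp [wt]
  simp only [h]
  rw [Finset.prod_univ_sum, Fintype.piFinset_univ]
  refine Finset.sum_congr rfl fun D _ => ?_
  rw [Finset.prod_mul_distrib]
  congr 1
  rw [Finset.prod_ite_zero]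
  simp only [Finset.mem_univ, true_imp_iff, Finset.prod_const_one]
  by_cases hex : ∃ i, c i = true ∧ D i = true
  · rw [if_pos hex, if_neg (by push Not; exact hex)]
  · rw [if_neg hex, if_pos (by push Not at hex ⊢; exact hex)]

theorem sum_prod_wt_mul_hitGF (N s t y : ℝ) {m : ℕ} (x : Fin m → ℝ) (a b : Fin m → Bool) :
    ∑ D : Fin m → Bool, (∏ i, wt (linkP N (x i) y) (D i)) * hitGF s t a b D =
      condGF N s t (fun i => (x i, a i, b i)) y := by
  have hexp : ∀ D, hitGF s t a b D = s * t +
      s * (1 - t) * (if ∃ i, b i = true ∧ D i = true then (0 : ℝ) else 1) +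
      (1 - s) * t * (if ∃ i, a i = true ∧ D i = true then (0 : ℝ) else 1) +
      (1 - s) * (1 - t) *
        (if ∃ i, (a i || b i) = true ∧ D i = true then (0 : ℝ) else 1) := by
    intro D
    have hor : (∃ i, (a i || b i) = true ∧ D i = true) ↔
        (∃ i, a i = true ∧ D i = true) ∨ ∃ i, b i = true ∧ D i = true := by
      simp only [Bool.or_eq_true, or_and_right, exists_or]
    unfold hitGF
    by_cases h1 : ∃ i, a i = true ∧ D i = true <;>
      by_cases h2 : ∃ i, b i = true ∧ D i = true <;>
      simp only [hor, h1, h2, or_self, or_true, true_or, if_true, if_false] <;> ring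
  have hone : ∑ D : Fin m → Bool, ∏ i, wt (linkP N (x i) y) (D i) = 1 :=
    sum_prod_tag_eq_one (w := fun x b => wt (linkP N x y) b) (fun x => sum_wt _) x
  simp only [hexp, mul_add, Finset.sum_add_distrib]
  unfold condGF missProb
  rw [← sum_prod_wt_mul (fun i => linkP N (x i) y) b,
    ← sum_prod_wt_mul (fun i => linkP N (x i) y) a,
    ← sum_prod_wt_mul (fun i => linkP N (x i) y) fun i => a i || b i,
    Finset.mul_sum, Finset.mul_sum, Finset.mul_sum, ← Finset.sum_mul, hone, one_mul]
  congr 1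
  · congr 1
    · congr 1
      exact Finset.sum_congr rfl fun D _ => by ring
    · exact Finset.sum_congr rfl fun D _ => by ring
  · exact Finset.sum_congr rfl fun D _ => by ring

theorem missProb_nonneg (N : ℝ) {m : ℕ} (T : Fin m → ℝ × Bool × Bool) (y : ℝ)
    (χ : Bool × Bool → Bool) : 0 ≤ missProb N T y χ :=
  Finset.prod_nonneg fun i _ => by
    split_ifs
    · exact sub_nonneg.2 (linkP_le_one _ _ _)
    · exact zero_le_one

theorem missProb_le_one (N : ℝ) {m : ℕ} (T : Fin m → ℝ × Bool × Bool) (y : ℝ)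
    (χ : Bool × Bool → Bool) : missProb N T y χ ≤ 1 :=
  Finset.prod_le_one (fun i _ => by
    split_ifs
    · exact sub_nonneg.2 (linkP_le_one _ _ _)
    · exact zero_le_one) fun i _ => by
    split_ifs
    · linarith [linkP_nonneg N (T i).1 y]
    · exact le_rfl

theorem condGF_nonneg (N : ℝ) {s t : ℝ} (hs : 0 ≤ s) (hs1 : s ≤ 1) (ht : 0 ≤ t) (ht1 : t ≤ 1)
    {m : ℕ} (T : Fin m → ℝ × Bool × Bool) (y : ℝ) : 0 ≤ condGF N s t T y := by
  have := sub_nonneg.2 hs1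
  have := sub_nonneg.2 ht1
  have := missProb_nonneg N T y
  unfold condGF
  have h1 := this fun d => d.1
  have h2 := this fun d => d.2
  have h3 := this fun d => d.1 || d.2
  positivity

theorem condGF_le_one (N : ℝ) {s t : ℝ} (hs : 0 ≤ s) (hs1 : s ≤ 1) (ht : 0 ≤ t) (ht1 : t ≤ 1)
    {m : ℕ} (T : Fin m → ℝ × Bool × Bool) (y : ℝ) : condGF N s t T y ≤ 1 := by
  have h := missProb_le_one N T y
  have e1 : 0 ≤ s * (1 - t) := mul_nonneg hs (sub_nonneg.2 ht1)
  have e2 : 0 ≤ (1 - s) * t := mul_nonneg (sub_nonneg.2 hs1) ht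
  have e3 : 0 ≤ (1 - s) * (1 - t) := mul_nonneg (sub_nonneg.2 hs1) (sub_nonneg.2 ht1)
  have h1 := mul_le_mul_of_nonneg_left (h fun d => d.2) e1
  have h2 := mul_le_mul_of_nonneg_left (h fun d => d.1) e2
  have h3 := mul_le_mul_of_nonneg_left (h fun d => d.1 || d.2) e3
  unfold condGF
  nlinarith

theorem measurable_missProb (N : ℝ) {m : ℕ} (χ : Bool × Bool → Bool) :
    Measurable fun z : (Fin m → ℝ × Bool × Bool) × ℝ => missProb N z.1 z.2 χ := by
  unfold missProb
  refine Finset.measurable_prod _ fun i _ => Measurable.ite ?_ (by fun_prop) measurable_const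
  have h1 : Measurable fun z : (Fin m → ℝ × Bool × Bool) × ℝ => χ (z.1 i).2 :=
    (measurable_of_finite χ).comp (by fun_prop)
  exact h1 (MeasurableSet.singleton true)

theorem measurable_condGF (N s t : ℝ) {m : ℕ} :
    Measurable fun z : (Fin m → ℝ × Bool × Bool) × ℝ => condGF N s t z.1 z.2 := by
  have h := fun χ => measurable_missProb N (m := m) χ
  unfold condGF
  exact ((measurable_const.add ((h _).const_mul _)).add ((h _).const_mul _)).add
    ((h _).const_mul _)

theorem measurable_condGF_right (N s t : ℝ) {m : ℕ} (T : Fin m → ℝ × Bool × Bool) :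
    Measurable fun y => condGF N s t T y :=
  (measurable_condGF N s t (m := m)).of_uncurry_left (f := fun T y => condGF N s t T y)

theorem integrable_condGF {P₂ : Measure ℝ} [IsProbabilityMeasure P₂] (N : ℝ) {s t : ℝ}
    (hs : 0 ≤ s) (hs1 : s ≤ 1) (ht : 0 ≤ t) (ht1 : t ≤ 1)
    {m : ℕ} (T : Fin m → ℝ × Bool × Bool) : Integrable (fun y => condGF N s t T y) P₂ :=
  integrable_of_measurable_of_bound (measurable_condGF_right N s t T) (C := 1) fun y => by
    rw [abs_of_nonneg (condGF_nonneg N hs hs1 ht ht1 T y)]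
    exact condGF_le_one N hs hs1 ht ht1 T y

theorem measurable_meanGF {P₂ : Measure ℝ} [IsProbabilityMeasure P₂] (N s t : ℝ) {m : ℕ} :
    Measurable fun T : Fin m → ℝ × Bool × Bool => meanGF P₂ N s t T :=
  ((measurable_condGF N s t).stronglyMeasurable.integral_prod_right (ν := P₂)).measurable

theorem meanGF_nonneg (P₂ : Measure ℝ) (N : ℝ) {s t : ℝ} (hs : 0 ≤ s) (hs1 : s ≤ 1) (ht : 0 ≤ t)
    (ht1 : t ≤ 1) {m : ℕ} (T : Fin m → ℝ × Bool × Bool) : 0 ≤ meanGF P₂ N s t T :=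
  integral_nonneg fun y => condGF_nonneg N hs hs1 ht ht1 T y

theorem meanGF_le_one (P₂ : Measure ℝ) [IsProbabilityMeasure P₂] (N : ℝ) {s t : ℝ} (hs : 0 ≤ s)
    (hs1 : s ≤ 1) (ht : 0 ≤ t) (ht1 : t ≤ 1) {m : ℕ} (T : Fin m → ℝ × Bool × Bool) :
    meanGF P₂ N s t T ≤ 1 := by
  calc meanGF P₂ N s t T ≤ ∫ _, (1 : ℝ) ∂P₂ :=
        integral_mono (integrable_condGF N hs hs1 ht ht1 T) (integrable_const _) fun y =>
          condGF_le_one N hs hs1 ht ht1 T y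
    _ = 1 := by simp

/-- The indicator that some attribute is linked to both distinguished actors. -/
def common {m : ℕ} (T : Fin m → ℝ × Bool × Bool) : ℝ :=
  if ∃ i, (T i).2.1 = true ∧ (T i).2.2 = true then 1 else 0

theorem common_nonneg {m : ℕ} (T : Fin m → ℝ × Bool × Bool) : 0 ≤ common T := by
  unfold common; split_ifs <;> norm_num

theorem common_le_one {m : ℕ} (T : Fin m → ℝ × Bool × Bool) : common T ≤ 1 := by
  unfold common; split_ifs <;> norm_num

theorem measurable_common {m : ℕ} :
    Measurable fun T : Fin m → ℝ × Bool × Bool => common T := by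
  unfold common
  refine Measurable.ite ?_ measurable_const measurable_const
  have : {T : Fin m → ℝ × Bool × Bool | ∃ i, (T i).2.1 = true ∧ (T i).2.2 = true} =
      ⋃ i, {T | (T i).2 = (true, true)} := by
    ext T
    simp [Prod.ext_iff]
  rw [this]
  refine MeasurableSet.iUnion fun i => ?_
  have h1 : Measurable fun T : Fin m → ℝ × Bool × Bool => (T i).2 := by fun_prop
  exact h1 (MeasurableSet.singleton _)

theorem measurable_attr_weight (N y₀ y₁ : ℝ) (d : Bool × Bool) :
    Measurable fun x => wt (linkP N x y₀) d.1 * wt (linkP N x y₁) d.2 := by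
  fun_prop

theorem attr_weight_nonneg (N y₀ y₁ x : ℝ) (d : Bool × Bool) :
    0 ≤ wt (linkP N x y₀) d.1 * wt (linkP N x y₁) d.2 :=
  mul_nonneg (wt_linkP_nonneg _ _ _ _) (wt_linkP_nonneg _ _ _ _)

theorem attr_weight_le_one (N y₀ y₁ x : ℝ) (d : Bool × Bool) :
    wt (linkP N x y₀) d.1 * wt (linkP N x y₁) d.2 ≤ 1 :=
  mul_le_one₀ (wt_linkP_le_one _ _ _ _) (wt_linkP_nonneg _ _ _ _) (wt_linkP_le_one _ _ _ _)

theorem sum_attr_weight (N y₀ y₁ x : ℝ) :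
    ∑ d : Bool × Bool, wt (linkP N x y₀) d.1 * wt (linkP N x y₁) d.2 = 1 := by
  rw [Fintype.sum_prod_type]
  simp only [← Finset.mul_sum, sum_wt, mul_one]

instance instIsProbabilityMeasureAttrLaw (P₁ : Measure ℝ) [IsProbabilityMeasure P₁]
    (N y₀ y₁ : ℝ) : IsProbabilityMeasure (attrLaw P₁ N y₀ y₁) :=
  isProbabilityMeasure_tagLaw (fun d => measurable_attr_weight N y₀ y₁ d)
    (fun x d => attr_weight_nonneg N y₀ y₁ x d) fun x => sum_attr_weight N y₀ y₁ x

/-- The integrand in the exact formula, as an integral over the weights of the attributes and a sum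
over their links to two actors of weights `y.1`, `y.2`. -/
theorem integral_pi_attrLaw {P₁ : Measure ℝ} [IsProbabilityMeasure P₁] {m : ℕ} (N : ℝ)
    {f : (Fin m → ℝ × Bool × Bool) → ℝ} (hf : Measurable f) {C : ℝ} (hC : ∀ T, |f T| ≤ C)
    (y : ℝ × ℝ) :
    ∫ T, f T ∂(Measure.pi fun _ : Fin m => attrLaw P₁ N y.1 y.2) =
      ∫ x, ∑ D₀ : Fin m → Bool, ∑ D₁ : Fin m → Bool, (∏ i, wt (linkP N (x i) y.1) (D₀ i)) *
        (∏ i, wt (linkP N (x i) y.2) (D₁ i)) * f (fun i => (x i, D₀ i, D₁ i))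
        ∂(Measure.pi fun _ : Fin m => P₁) := by
  unfold attrLaw
  rw [integral_pi_tagLaw (fun d => measurable_attr_weight N y.1 y.2 d)
    (fun x d => attr_weight_nonneg N y.1 y.2 x d) (fun x => sum_attr_weight N y.1 y.2 x) hf hC]
  refine integral_congr_ae (Eventually.of_forall fun x => ?_)
  simp only
  rw [← (Equiv.arrowProdEquivProdArrow (Fin m) (fun _ => Bool) fun _ => Bool).symm.sum_comp,
    Fintype.sum_prod_type]
  refine Finset.sum_congr rfl fun D₀ _ => Finset.sum_congr rfl fun D₁ _ => ?_
  rw [Finset.prod_mul_distrib]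
  rfl

theorem measurable_attr_integrand {m : ℕ} (N : ℝ) {f : (Fin m → ℝ × Bool × Bool) → ℝ}
    (hf : Measurable f) (D₀ D₁ : Fin m → Bool) :
    Measurable fun z : (Fin m → ℝ) × ℝ × ℝ => (∏ i, wt (linkP N (z.1 i) z.2.1) (D₀ i)) *
        (∏ i, wt (linkP N (z.1 i) z.2.2) (D₁ i)) * f (fun i => (z.1 i, D₀ i, D₁ i)) := by
  have : Measurable fun z : (Fin m → ℝ) × ℝ × ℝ => f (fun i => (z.1 i, D₀ i, D₁ i)) :=
    hf.comp (by fun_prop)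
  fun_prop

theorem stronglyMeasurable_integral_pi_attrLaw {P₁ : Measure ℝ} [IsProbabilityMeasure P₁] {m : ℕ}
    (N : ℝ) {f : (Fin m → ℝ × Bool × Bool) → ℝ} (hf : Measurable f) {C : ℝ}
    (hC : ∀ T, |f T| ≤ C) :
    StronglyMeasurable fun y : ℝ × ℝ =>
      ∫ T, f T ∂(Measure.pi fun _ : Fin m => attrLaw P₁ N y.1 y.2) := by
  simp only [integral_pi_attrLaw N hf hC]
  have h : Measurable (Function.uncurry fun (x : Fin m → ℝ) (y : ℝ × ℝ) =>
      ∑ D₀ : Fin m → Bool, ∑ D₁ : Fin m → Bool, (∏ i, wt (linkP N (x i) y.1) (D₀ i)) *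
        (∏ i, wt (linkP N (x i) y.2) (D₁ i)) * f (fun i => (x i, D₀ i, D₁ i))) :=
    Finset.measurable_sum _ fun D₀ _ => Finset.measurable_sum _ fun D₁ _ =>
      measurable_attr_integrand N hf D₀ D₁
  exact h.stronglyMeasurable.integral_prod_left

/-- The exact formula: given the weights of two actors, the triples formed by the weight of an
attribute and its links to the two actors are independent, and given these triples the other actors
contribute independent factors with the same mean. -/
theorem integral_bipartiteLaw_hitGF {P₁ P₂ : Measure ℝ} [IsProbabilityMeasure P₁]
    [IsProbabilityMeasure P₂] {m k : ℕ} {s t : ℝ} (hs : 0 ≤ s) (hs1 : s ≤ 1) (ht : 0 ≤ t)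
    (ht1 : t ≤ 1) :
    ∫ h : Bipartite m (k + 2), (if ∃ i, h i 0 = true ∧ h i 1 = true then (1 : ℝ) else 0) *
        ∏ j : Fin k, hitGF s t (col h 0) (col h 1) (col h j.succ.succ)
        ∂(bipartiteLaw P₁ P₂ m (k + 2)) =
      ∫ y, ∫ T, common T * meanGF P₂ √(((k + 2 : ℕ) : ℝ) * m) s t T ^ k
        ∂(Measure.pi fun _ : Fin m => attrLaw P₁ √(((k + 2 : ℕ) : ℝ) * m) y.1 y.2)
        ∂(P₂.prod P₂) := by
  have h1 := integral_bipartiteLaw (P₁ := P₁) (P₂ := P₂) (m := m) (k := k)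
    (fun D₀ D₁ => if ∃ i, D₀ i = true ∧ D₁ i = true then (1 : ℝ) else 0) (hitGF s t)
  refine h1.trans ?_
  set N := √(((k + 2 : ℕ) : ℝ) * m) with hN
  set f : (Fin m → ℝ × Bool × Bool) → ℝ := fun T => common T * meanGF P₂ N s t T ^ k with hfdef
  have hf : Measurable f := measurable_common.mul ((measurable_meanGF N s t).pow_const k)
  have hf0 : ∀ T, 0 ≤ f T := fun T =>
    mul_nonneg (common_nonneg T) (pow_nonneg (meanGF_nonneg P₂ N hs hs1 ht ht1 T) k)
  have hC : ∀ T, |f T| ≤ 1 := fun T => by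
    rw [abs_of_nonneg (hf0 T)]
    exact mul_le_one₀ (common_le_one T) (pow_nonneg (meanGF_nonneg P₂ N hs hs1 ht ht1 T) k)
      (pow_le_one₀ (meanGF_nonneg P₂ N hs hs1 ht ht1 T) (meanGF_le_one P₂ N hs hs1 ht ht1 T))
  simp only [integral_pi_attrLaw N hf hC]
  have hbd : ∀ (D₀ D₁ : Fin m → Bool) (z : (Fin m → ℝ) × ℝ × ℝ),
      |(∏ i, wt (linkP N (z.1 i) z.2.1) (D₀ i)) *
        (∏ i, wt (linkP N (z.1 i) z.2.2) (D₁ i)) * f (fun i => (z.1 i, D₀ i, D₁ i))| ≤ 1 := by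
    intro D₀ D₁ z
    rw [abs_mul, abs_of_nonneg (mul_nonneg (prod_wt_nonneg _ _ _ _) (prod_wt_nonneg _ _ _ _))]
    exact mul_le_one₀ (mul_le_one₀ (prod_wt_le_one _ _ _ _) (prod_wt_nonneg _ _ _ _)
      (prod_wt_le_one _ _ _ _)) (abs_nonneg _) (hC _)
  have hint : ∀ D₀ D₁ : Fin m → Bool, Integrable (fun z : (Fin m → ℝ) × ℝ × ℝ =>
      (∏ i, wt (linkP N (z.1 i) z.2.1) (D₀ i)) *
        (∏ i, wt (linkP N (z.1 i) z.2.2) (D₁ i)) * f (fun i => (z.1 i, D₀ i, D₁ i)))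
      ((Measure.pi fun _ : Fin m => P₁).prod (P₂.prod P₂)) := fun D₀ D₁ =>
    integrable_of_measurable_of_bound (measurable_attr_integrand N hf D₀ D₁) (hbd D₀ D₁)
  rw [← integral_integral_swap (f := fun (x : Fin m → ℝ) (y : ℝ × ℝ) =>
    ∑ D₀ : Fin m → Bool, ∑ D₁ : Fin m → Bool, (∏ i, wt (linkP N (x i) y.1) (D₀ i)) *
        (∏ i, wt (linkP N (x i) y.2) (D₁ i)) * f (fun i => (x i, D₀ i, D₁ i)))
    (integrable_finsetSum _ fun D₀ _ => integrable_finsetSum _ fun D₁ _ => hint D₀ D₁)]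
  refine integral_congr_ae (Eventually.of_forall fun x => ?_)
  have hint' : ∀ D₀ D₁ : Fin m → Bool, Integrable (fun y : ℝ × ℝ =>
      (∏ i, wt (linkP N (x i) y.1) (D₀ i)) *
        (∏ i, wt (linkP N (x i) y.2) (D₁ i)) * f (fun i => (x i, D₀ i, D₁ i)))
      (P₂.prod P₂) := fun D₀ D₁ =>
    integrable_of_measurable_of_bound
      ((measurable_attr_integrand N hf D₀ D₁).of_uncurry_left (f := fun (x : Fin m → ℝ)
        (y : ℝ × ℝ) => (∏ i, wt (linkP N (x i) y.1) (D₀ i)) *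
          (∏ i, wt (linkP N (x i) y.2) (D₁ i)) * f (fun i => (x i, D₀ i, D₁ i))))
      fun y => hbd D₀ D₁ (x, y)
  simp only
  rw [integral_finsetSum _ fun D₀ _ => integrable_finsetSum _ fun D₁ _ => hint' D₀ D₁]
  refine Finset.sum_congr rfl fun D₀ _ => ?_
  rw [integral_finsetSum _ fun D₁ _ => hint' D₀ D₁]
  refine Finset.sum_congr rfl fun D₁ _ => ?_
  rw [integral_mul_const, integral_prod_mul (fun y => ∏ i, wt (linkP N (x i) y) (D₀ i))
    fun y => ∏ i, wt (linkP N (x i) y) (D₁ i)]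
  have hmean : ∑ D, avgWt P₂ N x D * hitGF s t D₀ D₁ D =
      meanGF P₂ N s t (fun i => (x i, D₀ i, D₁ i)) := by
    unfold avgWt meanGF
    simp only [← integral_mul_const, ← sum_prod_wt_mul_hitGF]
    rw [integral_finsetSum _ fun D _ => (integrable_prod_wt N x D).mul_const _]
  rw [hmean]
  rfl

/-! ### Linearization of the mean contribution of an actor -/

/-- One minus the contribution to the monomial of an actor linked to one attribute only, whose
links to the two distinguished actors are `d`. -/
def gap (s t : ℝ) (d : Bool × Bool) : ℝ :=
  1 - (if d.1 = true then s else 1) * (if d.2 = true then t else 1)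

/-- The total weight of the attributes whose tag satisfies `χ`. -/
def tagSum {m : ℕ} (T : Fin m → ℝ × Bool × Bool) (χ : Bool × Bool → Bool) : ℝ :=
  ∑ i, if χ (T i).2 = true then (T i).1 else 0

theorem sum_mul_gap (s t : ℝ) {m : ℕ} (T : Fin m → ℝ × Bool × Bool) :
    ∑ i, (T i).1 * gap s t (T i).2 = s * (1 - t) * tagSum T (fun d => d.2) +
      (1 - s) * t * tagSum T (fun d => d.1) +
      (1 - s) * (1 - t) * tagSum T (fun d => d.1 || d.2) := by
  unfold tagSum
  rw [Finset.mul_sum, Finset.mul_sum, Finset.mul_sum, ← Finset.sum_add_distrib,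
    ← Finset.sum_add_distrib]
  refine Finset.sum_congr rfl fun i _ => ?_
  unfold gap
  rcases (T i).2 with ⟨a, b⟩
  cases a <;> cases b <;> simp <;> ring

theorem gap_nonneg {s t : ℝ} (hs1 : s ≤ 1) (ht : 0 ≤ t) (ht1 : t ≤ 1)
    (d : Bool × Bool) : 0 ≤ gap s t d := by
  unfold gap
  rw [sub_nonneg]
  refine mul_le_one₀ ?_ ?_ ?_ <;> split_ifs <;> first | assumption | norm_num

theorem gap_le_one {s t : ℝ} (hs : 0 ≤ s) (ht : 0 ≤ t) (d : Bool × Bool) : gap s t d ≤ 1 := by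
  unfold gap
  have : 0 ≤ (if d.1 = true then s else 1) * (if d.2 = true then t else 1) := by
    refine mul_nonneg ?_ ?_ <;> split_ifs <;> first | assumption | norm_num
  linarith

theorem tagSum_nonneg {m : ℕ} {T : Fin m → ℝ × Bool × Bool} (hT : ∀ i, 0 ≤ (T i).1)
    (χ : Bool × Bool → Bool) : 0 ≤ tagSum T χ :=
  Finset.sum_nonneg fun i _ => by split_ifs <;> simp [hT i]

theorem tagSum_mono {m : ℕ} {T : Fin m → ℝ × Bool × Bool} (hT : ∀ i, 0 ≤ (T i).1)
    {χ χ' : Bool × Bool → Bool} (h : ∀ d, χ d = true → χ' d = true) :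
    tagSum T χ ≤ tagSum T χ' :=
  Finset.sum_le_sum fun i _ => by
    by_cases h1 : χ (T i).2 = true
    · rw [if_pos h1, if_pos (h _ h1)]
    · rw [if_neg h1]; split_ifs <;> simp [hT i]

theorem sum_mul_gap_nonneg {s t : ℝ} (hs1 : s ≤ 1) (ht : 0 ≤ t) (ht1 : t ≤ 1)
    {m : ℕ} {T : Fin m → ℝ × Bool × Bool} (hT : ∀ i, 0 ≤ (T i).1) :
    0 ≤ ∑ i, (T i).1 * gap s t (T i).2 :=
  Finset.sum_nonneg fun i _ => mul_nonneg (hT i) (gap_nonneg hs1 ht ht1 _)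

theorem sum_mul_gap_le {s t : ℝ} (hs : 0 ≤ s) (ht : 0 ≤ t)
    {m : ℕ} {T : Fin m → ℝ × Bool × Bool} (hT : ∀ i, 0 ≤ (T i).1) :
    ∑ i, (T i).1 * gap s t (T i).2 ≤ tagSum T (fun d => d.1 || d.2) :=
  Finset.sum_le_sum fun i _ => by
    split_ifs with h
    · exact mul_le_of_le_one_right (hT i) (gap_le_one hs ht _)
    · have : gap s t (T i).2 = 0 := by
        unfold gap
        rcases hd : (T i).2 with ⟨a, b⟩
        rw [hd] at h
        cases a <;> cases b <;> simp_all
      rw [this, mul_zero]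

/-- The first two Bonferroni type bounds for the probability of missing all attributes with a given
property. -/
theorem missProb_bounds {N y : ℝ} (hN : 0 < N) (hy : 0 ≤ y) {m : ℕ}
    {T : Fin m → ℝ × Bool × Bool} (hT : ∀ i, 0 ≤ (T i).1) {χ : Bool × Bool → Bool}
    (h1 : y / N * tagSum T χ ≤ 1) :
    1 - y / N * tagSum T χ ≤ missProb N T y χ ∧
      missProb N T y χ ≤ 1 - y / N * tagSum T χ + (y / N * tagSum T χ) ^ 2 := by
  have hyN : 0 ≤ y / N := div_nonneg hy hN.le
  set p : Fin m → ℝ := fun i => y / N * (if χ (T i).2 = true then (T i).1 else 0) with hp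
  have hp0 : ∀ i, 0 ≤ p i := fun i => mul_nonneg hyN (by split_ifs <;> simp [hT i])
  have hsum : y / N * tagSum T χ = ∑ i, p i := by simp only [hp, tagSum, Finset.mul_sum]
  rw [hsum] at h1 ⊢
  have hp1 : ∀ i, p i ≤ 1 := fun i =>
    (Finset.single_le_sum (fun j _ => hp0 j) (Finset.mem_univ i)).trans h1
  -- the truncation of the linking probability is not active
  have hmiss : missProb N T y χ = ∏ i, (1 - p i) := by
    unfold missProb
    refine Finset.prod_congr rfl fun i _ => ?_
    have h2 := hp1 i
    have h3 := hp0 i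
    simp only [hp] at h2 h3 ⊢
    split_ifs with h
    · rw [if_pos h] at h2 h3
      have e : y / N * (T i).1 = (T i).1 * y / N := by ring
      rw [e] at h2 h3 ⊢
      rw [linkP, min_eq_right h2, max_eq_right h3]
    · simp
  rw [hmiss]
  exact ⟨one_sub_sum_le_prod_one_sub _ _ (fun i _ => hp0 i) fun i _ => hp1 i,
    prod_one_sub_le_one_sub_sum_add_sq _ _ (fun i _ => hp0 i) fun i _ => hp1 i⟩

/-- Linearization for an actor of weight `y`. The error is quadratic for small `y` and linear for
large `y`, so that a first moment of `y` suffices to integrate it. -/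
theorem abs_one_sub_condGF_sub_le {N s t y : ℝ} (hN : 0 < N) (hs : 0 ≤ s) (hs1 : s ≤ 1)
    (ht : 0 ≤ t) (ht1 : t ≤ 1) (hy : 0 ≤ y) {m : ℕ} {T : Fin m → ℝ × Bool × Bool}
    (hT : ∀ i, 0 ≤ (T i).1) :
    |1 - condGF N s t T y - y * ((∑ i, (T i).1 * gap s t (T i).2) / N)| ≤
      y * (tagSum T (fun d => d.1 || d.2) / N) *
        min 1 (y * (tagSum T (fun d => d.1 || d.2) / N)) := by
  set S := tagSum T (fun d => d.1 || d.2) with hS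
  have hyN : 0 ≤ y / N := div_nonneg hy hN.le
  have hL0 := sum_mul_gap_nonneg hs1 ht ht1 hT
  have hL1 := sum_mul_gap_le hs ht hT
  have eV : y * (S / N) = y / N * S := by ring
  have eL : y * ((∑ i, (T i).1 * gap s t (T i).2) / N) =
    y / N * ∑ i, (T i).1 * gap s t (T i).2 := by ring
  rw [eV, eL]
  have hL2 := mul_le_mul_of_nonneg_left hL1 hyN
  have hL3 := mul_nonneg hyN hL0
  rcases le_or_gt 1 (y / N * S) with h | h
  · rw [min_eq_left h, mul_one]
    have hc0 := condGF_nonneg N hs hs1 ht ht1 T y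
    have hc1 := condGF_le_one N hs hs1 ht ht1 T y
    rw [abs_le]
    constructor <;> linarith
  · rw [min_eq_right h.le]
    have hSa : tagSum T (fun d => d.1) ≤ S := tagSum_mono hT fun d hd => by simp [hd]
    have hSb : tagSum T (fun d => d.2) ≤ S := tagSum_mono hT fun d hd => by simp [hd]
    have hA := mul_le_mul_of_nonneg_left hSa hyN
    have hB := mul_le_mul_of_nonneg_left hSb hyN
    have hA0 := mul_nonneg hyN (tagSum_nonneg hT fun d => d.1)
    have hB0 := mul_nonneg hyN (tagSum_nonneg hT fun d => d.2)
    have b1 := missProb_bounds hN hy hT (hA.trans h.le)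
    have b2 := missProb_bounds hN hy hT (hB.trans h.le)
    have b3 := missProb_bounds hN hy hT (χ := fun d => d.1 || d.2) h.le
    rw [← hS] at b3
    have sA := pow_le_pow_left₀ hA0 hA 2
    have sB := pow_le_pow_left₀ hB0 hB 2
    have e1 : 0 ≤ s * (1 - t) := mul_nonneg hs (sub_nonneg.2 ht1)
    have e2 : 0 ≤ (1 - s) * t := mul_nonneg (sub_nonneg.2 hs1) ht
    have e3 : 0 ≤ (1 - s) * (1 - t) := mul_nonneg (sub_nonneg.2 hs1) (sub_nonneg.2 ht1)
    have l1 := mul_le_mul_of_nonneg_left b1.1 e2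
    have l2 := mul_le_mul_of_nonneg_left b2.1 e1
    have l3 := mul_le_mul_of_nonneg_left b3.1 e3
    have u1 := mul_le_mul_of_nonneg_left (b1.2.trans (add_le_add le_rfl sA)) e2
    have u2 := mul_le_mul_of_nonneg_left (b2.2.trans (add_le_add le_rfl sB)) e1
    have u3 := mul_le_mul_of_nonneg_left b3.2 e3
    have hst : 0 ≤ s * t * (y / N * S) ^ 2 := by positivity
    rw [sum_mul_gap, ← hS, condGF, abs_le]
    constructor <;> nlinarith

/-- The error function `∫ y min (1, y z) dP₂(y) + b² z` of the linearization. -/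
noncomputable def linErr (P₂ : Measure ℝ) (z : ℝ) : ℝ :=
  ∫ y, y * min 1 (y * z) ∂P₂ + moment P₂ 1 ^ 2 * z

theorem integrable_mul_min {P₂ : Measure ℝ} (hP₂ : ∀ᵐ y ∂P₂, 0 ≤ y)
    (hY : Integrable (fun y : ℝ => y) P₂) {z : ℝ} (hz : 0 ≤ z) :
    Integrable (fun y => y * min 1 (y * z)) P₂ := by
  refine hY.mono (by fun_prop) ?_
  filter_upwards [hP₂] with y hy
  rw [norm_mul, Real.norm_of_nonneg (le_min zero_le_one (mul_nonneg hy hz))]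
  exact mul_le_of_le_one_right (norm_nonneg _) (min_le_left _ _)

theorem linErr_mono {P₂ : Measure ℝ} (hP₂ : ∀ᵐ y ∂P₂, 0 ≤ y)
    (hY : Integrable (fun y : ℝ => y) P₂) {z z' : ℝ} (hz : 0 ≤ z) (h : z ≤ z') :
    linErr P₂ z ≤ linErr P₂ z' := by
  refine add_le_add (integral_mono_ae (integrable_mul_min hP₂ hY hz)
    (integrable_mul_min hP₂ hY (hz.trans h)) ?_) (by gcongr)
  filter_upwards [hP₂] with y hy
  gcongr

theorem linErr_nonneg {P₂ : Measure ℝ} (hP₂ : ∀ᵐ y ∂P₂, 0 ≤ y) {z : ℝ} (hz : 0 ≤ z) :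
    0 ≤ linErr P₂ z := by
  refine add_nonneg (integral_nonneg_of_ae ?_) (by positivity)
  filter_upwards [hP₂] with y hy
  exact mul_nonneg hy (le_min zero_le_one (mul_nonneg hy hz))

theorem tendsto_linErr {P₂ : Measure ℝ} (hP₂ : ∀ᵐ y ∂P₂, 0 ≤ y)
    (hY : Integrable (fun y : ℝ => y) P₂) {z : ℕ → ℝ} (hz0 : ∀ᶠ l in atTop, 0 ≤ z l)
    (hz : Tendsto z atTop (𝓝 0)) : Tendsto (fun l => linErr P₂ (z l)) atTop (𝓝 0) := by
  have h1 : Tendsto (fun l => ∫ y, y * min 1 (y * z l) ∂P₂) atTop (𝓝 (∫ _, (0 : ℝ) ∂P₂)) := by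
    refine tendsto_integral_filter_of_dominated_convergence (fun y => |y|)
      (Eventually.of_forall fun l => by fun_prop) ?_ hY.abs ?_
    · filter_upwards [hz0] with l hl
      filter_upwards [hP₂] with y hy
      rw [norm_mul, Real.norm_of_nonneg (le_min zero_le_one (mul_nonneg hy hl))]
      exact mul_le_of_le_one_right (norm_nonneg _) (min_le_left _ _)
    · refine Eventually.of_forall fun y => ?_
      have h2 : Tendsto (fun l => y * min 1 (y * z l)) atTop (𝓝 (y * min 1 (y * 0))) :=
        (tendsto_const_nhds.min (hz.const_mul y)).const_mul y
      simpa using h2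
  have h2 := h1.add (hz.const_mul (moment P₂ 1 ^ 2))
  simpa [linErr] using h2

theorem moment_one_nonneg {P : Measure ℝ} (hP : ∀ᵐ y ∂P, 0 ≤ y) : 0 ≤ moment P 1 := by
  refine integral_nonneg_of_ae ?_
  filter_upwards [hP] with y hy
  simpa using hy

/-- Linearization of the joint contribution of `k` actors of random weights. The error per actor is
`o(S / N)` for `S / N → 0`, where `S` is the total weight of the linked attributes. -/
theorem abs_meanGF_pow_sub_exp_le {P₂ : Measure ℝ} [IsProbabilityMeasure P₂]
    (hP₂ : ∀ᵐ y ∂P₂, 0 ≤ y) (hY : Integrable (fun y : ℝ => y) P₂) {N s t : ℝ} (hN : 0 < N)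
    (hs : 0 ≤ s) (hs1 : s ≤ 1) (ht : 0 ≤ t) (ht1 : t ≤ 1) {m : ℕ} {T : Fin m → ℝ × Bool × Bool}
    (hT : ∀ i, 0 ≤ (T i).1) (k : ℕ) :
    |meanGF P₂ N s t T ^ k -
        Real.exp (-(k * moment P₂ 1 / N * ∑ i, (T i).1 * gap s t (T i).2))| ≤
      k * (tagSum T (fun d => d.1 || d.2) / N *
        linErr P₂ (tagSum T (fun d => d.1 || d.2) / N)) := by
  set S := tagSum T (fun d => d.1 || d.2) with hS
  set L := ∑ i, (T i).1 * gap s t (T i).2 with hL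
  have hb := moment_one_nonneg hP₂
  have hL0 : 0 ≤ L := sum_mul_gap_nonneg hs1 ht ht1 hT
  have hL1 : L ≤ S := sum_mul_gap_le hs ht hT
  have hz : 0 ≤ S / N := div_nonneg (hL0.trans hL1) hN.le
  have e : (k : ℝ) * moment P₂ 1 / N * L = k * (moment P₂ 1 * (L / N)) := by ring
  rw [e]
  refine (abs_pow_sub_exp_le (meanGF_nonneg P₂ N hs hs1 ht ht1 T)
    (meanGF_le_one P₂ N hs hs1 ht ht1 T)
    (mul_nonneg hb (div_nonneg hL0 hN.le)) k).trans ?_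
  refine mul_le_mul_of_nonneg_left ?_ (Nat.cast_nonneg k)
  rw [linErr, mul_add]
  refine add_le_add ?_ ?_
  · have hmin := (integrable_mul_min hP₂ hY hz).const_mul (S / N)
    have hi1 : Integrable (fun y => 1 - condGF N s t T y) P₂ :=
      (integrable_const 1).sub (integrable_condGF N hs hs1 ht ht1 T)
    have hi2 : Integrable (fun y => y * (L / N)) P₂ := hY.mul_const _
    have e2 : 1 - meanGF P₂ N s t T - moment P₂ 1 * (L / N) =
        ∫ y, (1 - condGF N s t T y - y * (L / N)) ∂P₂ := by
      rw [integral_sub hi1 hi2, integral_sub (integrable_const 1)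
        (integrable_condGF N hs hs1 ht ht1 T), integral_mul_const]
      simp [meanGF, moment]
    rw [e2, ← integral_const_mul]
    refine (abs_integral_le_integral_abs).trans (integral_mono_ae (hi1.sub hi2).abs hmin ?_)
    filter_upwards [hP₂] with y hy
    refine (abs_one_sub_condGF_sub_le hN hs hs1 ht ht1 hy hT).trans (le_of_eq ?_)
    ring
  · have : L / N ≤ S / N := by gcongr
    have h0 : 0 ≤ L / N := div_nonneg hL0 hN.le
    calc (moment P₂ 1 * (L / N)) ^ 2 ≤ (moment P₂ 1 * (S / N)) ^ 2 := by gcongr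
      _ = _ := by ring

/-! ### Expectations for a single attribute -/

theorem integrable_tagLaw {α β : Type*} [MeasurableSpace α] [MeasurableSpace β] [Fintype β]
    {μ : Measure α} {w : α → β → ℝ} (hw : ∀ b, Measurable fun x => w x b)
    (hw0 : ∀ x b, 0 ≤ w x b) {f : α × β → ℝ} (hf : Measurable f)
    (hi : ∀ b, Integrable (fun x => w x b * f (x, b)) μ) : Integrable f (tagLaw μ w) := by
  unfold tagLaw
  rw [integrable_finsetSum_measure]
  intro b _
  rw [integrable_map_measure hf.aestronglyMeasurable (by fun_prop),
    integrable_withDensity_iff_integrable_smul' (hw b).ennreal_ofReal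
      (Eventually.of_forall fun _ => ENNReal.ofReal_lt_top)]
  simpa only [ENNReal.toReal_ofReal (hw0 _ _), smul_eq_mul, Function.comp_apply] using hi b

theorem ae_tagLaw_of_ae {α β : Type*} [MeasurableSpace α] [MeasurableSpace β] [Fintype β]
    {μ : Measure α} {w : α → β → ℝ} {p : α → Prop} (hp : MeasurableSet {x | p x})
    (h : ∀ᵐ x ∂μ, p x) : ∀ᵐ z ∂(tagLaw μ w), p z.1 := by
  unfold tagLaw
  rw [← Measure.sum_fintype, Measure.ae_sum_iff]
  intro b
  have hs : MeasurableSet {z : α × β | p z.1} := measurable_fst hp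
  rw [ae_map_iff (by fun_prop) hs]
  exact (withDensity_absolutelyContinuous _ _).ae_le h

theorem ae_pi_attrLaw_nonneg {P₁ : Measure ℝ} [IsProbabilityMeasure P₁] (hP₁ : ∀ᵐ x ∂P₁, 0 ≤ x)
    (N y₀ y₁ : ℝ) (m : ℕ) :
    ∀ᵐ T ∂(Measure.pi fun _ : Fin m => attrLaw P₁ N y₀ y₁), ∀ i, 0 ≤ (T i).1 := by
  rw [ae_all_iff]
  intro i
  exact (measurePreserving_eval (fun _ : Fin m => attrLaw P₁ N y₀ y₁) i).quasiMeasurePreserving.ae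
    (ae_tagLaw_of_ae measurableSet_Ici hP₁)

theorem integrable_attr_weight_mul {P₁ : Measure ℝ} (N y₀ y₁ : ℝ) (d : Bool × Bool) {g : ℝ → ℝ}
    (hg : Integrable g P₁) :
    Integrable (fun x => wt (linkP N x y₀) d.1 * wt (linkP N x y₁) d.2 * g x) P₁ := by
  refine hg.mono ((measurable_attr_weight N y₀ y₁ d).aestronglyMeasurable.mul
    hg.aestronglyMeasurable) (Eventually.of_forall fun x => ?_)
  rw [norm_mul, Real.norm_of_nonneg (attr_weight_nonneg N y₀ y₁ x d)]
  exact mul_le_of_le_one_left (norm_nonneg _) (attr_weight_le_one N y₀ y₁ x d)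

theorem integrable_attrLaw {P₁ : Measure ℝ} (N y₀ y₁ : ℝ) {f : ℝ × Bool × Bool → ℝ}
    (hf : Measurable f) (hi : ∀ d, Integrable (fun x => f (x, d)) P₁) :
    Integrable f (attrLaw P₁ N y₀ y₁) :=
  integrable_tagLaw (measurable_attr_weight N y₀ y₁) (attr_weight_nonneg N y₀ y₁) hf
    fun d => integrable_attr_weight_mul N y₀ y₁ d (hi d)

theorem integral_attrLaw {P₁ : Measure ℝ} (N y₀ y₁ : ℝ) {f : ℝ × Bool × Bool → ℝ}
    (hf : Measurable f) (hi : ∀ d, Integrable (fun x => f (x, d)) P₁) :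
    ∫ z, f z ∂(attrLaw P₁ N y₀ y₁) =
      ∑ d : Bool × Bool, ∫ x, wt (linkP N x y₀) d.1 * wt (linkP N x y₁) d.2 * f (x, d) ∂P₁ :=
  integral_tagLaw (measurable_attr_weight N y₀ y₁) (attr_weight_nonneg N y₀ y₁) hf
    fun d => integrable_attr_weight_mul N y₀ y₁ d (hi d)

/-- The indicator that an attribute is linked to both distinguished actors. -/
def both (z : ℝ × Bool × Bool) : ℝ := if z.2.1 = true ∧ z.2.2 = true then 1 else 0

/-- The weight of an attribute, if it is linked to one of the distinguished actors. -/
def reach (z : ℝ × Bool × Bool) : ℝ := if (z.2.1 || z.2.2) = true then z.1 else 0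

theorem measurableSet_tag (s : Set (Bool × Bool)) :
    MeasurableSet {z : ℝ × Bool × Bool | z.2 ∈ s} :=
  measurable_snd s.toFinite.measurableSet

theorem measurable_both : Measurable both :=
  Measurable.ite (measurableSet_tag {d | d.1 = true ∧ d.2 = true}) measurable_const measurable_const

theorem measurable_reach : Measurable reach :=
  Measurable.ite (measurableSet_tag {d | (d.1 || d.2) = true}) measurable_fst measurable_const

theorem measurable_gap (s t : ℝ) : Measurable fun z : ℝ × Bool × Bool => gap s t z.2 :=
  (measurable_of_finite (gap s t)).comp measurable_snd

theorem both_nonneg (z : ℝ × Bool × Bool) : 0 ≤ both z := by unfold both; split_ifs <;> norm_num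

theorem both_le_one (z : ℝ × Bool × Bool) : both z ≤ 1 := by unfold both; split_ifs <;> norm_num

theorem integral_both_mul {P₁ : Measure ℝ} (N y₀ y₁ : ℝ) {g : ℝ × Bool × Bool → ℝ}
    (hg : Measurable g) (hi : ∀ d, Integrable (fun x => g (x, d)) P₁) :
    ∫ z, both z * g z ∂(attrLaw P₁ N y₀ y₁) =
      ∫ x, linkP N x y₀ * linkP N x y₁ * g (x, true, true) ∂P₁ := by
  have hb : ∀ d, ∀ x, both (x, d) * g (x, d) = if d = (true, true) then g (x, d) else 0 := by
    rintro ⟨a, b⟩ x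
    cases a <;> cases b <;> simp [both]
  rw [integral_attrLaw N y₀ y₁ (f := fun z => both z * g z) (measurable_both.mul hg) fun d => by
    simp only [hb]
    split_ifs
    · exact hi d
    · exact integrable_zero _ _ _]
  rw [Fintype.sum_eq_single (true, true)]
  · simp [hb, wt]
  · intro d hd
    simp [hb, hd]

theorem linkP_le {N x y : ℝ} (hN : 0 ≤ N) (hx : 0 ≤ x) (hy : 0 ≤ y) : linkP N x y ≤ x * y / N :=
  max_le (by positivity) (min_le_right _ _)

theorem integrable_linkP_mul_linkP_mul {P₁ : Measure ℝ} (N y₀ y₁ : ℝ) {g : ℝ → ℝ}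
    (hg : Integrable g P₁) : Integrable (fun x => linkP N x y₀ * linkP N x y₁ * g x) P₁ := by
  simpa only [wt, cond_true] using integrable_attr_weight_mul N y₀ y₁ (true, true) hg

/-- An attribute is linked to both distinguished actors with a probability of order at most
`N⁻²`. The function `g` of its weight allows for truncation. -/
theorem integral_both_mul_le {P₁ : Measure ℝ} [IsProbabilityMeasure P₁] (hP₁ : ∀ᵐ x ∂P₁, 0 ≤ x)
    (hX : Integrable (fun x : ℝ => x ^ 2) P₁) {N y₀ y₁ : ℝ} (hN : 0 < N) (h₀ : 0 ≤ y₀)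
    (h₁ : 0 ≤ y₁) {g : ℝ → ℝ} (hg : Measurable g) (hg0 : ∀ x, 0 ≤ g x) (hg1 : ∀ x, g x ≤ 1) :
    N ^ 2 * ∫ z, both z * g z.1 ∂(attrLaw P₁ N y₀ y₁) ≤ y₀ * y₁ * ∫ x, x ^ 2 * g x ∂P₁ := by
  have hgi : Integrable g P₁ := integrable_of_measurable_of_bound hg (C := 1) fun x => by
    rw [abs_of_nonneg (hg0 x)]; exact hg1 x
  have hxi : Integrable (fun x => x ^ 2 * g x) P₁ := by
    refine hX.mono (hX.aestronglyMeasurable.mul hg.aestronglyMeasurable)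
      (Eventually.of_forall fun x => ?_)
    rw [norm_mul, Real.norm_of_nonneg (hg0 x)]
    exact mul_le_of_le_one_right (norm_nonneg _) (hg1 x)
  rw [integral_both_mul N y₀ y₁ (g := fun z => g z.1) (hg.comp measurable_fst) fun _ => hgi,
    ← integral_const_mul, ← integral_const_mul]
  refine integral_mono_ae ((integrable_linkP_mul_linkP_mul N y₀ y₁ hgi).const_mul _)
    (hxi.const_mul _) ?_
  filter_upwards [hP₁] with x hx
  have e0 := linkP_le hN.le hx h₀
  have e1 := linkP_le hN.le hx h₁
  calc N ^ 2 * (linkP N x y₀ * linkP N x y₁ * g x)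
      ≤ N ^ 2 * (x * y₀ / N * (x * y₁ / N) * g x) := by
        have := linkP_nonneg N x y₁
        have := hg0 x
        have := linkP_nonneg N x y₀
        gcongr
    _ = y₀ * y₁ * (x ^ 2 * g x) := by field_simp

theorem integral_both_le {P₁ : Measure ℝ} [IsProbabilityMeasure P₁] (hP₁ : ∀ᵐ x ∂P₁, 0 ≤ x)
    (hX : Integrable (fun x : ℝ => x ^ 2) P₁) {N y₀ y₁ : ℝ} (hN : 0 < N) (h₀ : 0 ≤ y₀)
    (h₁ : 0 ≤ y₁) :
    N ^ 2 * ∫ z, both z ∂(attrLaw P₁ N y₀ y₁) ≤ y₀ * y₁ * moment P₁ 2 := by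
  have := integral_both_mul_le hP₁ hX hN h₀ h₁ (g := fun _ => 1) measurable_const
    (fun _ => zero_le_one) fun _ => le_rfl
  simpa [moment] using this

theorem integrable_id_of_sq {P₁ : Measure ℝ} [IsProbabilityMeasure P₁]
    (hX : Integrable (fun x : ℝ => x ^ 2) P₁) : Integrable (fun x : ℝ => x) P₁ := by
  refine ((integrable_const (1 : ℝ)).add hX).mono (by fun_prop) (Eventually.of_forall fun x => ?_)
  simp only [Pi.add_apply, Real.norm_eq_abs]
  rw [abs_of_nonneg (a := 1 + x ^ 2) (by positivity), abs_le]
  constructor <;> nlinarith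

theorem integrable_reach {P₁ : Measure ℝ} [IsProbabilityMeasure P₁]
    (hX : Integrable (fun x : ℝ => x ^ 2) P₁) (N y₀ y₁ : ℝ) :
    Integrable reach (attrLaw P₁ N y₀ y₁) := by
  refine integrable_attrLaw N y₀ y₁ measurable_reach fun d => ?_
  unfold reach
  by_cases h : (d.1 || d.2) = true
  · simp only [h, if_true]; exact integrable_id_of_sq hX
  · simp only [h]; exact integrable_zero _ _ _

/-- The mean weight that an attribute contributes to those linked to the two actors. -/
theorem integral_reach_le {P₁ : Measure ℝ} [IsProbabilityMeasure P₁] (hP₁ : ∀ᵐ x ∂P₁, 0 ≤ x)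
    (hX : Integrable (fun x : ℝ => x ^ 2) P₁) {N y₀ y₁ : ℝ} (hN : 0 < N) (h₀ : 0 ≤ y₀)
    (h₁ : 0 ≤ y₁) :
    ∫ z, reach z ∂(attrLaw P₁ N y₀ y₁) ≤ (y₀ + y₁) / N * moment P₁ 2 := by
  have hx := integrable_id_of_sq hX
  have hi : ∀ d : Bool × Bool, Integrable (fun x => reach (x, d)) P₁ := fun d => by
    unfold reach
    by_cases h : (d.1 || d.2) = true
    · simp only [h, if_true]; exact hx
    · simp only [h]; exact integrable_zero _ _ _
  rw [integral_attrLaw N y₀ y₁ measurable_reach hi,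
    ← integral_finsetSum _ fun d _ => integrable_attr_weight_mul N y₀ y₁ d (hi d), moment,
    ← integral_const_mul]
  refine integral_mono_ae (integrable_finsetSum _ fun d _ =>
    integrable_attr_weight_mul N y₀ y₁ d (hi d)) (hX.const_mul _) ?_
  filter_upwards [hP₁] with x hx0
  have e0 := linkP_le hN.le hx0 h₀
  have e1 := linkP_le hN.le hx0 h₁
  have n0 := linkP_nonneg N x y₀
  have n1 := linkP_nonneg N x y₁
  have e2 : (y₀ + y₁) / N * x ^ 2 = x * (x * y₀ / N + x * y₁ / N) := by field_simp
  rw [e2, Fintype.sum_prod_type]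
  simp only [Fintype.sum_bool, wt, reach, cond_true, cond_false, Bool.or_true,
    Bool.or_false, if_true, Bool.false_eq_true, if_false, mul_zero, add_zero]
  have e3 : linkP N x y₀ * linkP N x y₁ * x + linkP N x y₀ * (1 - linkP N x y₁) * x +
      (1 - linkP N x y₀) * linkP N x y₁ * x ≤ x * (linkP N x y₀ + linkP N x y₁) := by
    nlinarith [mul_nonneg (mul_nonneg n0 n1) hx0]
  exact e3.trans (mul_le_mul_of_nonneg_left (add_le_add e0 e1) hx0)

theorem tendsto_mul_linkP {N : ℕ → ℝ} (hN : Tendsto N atTop atTop) {x y : ℝ} (hx : 0 ≤ x)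
    (hy : 0 ≤ y) : Tendsto (fun l => N l * linkP (N l) x y) atTop (𝓝 (x * y)) := by
  refine tendsto_const_nhds.congr' ?_
  filter_upwards [hN.eventually_ge_atTop (x * y), hN.eventually_gt_atTop 0] with l h1 h2
  have h3 : x * y / N l ≤ 1 := (div_le_one h2).2 h1
  rw [linkP, min_eq_right h3, max_eq_right (by positivity)]
  field_simp

theorem tendsto_linkP {N : ℕ → ℝ} (hN : Tendsto N atTop atTop) {x y : ℝ} (hx : 0 ≤ x)
    (hy : 0 ≤ y) : Tendsto (fun l => linkP (N l) x y) atTop (𝓝 0) := by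
  have := (tendsto_mul_linkP hN hx hy).mul (tendsto_inv_atTop_zero.comp hN)
  rw [mul_zero] at this
  refine this.congr' ?_
  filter_upwards [hN.eventually_gt_atTop 0] with l h2
  simp only [Function.comp_apply]
  field_simp

theorem integrable_exp_neg {P₁ : Measure ℝ} [IsProbabilityMeasure P₁] (hP₁ : ∀ᵐ x ∂P₁, 0 ≤ x)
    {θ γ : ℝ} (hθ : 0 ≤ θ) (hγ : 0 ≤ γ) :
    Integrable (fun x => Real.exp (-(θ * (x * γ)))) P₁ := by
  refine Integrable.of_bound (by fun_prop) 1 ?_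
  filter_upwards [hP₁] with x hx
  rw [Real.norm_of_nonneg (Real.exp_pos _).le]
  exact Real.exp_le_one_iff.2 (neg_nonpos.2 (by positivity))

theorem measurable_exp_gap (θ s t : ℝ) :
    Measurable fun z : ℝ × Bool × Bool => Real.exp (-(θ * (z.1 * gap s t z.2))) :=
  Real.measurable_exp.comp ((measurable_fst.mul (measurable_gap s t)).const_mul θ).neg

/-- An attribute linked to both actors, on the scale `N ^ 2`: its weight gets biased by the square,
and the limit is a multiple of `limA`. -/
theorem tendsto_integral_both_mul_exp {P₁ : Measure ℝ} [IsProbabilityMeasure P₁]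
    (hP₁ : ∀ᵐ x ∂P₁, 0 ≤ x) (hX : Integrable (fun x : ℝ => x ^ 2) P₁) {y₀ y₁ s t : ℝ}
    (h₀ : 0 ≤ y₀) (h₁ : 0 ≤ y₁) (hs1 : s ≤ 1) (ht : 0 ≤ t) (ht1 : t ≤ 1) {N θ : ℕ → ℝ} {κ : ℝ}
    (hN : Tendsto N atTop atTop) (hθ0 : ∀ l, 0 ≤ θ l) (hθ : Tendsto θ atTop (𝓝 κ)) :
    Tendsto (fun l => N l ^ 2 *
        ∫ z, both z * Real.exp (-(θ l * (z.1 * gap s t z.2))) ∂(attrLaw P₁ (N l) y₀ y₁)) atTop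
      (𝓝 (y₀ * y₁ * limA P₁ κ (s * t))) := by
  have hgap : gap s t (true, true) = 1 - s * t := by simp [gap]
  have hst : s * t ≤ 1 := mul_le_one₀ hs1 ht ht1
  have key : ∀ l, N l ^ 2 * ∫ z, both z * Real.exp (-(θ l * (z.1 * gap s t z.2)))
      ∂(attrLaw P₁ (N l) y₀ y₁) =
      ∫ x, (N l * linkP (N l) x y₀) * (N l * linkP (N l) x y₁) *
        Real.exp (-(θ l * (x * (1 - s * t)))) ∂P₁ := by
    intro l
    rw [integral_both_mul (N l) y₀ y₁
      (g := fun z => Real.exp (-(θ l * (z.1 * gap s t z.2)))) (measurable_exp_gap _ _ _)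
      fun d => integrable_exp_neg hP₁ (hθ0 l) (gap_nonneg hs1 ht ht1 d), ← integral_const_mul]
    refine integral_congr_ae (Eventually.of_forall fun x => ?_)
    simp only [hgap]
    ring
  simp only [key]
  rw [limA, ← integral_const_mul]
  refine tendsto_integral_filter_of_dominated_convergence (fun x => y₀ * y₁ * x ^ 2)
    (Eventually.of_forall fun l => by fun_prop) ?_ (hX.const_mul _) ?_
  · filter_upwards [hN.eventually_gt_atTop 0] with l hl
    filter_upwards [hP₁] with x hx
    have e0 := linkP_le hl.le hx h₀
    have e1 := linkP_le hl.le hx h₁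
    have n0 := linkP_nonneg (N l) x y₀
    have n1 := linkP_nonneg (N l) x y₁
    have hexp : Real.exp (-(θ l * (x * (1 - s * t)))) ≤ 1 :=
      Real.exp_le_one_iff.2 (neg_nonpos.2
        (mul_nonneg (hθ0 l) (mul_nonneg hx (sub_nonneg.2 hst))))
    rw [Real.norm_of_nonneg (by positivity)]
    calc _ ≤ (N l * (x * y₀ / N l)) * (N l * (x * y₁ / N l)) * 1 := by gcongr
      _ = _ := by field_simp
  · filter_upwards [hP₁] with x hx
    have h1 := ((tendsto_mul_linkP hN hx h₀).mul (tendsto_mul_linkP hN hx h₁)).mul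
      ((Real.continuous_exp.tendsto _).comp ((hθ.mul_const (x * (1 - s * t))).neg))
    refine (h1.congr fun l => rfl).trans (le_of_eq ?_)
    congr 1
    rw [mul_assoc κ]
    ring

/-- Here `W l x` is the probability of a link of an attribute of weight `x` that is of the order
`ω x / N`, and `m` times the integral converges because `1 - e ^ (-v) = v * expQuot v`. -/
theorem tendsto_integral_mul_one_sub_exp {P₁ : Measure ℝ} (hP₁ : ∀ᵐ x ∂P₁, 0 ≤ x)
    (hX : Integrable (fun x : ℝ => x ^ 2) P₁) {y γ b κ : ℝ} (hγ : 0 ≤ γ) {N θ m : ℕ → ℝ}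
    (hN : Tendsto N atTop atTop) (hm0 : ∀ l, 0 ≤ m l) (hθ0 : ∀ l, 0 ≤ θ l)
    (hθ : Tendsto θ atTop (𝓝 κ)) (hb : Tendsto (fun l => m l / N l * θ l) atTop (𝓝 b))
    {W : ℕ → ℝ → ℝ} (hWm : ∀ l, Measurable (W l)) (hW0 : ∀ l x, 0 ≤ W l x)
    (hW1 : ∀ l, 0 < N l → ∀ x, 0 ≤ x → N l * W l x ≤ x * y) {ω : ℝ → ℝ}
    (hW : ∀ x, 0 ≤ x → Tendsto (fun l => N l * W l x) atTop (𝓝 (ω x))) :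
    Tendsto (fun l => m l * ∫ x, W l x * (1 - Real.exp (-(θ l * (x * γ)))) ∂P₁) atTop
      (𝓝 (b * γ * ∫ x, ω x * x * expQuot (κ * (x * γ)) ∂P₁)) := by
  simp only [← integral_const_mul]
  refine tendsto_integral_filter_of_dominated_convergence (fun x => (b + 1) * y * γ * x ^ 2)
    (Eventually.of_forall fun l => ?_) ?_ (hX.const_mul _) ?_
  · have := hWm l
    fun_prop
  · filter_upwards [hN.eventually_gt_atTop 0, hb.eventually_le_const (lt_add_one b)] with l hl hbl
    filter_upwards [hP₁] with x hx
    have hv : 0 ≤ θ l * (x * γ) := mul_nonneg (hθ0 l) (mul_nonneg hx hγ)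
    have hmN : 0 ≤ m l / N l * θ l := mul_nonneg (div_nonneg (hm0 l) hl.le) (hθ0 l)
    have e := mul_expQuot (θ l * (x * γ))
    have hE0 := expQuot_nonneg hv
    have hE1 := expQuot_le_one hv
    have hNW : 0 ≤ N l * W l x := mul_nonneg hl.le (hW0 l x)
    rw [← e]
    have e2 : m l * (W l x * (θ l * (x * γ) * expQuot (θ l * (x * γ)))) =
        (m l / N l * θ l) * (N l * W l x) * (x * γ) * expQuot (θ l * (x * γ)) := by
      field_simp
    rw [e2, Real.norm_of_nonneg (by positivity)]
    calc _ ≤ (b + 1) * (x * y) * (x * γ) * 1 := by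
          have h1 := hW1 l hl x hx
          have : 0 ≤ b + 1 := hmN.trans hbl
          have : 0 ≤ x * y := hNW.trans h1
          gcongr
      _ = _ := by ring
  · filter_upwards [hP₁] with x hx
    have hQ : Tendsto (fun l => expQuot (θ l * (x * γ))) atTop (𝓝 (expQuot (κ * (x * γ)))) :=
      (continuous_expQuot.tendsto _).comp (hθ.mul_const _)
    have h1 := ((hb.mul (hW x hx)).mul_const (x * γ)).mul hQ
    have e : b * γ * (ω x * x * expQuot (κ * (x * γ))) =
        b * ω x * (x * γ) * expQuot (κ * (x * γ)) := by ring
    rw [e]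
    refine h1.congr' ?_
    filter_upwards [hN.eventually_gt_atTop 0] with l hl
    rw [← mul_expQuot (θ l * (x * γ))]
    field_simp

/-- The loss due to a single attribute, multiplied by the number `m` of attributes. The attributes
linked to just one of the two actors contribute the two terms of the limit; those linked to both are
too few to matter. -/
theorem tendsto_one_sub_integral_exp {P₁ : Measure ℝ} [IsProbabilityMeasure P₁]
    (hP₁ : ∀ᵐ x ∂P₁, 0 ≤ x) (hX : Integrable (fun x : ℝ => x ^ 2) P₁) {y₀ y₁ s t b κ : ℝ}
    (h₀ : 0 ≤ y₀) (h₁ : 0 ≤ y₁) (hs1 : s ≤ 1) (ht : 0 ≤ t) (ht1 : t ≤ 1) {N θ m : ℕ → ℝ}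
    (hN : Tendsto N atTop atTop) (hm0 : ∀ l, 0 ≤ m l) (hθ0 : ∀ l, 0 ≤ θ l)
    (hθ : Tendsto θ atTop (𝓝 κ)) (hb : Tendsto (fun l => m l / N l * θ l) atTop (𝓝 b)) :
    Tendsto (fun l => m l *
        (1 - ∫ z, Real.exp (-(θ l * (z.1 * gap s t z.2))) ∂(attrLaw P₁ (N l) y₀ y₁))) atTop
      (𝓝 (y₀ * limRate P₁ b κ s + y₁ * limRate P₁ b κ t)) := by
  have key : ∀ l, m l *
      (1 - ∫ z, Real.exp (-(θ l * (z.1 * gap s t z.2))) ∂(attrLaw P₁ (N l) y₀ y₁)) =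
      ∑ d : Bool × Bool, m l * ∫ x, wt (linkP (N l) x y₀) d.1 * wt (linkP (N l) x y₁) d.2 *
        (1 - Real.exp (-(θ l * (x * gap s t d)))) ∂P₁ := by
    intro l
    have hi : ∀ d, Integrable (fun x => Real.exp (-(θ l * (x * gap s t d)))) P₁ := fun d =>
      integrable_exp_neg hP₁ (hθ0 l) (gap_nonneg hs1 ht ht1 d)
    have hI := integrable_attrLaw (N l) y₀ y₁ (measurable_exp_gap (θ l) s t) hi
    rw [← Finset.mul_sum, ← integral_attrLaw (N l) y₀ y₁
      (f := fun z => 1 - Real.exp (-(θ l * (z.1 * gap s t z.2))))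
      (measurable_const.sub (measurable_exp_gap _ _ _)) fun d => (integrable_const 1).sub (hi d),
      integral_sub (integrable_const 1) hI]
    simp
  simp only [key]
  have hlim : ∀ y u : ℝ, y * limRate P₁ b κ u =
      b * (1 - u) * ∫ x, x * y * x * expQuot (κ * (x * (1 - u))) ∂P₁ := by
    intro y u
    rw [limRate, ← integral_const_mul, ← integral_const_mul, ← integral_const_mul]
    refine integral_congr_ae (Eventually.of_forall fun x => ?_)
    simp only
    rw [mul_assoc κ]
    ring
  have hle : ∀ l, 0 < N l → ∀ x, 0 ≤ x → ∀ y, 0 ≤ y → N l * linkP (N l) x y ≤ x * y := by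
    intro l hl x hx y hy
    calc N l * linkP (N l) x y ≤ N l * (x * y / N l) := by
          have := linkP_le hl.le hx hy
          gcongr
      _ = x * y := by field_simp
  have g11 : 0 ≤ gap s t (true, true) := gap_nonneg hs1 ht ht1 _
  have g10 : gap s t (true, false) = 1 - s := by simp [gap]
  have g01 : gap s t (false, true) = 1 - t := by simp [gap]
  have g00 : gap s t (false, false) = 0 := by simp [gap]
  have t11 := tendsto_integral_mul_one_sub_exp hP₁ hX (y := y₀) g11 hN hm0 hθ0 hθ hb
    (W := fun l x => wt (linkP (N l) x y₀) true * wt (linkP (N l) x y₁) true) (ω := fun _ => 0)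
    (fun l => by fun_prop) (fun l x => attr_weight_nonneg (N l) y₀ y₁ x (true, true))
    (fun l hl x hx => by
      refine le_trans ?_ (hle l hl x hx y₀ h₀)
      exact mul_le_mul_of_nonneg_left (mul_le_of_le_one_right (linkP_nonneg _ _ _)
        (wt_linkP_le_one _ _ _ _)) hl.le)
    (fun x hx => by
      have := (tendsto_mul_linkP hN hx h₀).mul (tendsto_linkP hN hx h₁)
      rw [mul_zero] at this
      refine this.congr fun l => ?_
      simp only [wt, cond_true]
      ring)
  have t10 := tendsto_integral_mul_one_sub_exp hP₁ hX (y := y₀) (sub_nonneg.2 hs1) hN hm0 hθ0 hθ hb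
    (W := fun l x => wt (linkP (N l) x y₀) true * wt (linkP (N l) x y₁) false)
    (ω := fun x => x * y₀)
    (fun l => by fun_prop) (fun l x => attr_weight_nonneg (N l) y₀ y₁ x (true, false))
    (fun l hl x hx => by
      refine le_trans ?_ (hle l hl x hx y₀ h₀)
      exact mul_le_mul_of_nonneg_left (mul_le_of_le_one_right (linkP_nonneg _ _ _)
        (wt_linkP_le_one _ _ _ _)) hl.le)
    (fun x hx => by
      have := (tendsto_mul_linkP hN hx h₀).mul ((tendsto_linkP hN hx h₁).const_sub 1)
      rw [sub_zero, mul_one] at this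
      refine this.congr fun l => ?_
      simp only [wt, cond_true, cond_false]
      ring)
  have t01 := tendsto_integral_mul_one_sub_exp hP₁ hX (y := y₁) (sub_nonneg.2 ht1) hN hm0 hθ0 hθ hb
    (W := fun l x => wt (linkP (N l) x y₀) false * wt (linkP (N l) x y₁) true)
    (ω := fun x => x * y₁)
    (fun l => by fun_prop) (fun l x => attr_weight_nonneg (N l) y₀ y₁ x (false, true))
    (fun l hl x hx => by
      refine le_trans ?_ (hle l hl x hx y₁ h₁)
      exact mul_le_mul_of_nonneg_left (mul_le_of_le_one_left (linkP_nonneg _ _ _)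
        (wt_linkP_le_one _ _ _ _)) hl.le)
    (fun x hx => by
      have := (tendsto_mul_linkP hN hx h₁).mul ((tendsto_linkP hN hx h₀).const_sub 1)
      rw [sub_zero, mul_one] at this
      refine this.congr fun l => ?_
      simp only [wt, cond_true, cond_false]
      ring)
  have hall := (t11.add t10).add t01
  rw [← hlim, ← hlim] at hall
  simp only [zero_mul, integral_zero, mul_zero, zero_add] at hall
  refine hall.congr fun l => ?_
  rw [Fintype.sum_prod_type]
  simp only [Fintype.sum_bool, g10, g01, g00, mul_zero, neg_zero, Real.exp_zero, sub_self,
    integral_zero, add_zero]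

/-! ### The limit for two actors of given weights -/

theorem common_le_sum_both {m : ℕ} (T : Fin m → ℝ × Bool × Bool) : common T ≤ ∑ i, both (T i) := by
  unfold common
  split_ifs with h
  · obtain ⟨i, hi⟩ := h
    have : both (T i) = 1 := by rw [both, if_pos hi]
    rw [← this]
    exact Finset.single_le_sum (f := fun i => both (T i)) (fun j _ => both_nonneg _)
      (Finset.mem_univ i)
  · exact Finset.sum_nonneg fun i _ => both_nonneg _

/-- Inclusion-exclusion: the indicator `common` is the number of common attributes, up to the number
of ordered pairs of distinct ones. -/
theorem abs_common_sub_sum_le {m : ℕ} (T : Fin m → ℝ × Bool × Bool) :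
    |common T - ∑ i, both (T i)| ≤ ∑ i, ∑ j ∈ Finset.univ.erase i, both (T i) * both (T j) := by
  have hnn : ∀ i j, 0 ≤ both (T i) * both (T j) := fun i j =>
    mul_nonneg (both_nonneg _) (both_nonneg _)
  rw [abs_sub_comm, abs_of_nonneg (sub_nonneg.2 (common_le_sum_both T))]
  by_cases h : ∃ i, (T i).2.1 = true ∧ (T i).2.2 = true
  · have hc : common T = 1 := if_pos h
    obtain ⟨i, hi⟩ := h
    have h1 : both (T i) = 1 := by rw [both, if_pos hi]
    rw [hc, ← Finset.add_sum_erase _ _ (Finset.mem_univ i), h1, add_sub_cancel_left]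
    calc ∑ j ∈ Finset.univ.erase i, both (T j)
        = ∑ j ∈ Finset.univ.erase i, both (T i) * both (T j) := by simp only [h1, one_mul]
      _ ≤ _ := Finset.single_le_sum
          (f := fun i => ∑ j ∈ Finset.univ.erase i, both (T i) * both (T j))
          (fun i _ => Finset.sum_nonneg fun j _ => hnn i j) (Finset.mem_univ i)
  · have h0 : ∀ i, both (T i) = 0 := fun i => if_neg fun hi => h ⟨i, hi⟩
    have hc : common T = 0 := if_neg h
    simp [h0, hc]

theorem integrable_both (P₁ : Measure ℝ) [IsProbabilityMeasure P₁] (N y₀ y₁ : ℝ) :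
    Integrable both (attrLaw P₁ N y₀ y₁) :=
  integrable_of_measurable_of_bound measurable_both (C := 1) fun z => by
    rw [abs_of_nonneg (both_nonneg z)]; exact both_le_one z

theorem integral_both_nonneg (P₁ : Measure ℝ) (N y₀ y₁ : ℝ) :
    0 ≤ ∫ z, both z ∂(attrLaw P₁ N y₀ y₁) := integral_nonneg both_nonneg

theorem reach_nonneg {z : ℝ × Bool × Bool} (hz : 0 ≤ z.1) : 0 ≤ reach z := by
  unfold reach; split_ifs <;> simp [hz]

/-- The union bound for the event `common`, uniform in `n` and `m`. It is linear in either weight,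
hence integrable, and serves as the dominating function. -/
theorem mul_integral_common_mul_le {P₁ : Measure ℝ} [IsProbabilityMeasure P₁]
    (hP₁ : ∀ᵐ x ∂P₁, 0 ≤ x) (hX : Integrable (fun x : ℝ => x ^ 2) P₁) {y₀ y₁ : ℝ} (h₀ : 0 ≤ y₀)
    (h₁ : 0 ≤ y₁) {m : ℕ} {n N : ℝ} (hn : 0 ≤ n) (hN : 0 < N) (hnm : N ^ 2 = n * m)
    {f : (Fin m → ℝ × Bool × Bool) → ℝ} (hf : Measurable f) (hf0 : ∀ T, 0 ≤ f T)
    (hf1 : ∀ T, f T ≤ 1) :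
    n * ∫ T, common T * f T ∂(Measure.pi fun _ : Fin m => attrLaw P₁ N y₀ y₁) ≤
      y₀ * y₁ * moment P₁ 2 := by
  have h1 : ∫ T, common T * f T ∂(Measure.pi fun _ : Fin m => attrLaw P₁ N y₀ y₁) ≤
      ∫ T, ∑ i, both (T i) ∂(Measure.pi fun _ : Fin m => attrLaw P₁ N y₀ y₁) := by
    refine integral_mono (integrable_of_measurable_of_bound (measurable_common.mul hf) (C := 1)
      fun T => ?_) (integrable_finsetSum _ fun i _ =>
        integrable_pi_eval (integrable_both P₁ N y₀ y₁) i) fun T => ?_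
    · rw [abs_of_nonneg (mul_nonneg (common_nonneg T) (hf0 T))]
      exact mul_le_one₀ (common_le_one T) (hf0 T) (hf1 T)
    · exact (mul_le_of_le_one_right (common_nonneg T) (hf1 T)).trans (common_le_sum_both T)
  rw [integral_finsetSum _ fun i _ => integrable_pi_eval (integrable_both P₁ N y₀ y₁) i] at h1
  simp only [integral_pi_eval _ measurable_both.aestronglyMeasurable, Finset.sum_const,
    Finset.card_univ, Fintype.card_fin, nsmul_eq_mul] at h1
  calc _ ≤ n * (m * ∫ z, both z ∂(attrLaw P₁ N y₀ y₁)) := by gcongr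
    _ = N ^ 2 * ∫ z, both z ∂(attrLaw P₁ N y₀ y₁) := by rw [hnm]; ring
    _ ≤ _ := integral_both_le hP₁ hX hN h₀ h₁

/-- Two actors rarely share more than one attribute. -/
theorem mul_integral_sum_both_mul_both_le {P₁ : Measure ℝ} [IsProbabilityMeasure P₁]
    (hP₁ : ∀ᵐ x ∂P₁, 0 ≤ x) (hX : Integrable (fun x : ℝ => x ^ 2) P₁) {y₀ y₁ : ℝ} (h₀ : 0 ≤ y₀)
    (h₁ : 0 ≤ y₁) {m : ℕ} {n N : ℝ} (hn : 0 < n) (hN : 0 < N) (hnm : N ^ 2 = n * m) :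
    n * ∫ T : Fin m → ℝ × Bool × Bool, ∑ i, ∑ j ∈ Finset.univ.erase i, both (T i) * both (T j)
        ∂(Measure.pi fun _ : Fin m => attrLaw P₁ N y₀ y₁) ≤
      (y₀ * y₁ * moment P₁ 2) ^ 2 / n := by
  set I := ∫ z, both z ∂(attrLaw P₁ N y₀ y₁) with hI
  have hI0 : 0 ≤ I := integral_both_nonneg P₁ N y₀ y₁
  have hint : ∀ i : Fin m, ∀ j ∈ Finset.univ.erase i, Integrable (fun T : Fin m → ℝ × Bool × Bool =>
      both (T i) * both (T j)) (Measure.pi fun _ : Fin m => attrLaw P₁ N y₀ y₁) := fun i j hj =>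
    integrable_pi_eval_mul_eval measurable_both measurable_both (integrable_both P₁ N y₀ y₁)
      (integrable_both P₁ N y₀ y₁) (Finset.ne_of_mem_erase hj).symm
  rw [integral_finsetSum _ fun i _ => integrable_finsetSum _ (hint i)]
  have h2 : ∀ i : Fin m, ∫ T : Fin m → ℝ × Bool × Bool, ∑ j ∈ Finset.univ.erase i,
      both (T i) * both (T j) ∂(Measure.pi fun _ : Fin m => attrLaw P₁ N y₀ y₁) ≤ m * I ^ 2 := by
    intro i
    rw [integral_finsetSum _ (hint i)]
    calc _ = ∑ j ∈ Finset.univ.erase i, I ^ 2 := Finset.sum_congr rfl fun j hj => by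
          rw [integral_pi_eval_mul_eval _ measurable_both measurable_both
            (Finset.ne_of_mem_erase hj).symm, sq]
      _ ≤ ∑ j : Fin m, I ^ 2 := Finset.sum_le_sum_of_subset_of_nonneg (Finset.erase_subset _ _)
          fun _ _ _ => sq_nonneg I
      _ = m * I ^ 2 := by simp
  have h3 := integral_both_le hP₁ hX hN h₀ h₁
  rw [← hI, hnm] at h3
  calc _ ≤ n * ∑ _i : Fin m, m * I ^ 2 := by gcongr with i; exact h2 i
    _ = (n * m * I) ^ 2 / n := by simp; field_simp
    _ ≤ _ := by gcongr

/-- A pointwise bound for an error `D ≤ 1` that is small when the total weight `S` of the linked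
attributes is small. If `n S / N ≤ 2 R`, the error is at most `E`. Otherwise the `i`-th attribute
or the other attributes together contribute more than `R`, and `D ≤ 1` is used. -/
theorem both_mul_le {D R n N E : ℝ} {m k : ℕ} {T : Fin m → ℝ × Bool × Bool}
    {e : ℝ → ℝ} (hT : ∀ i, 0 ≤ (T i).1) (hR : 0 < R) (hn : 0 < n) (hN : 0 < N) (hkn : k ≤ n)
    (he : ∀ z z', 0 ≤ z → z ≤ z' → e z ≤ e z') (he0 : ∀ z, 0 ≤ z → 0 ≤ e z)
    (hE : E = 2 * R * e (2 * R / n)) (hD1 : D ≤ 1)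
    (hD : D ≤ k * ((∑ j, reach (T j)) / N * e ((∑ j, reach (T j)) / N))) (i : Fin m) :
    both (T i) * D ≤ both (T i) * E + both (T i) * (if R < n / N * (T i).1 then 1 else 0) +
      n / (N * R) * ∑ j ∈ Finset.univ.erase i, both (T i) * reach (T j) := by
  by_cases hb : (T i).2.1 = true ∧ (T i).2.2 = true
  swap
  · have : both (T i) = 0 := if_neg hb
    simp [this]
  have h1 : both (T i) = 1 := if_pos hb
  have hr : reach (T i) = (T i).1 := by simp [reach, hb.1]
  simp only [h1, one_mul]
  set S := ∑ j, reach (T j) with hS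
  set S' := ∑ j ∈ Finset.univ.erase i, reach (T j) with hS'
  have hSS' : S = (T i).1 + S' := by
    rw [hS, ← Finset.add_sum_erase _ _ (Finset.mem_univ i), hr]
  have hS'0 : 0 ≤ S' := Finset.sum_nonneg fun j _ => reach_nonneg (hT j)
  have hS0 : 0 ≤ S := by rw [hSS']; exact add_nonneg (hT i) hS'0
  have hE0 : 0 ≤ E := by rw [hE]; exact mul_nonneg (by positivity) (he0 _ (by positivity))
  have hlast : 0 ≤ n / (N * R) * S' := by positivity
  have hind : (0 : ℝ) ≤ if R < n / N * (T i).1 then 1 else 0 := by split_ifs <;> norm_num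
  rcases le_or_gt (n * (S / N)) (2 * R) with h | h
  · have hz : S / N ≤ 2 * R / n := by rw [le_div_iff₀ hn]; linarith
    have hz0 : 0 ≤ S / N := by positivity
    have h2 : D ≤ E := by
      rw [hE]
      refine hD.trans ?_
      calc (k : ℝ) * (S / N * e (S / N)) ≤ n * (S / N * e (2 * R / n)) := by
            have h3 := he _ _ hz0 hz
            have h4 := he0 _ hz0
            gcongr
        _ = n * (S / N) * e (2 * R / n) := by ring
        _ ≤ _ := mul_le_mul_of_nonneg_right h (he0 _ (by positivity))
    linarith
  · by_cases hx : R < n / N * (T i).1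
    · rw [if_pos hx]; linarith
    · rw [if_neg hx]
      have h3 : 1 ≤ n / (N * R) * S' := by
        have e1 : n * (S / N) = n / N * (T i).1 + n / N * S' := by rw [hSS']; ring
        have e2 : n / (N * R) * S' = n / N * S' / R := by field_simp
        rw [e2, le_div_iff₀ hR]
        linarith
      linarith

theorem exp_gap_le_one {s t θ : ℝ} (hs1 : s ≤ 1) (ht : 0 ≤ t) (ht1 : t ≤ 1) (hθ : 0 ≤ θ) {m : ℕ}
    {T : Fin m → ℝ × Bool × Bool} (hT : ∀ i, 0 ≤ (T i).1) :
    Real.exp (-(θ * ∑ i, (T i).1 * gap s t (T i).2)) ≤ 1 :=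
  Real.exp_le_one_iff.2 (neg_nonpos.2 (mul_nonneg hθ (sum_mul_gap_nonneg hs1 ht ht1 hT)))

theorem measurable_exp_sum_gap (s t θ : ℝ) {m : ℕ} :
    Measurable fun T : Fin m → ℝ × Bool × Bool =>
      Real.exp (-(θ * ∑ i, (T i).1 * gap s t (T i).2)) := by
  have h : ∀ i : Fin m, Measurable fun T : Fin m → ℝ × Bool × Bool =>
      (T i).1 * gap s t (T i).2 := fun i =>
    (measurable_fst.mul (measurable_gap s t)).comp (measurable_pi_apply i)
  exact Real.measurable_exp.comp
    ((Finset.measurable_sum _ fun i _ => h i).const_mul θ).neg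

theorem abs_meanGF_pow_sub_exp_le_one {P₂ : Measure ℝ} [IsProbabilityMeasure P₂] (N : ℝ)
    {s t θ : ℝ} (hs : 0 ≤ s) (hs1 : s ≤ 1) (ht : 0 ≤ t) (ht1 : t ≤ 1) (hθ : 0 ≤ θ) {m : ℕ} (k : ℕ)
    {T : Fin m → ℝ × Bool × Bool} (hT : ∀ i, 0 ≤ (T i).1) :
    |meanGF P₂ N s t T ^ k - Real.exp (-(θ * ∑ i, (T i).1 * gap s t (T i).2))| ≤ 1 := by
  have a0 := pow_nonneg (meanGF_nonneg P₂ N hs hs1 ht ht1 T) k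
  have a1 := pow_le_one₀ (n := k) (meanGF_nonneg P₂ N hs hs1 ht ht1 T)
    (meanGF_le_one P₂ N hs hs1 ht ht1 T)
  have b0 := (Real.exp_pos (-(θ * ∑ i, (T i).1 * gap s t (T i).2))).le
  have b1 := exp_gap_le_one hs1 ht ht1 hθ hT
  rw [abs_le]
  constructor <;> linarith

theorem integrable_both_mul_abs_sub {P₁ P₂ : Measure ℝ} [IsProbabilityMeasure P₁]
    [IsProbabilityMeasure P₂] (hP₁ : ∀ᵐ x ∂P₁, 0 ≤ x) (N y₀ y₁ : ℝ) {s t θ : ℝ} (hs : 0 ≤ s)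
    (hs1 : s ≤ 1) (ht : 0 ≤ t) (ht1 : t ≤ 1) (hθ : 0 ≤ θ) {m : ℕ} (k : ℕ) (i : Fin m) :
    Integrable (fun T : Fin m → ℝ × Bool × Bool => both (T i) *
      |meanGF P₂ N s t T ^ k - Real.exp (-(θ * ∑ i, (T i).1 * gap s t (T i).2))|)
      (Measure.pi fun _ : Fin m => attrLaw P₁ N y₀ y₁) := by
  refine Integrable.of_bound ((measurable_both.comp (measurable_pi_apply i)).mul
    (((measurable_meanGF N s t).pow_const k).sub
      (measurable_exp_sum_gap s t θ)).abs).aestronglyMeasurable 1 ?_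
  filter_upwards [ae_pi_attrLaw_nonneg hP₁ N y₀ y₁ m] with T hT
  rw [Real.norm_of_nonneg (mul_nonneg (both_nonneg _) (abs_nonneg _))]
  exact mul_le_one₀ (both_le_one _) (abs_nonneg _)
    (abs_meanGF_pow_sub_exp_le_one N hs hs1 ht ht1 hθ k hT)

theorem integrable_both_mul_exp {P₁ : Measure ℝ} [IsProbabilityMeasure P₁]
    (hP₁ : ∀ᵐ x ∂P₁, 0 ≤ x) (N y₀ y₁ : ℝ) {s t θ : ℝ} (hs1 : s ≤ 1) (ht : 0 ≤ t) (ht1 : t ≤ 1)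
    (hθ : 0 ≤ θ) {m : ℕ} (i : Fin m) :
    Integrable (fun T : Fin m → ℝ × Bool × Bool => both (T i) *
      Real.exp (-(θ * ∑ i, (T i).1 * gap s t (T i).2)))
      (Measure.pi fun _ : Fin m => attrLaw P₁ N y₀ y₁) := by
  refine Integrable.of_bound ((measurable_both.comp (measurable_pi_apply i)).mul
    (measurable_exp_sum_gap s t θ)).aestronglyMeasurable 1 ?_
  filter_upwards [ae_pi_attrLaw_nonneg hP₁ N y₀ y₁ m] with T hT
  rw [Real.norm_of_nonneg (mul_nonneg (both_nonneg _) (Real.exp_pos _).le)]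
  exact mul_le_one₀ (both_le_one _) (Real.exp_pos _).le (exp_gap_le_one hs1 ht ht1 hθ hT)

/-- The cost of linearizing the mean contribution of an actor. The truncation at the level `R` of
the weight of the linked attributes is needed because `X` has two moments only. -/
theorem mul_sum_integral_both_mul_abs_le {P₁ P₂ : Measure ℝ} [IsProbabilityMeasure P₁]
    [IsProbabilityMeasure P₂] (hP₁ : ∀ᵐ x ∂P₁, 0 ≤ x) (hP₂ : ∀ᵐ y ∂P₂, 0 ≤ y)
    (hX : Integrable (fun x : ℝ => x ^ 2) P₁) (hY : Integrable (fun y : ℝ => y) P₂)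
    {y₀ y₁ s t : ℝ} (h₀ : 0 ≤ y₀) (h₁ : 0 ≤ y₁) (hs : 0 ≤ s) (hs1 : s ≤ 1) (ht : 0 ≤ t)
    (ht1 : t ≤ 1) {m k : ℕ} {n N R : ℝ} (hR : 0 < R) (hn : 0 < n) (hN : 0 < N)
    (hnm : N ^ 2 = n * m) (hkn : k ≤ n) :
    n * ∫ T : Fin m → ℝ × Bool × Bool, ∑ i, both (T i) * |meanGF P₂ N s t T ^ k -
        Real.exp (-(k * moment P₂ 1 / N * ∑ i, (T i).1 * gap s t (T i).2))|
        ∂(Measure.pi fun _ : Fin m => attrLaw P₁ N y₀ y₁) ≤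
      y₀ * y₁ * moment P₁ 2 * (2 * R * linErr P₂ (2 * R / n)) +
        y₀ * y₁ * (∫ x, x ^ 2 * (if R < n / N * x then 1 else 0) ∂P₁) +
        y₀ * y₁ * moment P₁ 2 * ((y₀ + y₁) * moment P₁ 2) / R := by
  set μ := Measure.pi fun _ : Fin m => attrLaw P₁ N y₀ y₁ with hμ
  set θ := k * moment P₂ 1 / N with hθ
  have hθ0 : 0 ≤ θ := div_nonneg (mul_nonneg (Nat.cast_nonneg k) (moment_one_nonneg hP₂)) hN.le
  set E := 2 * R * linErr P₂ (2 * R / n) with hE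
  set ind : ℝ × Bool × Bool → ℝ := fun z => if R < n / N * z.1 then 1 else 0 with hind
  have hindm' : Measurable fun x : ℝ => if R < n / N * x then (1 : ℝ) else 0 :=
    Measurable.ite (measurableSet_lt measurable_const (measurable_id.const_mul _))
      measurable_const measurable_const
  have hindm : Measurable ind := hindm'.comp measurable_fst
  have hbi : Measurable fun z => both z * ind z := measurable_both.mul hindm
  have hbii : Integrable (fun z => both z * ind z) (attrLaw P₁ N y₀ y₁) :=
    integrable_of_measurable_of_bound hbi (C := 1) fun z => by
      have : 0 ≤ ind z := by simp only [hind]; split_ifs <;> norm_num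
      have h1 : ind z ≤ 1 := by simp only [hind]; split_ifs <;> norm_num
      rw [abs_of_nonneg (mul_nonneg (both_nonneg z) this)]
      exact mul_le_one₀ (both_le_one z) this h1
  have hb := integrable_both P₁ N y₀ y₁
  have hr := integrable_reach hX N y₀ y₁
  have hpair : ∀ i : Fin m, ∀ j ∈ Finset.univ.erase i,
      Integrable (fun T : Fin m → ℝ × Bool × Bool => both (T i) * reach (T j)) μ := fun i j hj =>
    integrable_pi_eval_mul_eval measurable_both measurable_reach hb hr
      (Finset.ne_of_mem_erase hj).symm
  have hT := ae_pi_attrLaw_nonneg hP₁ N y₀ y₁ m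
  have hLi : ∀ i : Fin m, Integrable (fun T : Fin m → ℝ × Bool × Bool => both (T i) *
      |meanGF P₂ N s t T ^ k - Real.exp (-(θ * ∑ i, (T i).1 * gap s t (T i).2))|) μ :=
    integrable_both_mul_abs_sub hP₁ N y₀ y₁ hs hs1 ht ht1 hθ0 k
  have hRi : ∀ i : Fin m, Integrable (fun T : Fin m → ℝ × Bool × Bool =>
      both (T i) * E + both (T i) * ind (T i) +
        n / (N * R) * ∑ j ∈ Finset.univ.erase i, both (T i) * reach (T j)) μ := fun i =>
    (((integrable_pi_eval hb i).mul_const E).add (integrable_pi_eval hbii i)).add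
      ((integrable_finsetSum _ (hpair i)).const_mul _)
  have hone : ∀ i : Fin m, ∫ T : Fin m → ℝ × Bool × Bool, both (T i) * |meanGF P₂ N s t T ^ k -
        Real.exp (-(θ * ∑ i, (T i).1 * gap s t (T i).2))| ∂μ ≤
      (∫ z, both z ∂(attrLaw P₁ N y₀ y₁)) * E + ∫ z, both z * ind z ∂(attrLaw P₁ N y₀ y₁) +
        n / (N * R) * (m * ((∫ z, both z ∂(attrLaw P₁ N y₀ y₁)) *
          ((y₀ + y₁) / N * moment P₁ 2))) := by
    intro i
    calc _ ≤ ∫ T : Fin m → ℝ × Bool × Bool, (both (T i) * E + both (T i) * ind (T i) +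
            n / (N * R) * ∑ j ∈ Finset.univ.erase i, both (T i) * reach (T j)) ∂μ := by
          refine integral_mono_ae (hLi i) (hRi i) ?_
          filter_upwards [hT] with T hT
          exact both_mul_le hT hR hn hN hkn (fun z z' h h' => linErr_mono hP₂ hY h h')
            (fun z h => linErr_nonneg hP₂ h) hE
            (abs_meanGF_pow_sub_exp_le_one N hs hs1 ht ht1 hθ0 k hT)
            (abs_meanGF_pow_sub_exp_le hP₂ hY hN hs hs1 ht ht1 hT k) i
      _ = (∫ z, both z ∂(attrLaw P₁ N y₀ y₁)) * E + ∫ z, both z * ind z ∂(attrLaw P₁ N y₀ y₁) +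
            n / (N * R) * ∑ j ∈ Finset.univ.erase i, (∫ z, both z ∂(attrLaw P₁ N y₀ y₁)) *
              ∫ z, reach z ∂(attrLaw P₁ N y₀ y₁) := by
          have hA1 : Integrable (fun T : Fin m → ℝ × Bool × Bool => both (T i) * E) μ :=
            (integrable_pi_eval hb i).mul_const E
          have hA2 : Integrable (fun T : Fin m → ℝ × Bool × Bool => both (T i) * ind (T i)) μ :=
            integrable_pi_eval hbii i
          have hA : Integrable (fun T : Fin m → ℝ × Bool × Bool =>
            both (T i) * E + both (T i) * ind (T i)) μ := hA1.add hA2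
          have hC : Integrable (fun T : Fin m → ℝ × Bool × Bool =>
              n / (N * R) * ∑ j ∈ Finset.univ.erase i, both (T i) * reach (T j)) μ :=
            (integrable_finsetSum _ (hpair i)).const_mul _
          have v1 : ∫ T : Fin m → ℝ × Bool × Bool, both (T i) ∂μ =
            ∫ z, both z ∂(attrLaw P₁ N y₀ y₁) :=
            integral_pi_eval _ measurable_both.aestronglyMeasurable i
          have v2 : ∫ T : Fin m → ℝ × Bool × Bool, both (T i) * ind (T i) ∂μ =
            ∫ z, both z * ind z ∂(attrLaw P₁ N y₀ y₁) :=
            integral_pi_eval _ hbi.aestronglyMeasurable i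
          rw [integral_add hA hC, integral_add hA1 hA2, integral_mul_const, integral_const_mul,
            integral_finsetSum _ (hpair i), v1, v2]
          congr 2
          exact Finset.sum_congr rfl fun j hj => integral_pi_eval_mul_eval _ measurable_both
            measurable_reach (Finset.ne_of_mem_erase hj).symm
      _ ≤ _ := by
          gcongr
          have hb0 := integral_both_nonneg P₁ N y₀ y₁
          have hre := integral_reach_le hP₁ hX hN h₀ h₁
          have hm2 : 0 ≤ moment P₁ 2 := integral_nonneg fun x => sq_nonneg x
          calc _ ≤ ∑ j ∈ Finset.univ.erase i, (∫ z, both z ∂(attrLaw P₁ N y₀ y₁)) *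
                ((y₀ + y₁) / N * moment P₁ 2) := by gcongr
            _ ≤ ∑ j : Fin m, (∫ z, both z ∂(attrLaw P₁ N y₀ y₁)) *
                ((y₀ + y₁) / N * moment P₁ 2) :=
                Finset.sum_le_sum_of_subset_of_nonneg (Finset.erase_subset _ _)
                  fun _ _ _ => by positivity
            _ = _ := by simp
  rw [integral_finsetSum _ fun i _ => hLi i]
  have hB := integral_both_le hP₁ hX hN h₀ h₁
  have hBI := integral_both_mul_le hP₁ hX hN h₀ h₁ hindm'
    (fun x => by split_ifs <;> norm_num) (fun x => by split_ifs <;> norm_num)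
  have hE0 : 0 ≤ E := mul_nonneg (by positivity) (linErr_nonneg hP₂ (by positivity))
  have hm2 : 0 ≤ moment P₁ 2 := integral_nonneg fun x => sq_nonneg x
  set I := ∫ z, both z ∂(attrLaw P₁ N y₀ y₁) with hI
  set J := ∫ z, both z * ind z ∂(attrLaw P₁ N y₀ y₁) with hJ
  calc _ ≤ n * ∑ _i : Fin m, (I * E + J +
          n / (N * R) * (m * (I * ((y₀ + y₁) / N * moment P₁ 2)))) := by
        gcongr with i
        exact hone i
    _ = (N ^ 2 * I) * E + N ^ 2 * J + (N ^ 2 * I) * ((y₀ + y₁) * moment P₁ 2) *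
          (n * m / N ^ 2) / R := by
        rw [Finset.sum_const, Finset.card_univ, Fintype.card_fin, nsmul_eq_mul]
        rw [hnm]
        have : n * (m : ℝ) ≠ 0 := by rw [← hnm]; positivity
        have hm : (m : ℝ) ≠ 0 := right_ne_zero_of_mul this
        have e : N * N = n * m := by rw [← hnm, sq]
        have e3 : n / (N * R) * (m * (I * ((y₀ + y₁) / N * moment P₁ 2))) =
            n * m * (I * ((y₀ + y₁) * moment P₁ 2)) / (N * N) / R := by
          field_simp
        rw [e3, e]
        field_simp
    _ = (N ^ 2 * I) * E + N ^ 2 * J + (N ^ 2 * I) * ((y₀ + y₁) * moment P₁ 2) / R := by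
        rw [← hnm, div_self (by positivity), mul_one]
    _ ≤ _ := by gcongr

/-- The linearized expectation factorizes over the attributes. -/
theorem integral_sum_both_mul_exp {P₁ : Measure ℝ} [IsProbabilityMeasure P₁] (N y₀ y₁ θ s t : ℝ)
    (hP₁ : ∀ᵐ x ∂P₁, 0 ≤ x) (hs1 : s ≤ 1) (ht : 0 ≤ t) (ht1 : t ≤ 1) (hθ : 0 ≤ θ) (m : ℕ) :
    ∫ T : Fin m → ℝ × Bool × Bool, ∑ i, both (T i) *
        Real.exp (-(θ * ∑ i, (T i).1 * gap s t (T i).2))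
        ∂(Measure.pi fun _ : Fin m => attrLaw P₁ N y₀ y₁) =
      m * ((∫ z, both z * Real.exp (-(θ * (z.1 * gap s t z.2))) ∂(attrLaw P₁ N y₀ y₁)) *
        (∫ z, Real.exp (-(θ * (z.1 * gap s t z.2))) ∂(attrLaw P₁ N y₀ y₁)) ^ (m - 1)) := by
  rw [integral_finsetSum _ fun i _ => ?_]
  · have h : ∀ i : Fin m, ∫ T : Fin m → ℝ × Bool × Bool, both (T i) *
        Real.exp (-(θ * ∑ i, (T i).1 * gap s t (T i).2))
        ∂(Measure.pi fun _ : Fin m => attrLaw P₁ N y₀ y₁) =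
        (∫ z, both z * Real.exp (-(θ * (z.1 * gap s t z.2))) ∂(attrLaw P₁ N y₀ y₁)) *
        (∫ z, Real.exp (-(θ * (z.1 * gap s t z.2))) ∂(attrLaw P₁ N y₀ y₁)) ^ (m - 1) := by
      intro i
      have hprod := integral_fintype_prod_eq_prod (𝕜 := ℝ)
        (μ := fun _ : Fin m => attrLaw P₁ N y₀ y₁) fun (j : Fin m) (z : ℝ × Bool × Bool) =>
          (if j = i then both z else 1) * Real.exp (-(θ * (z.1 * gap s t z.2)))
      have e1 : ∀ T : Fin m → ℝ × Bool × Bool, ∏ j, ((if j = i then both (T j) else 1) *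
          Real.exp (-(θ * ((T j).1 * gap s t (T j).2)))) =
          both (T i) * Real.exp (-(θ * ∑ i, (T i).1 * gap s t (T i).2)) := by
        intro T
        rw [Finset.prod_mul_distrib, ← Real.exp_sum, Finset.prod_ite_eq' Finset.univ i,
          if_pos (Finset.mem_univ i), Finset.mul_sum, Finset.sum_neg_distrib]
      simp only [e1] at hprod
      rw [hprod, ← Finset.mul_prod_erase _ _ (Finset.mem_univ i)]
      congr 1
      · simp
      · rw [Finset.prod_congr rfl (g := fun _ => ∫ z, Real.exp (-(θ * (z.1 * gap s t z.2)))
          ∂(attrLaw P₁ N y₀ y₁)) fun j hj => by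
            simp only [if_neg (Finset.ne_of_mem_erase hj), one_mul]]
        simp
    simp only [h, Finset.sum_const, Finset.card_univ, Fintype.card_fin, nsmul_eq_mul]
  · exact integrable_both_mul_exp hP₁ N y₀ y₁ hs1 ht ht1 hθ i

theorem tendsto_truncated_sq {P₁ : Measure ℝ} (hX : Integrable (fun x : ℝ => x ^ 2) P₁) (C : ℝ) :
    Tendsto (fun R : ℝ => ∫ x, x ^ 2 * (if R < C * x then 1 else 0) ∂P₁) atTop (𝓝 0) := by
  have h : Tendsto (fun R : ℝ => ∫ x, x ^ 2 * (if R < C * x then 1 else 0) ∂P₁) atTop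
      (𝓝 (∫ _, (0 : ℝ) ∂P₁)) := by
    refine tendsto_integral_filter_of_dominated_convergence (fun x => x ^ 2)
      (Eventually.of_forall fun R => ?_) (Eventually.of_forall fun R =>
        Eventually.of_forall fun x => ?_) hX (Eventually.of_forall fun x => ?_)
    · exact ((measurable_id.pow_const 2).mul (Measurable.ite (measurableSet_lt measurable_const
        (measurable_id.const_mul _)) measurable_const measurable_const)).aestronglyMeasurable
    · rw [norm_mul, Real.norm_of_nonneg (sq_nonneg x)]
      refine mul_le_of_le_one_right (sq_nonneg x) ?_
      split_ifs <;> simp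
    · refine tendsto_const_nhds.congr' ?_
      filter_upwards [eventually_ge_atTop (C * x)] with R hR
      rw [if_neg (not_lt.2 hR), mul_zero]
  simpa using h

/-- The linearization error vanishes: first the number of actors tends to infinity, then the
truncation level `R`. -/
theorem tendsto_mul_sum_integral_both_mul_abs {P₁ P₂ : Measure ℝ} [IsProbabilityMeasure P₁]
    [IsProbabilityMeasure P₂] (hP₁ : ∀ᵐ x ∂P₁, 0 ≤ x) (hP₂ : ∀ᵐ y ∂P₂, 0 ≤ y)
    (hX : Integrable (fun x : ℝ => x ^ 2) P₁) (hY : Integrable (fun y : ℝ => y) P₂)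
    {y₀ y₁ s t : ℝ} (h₀ : 0 ≤ y₀) (h₁ : 0 ≤ y₁) (hs : 0 ≤ s) (hs1 : s ≤ 1) (ht : 0 ≤ t)
    (ht1 : t ≤ 1) {m k : ℕ → ℕ} {n N : ℕ → ℝ} {c : ℝ} (hn : Tendsto n atTop atTop)
    (hN : Tendsto N atTop atTop) (hnm : ∀ l, N l ^ 2 = n l * m l) (hkn : ∀ l, k l ≤ n l)
    (hc : Tendsto (fun l => n l / N l) atTop (𝓝 c)) :
    Tendsto (fun l => n l * ∫ T : Fin (m l) → ℝ × Bool × Bool, ∑ i, both (T i) *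
        |meanGF P₂ (N l) s t T ^ k l -
          Real.exp (-(k l * moment P₂ 1 / N l * ∑ i, (T i).1 * gap s t (T i).2))|
        ∂(Measure.pi fun _ : Fin (m l) => attrLaw P₁ (N l) y₀ y₁)) atTop (𝓝 0) := by
  set K := y₀ * y₁ * moment P₁ 2 with hK
  set K' := K * ((y₀ + y₁) * moment P₁ 2) with hK'
  have hR0 : Tendsto (fun R : ℝ => y₀ * y₁ *
      (∫ x, x ^ 2 * (if R < (c + 1) * x then 1 else 0) ∂P₁) + K' / R) atTop (𝓝 0) := by
    have := ((tendsto_truncated_sq hX (c + 1)).const_mul (y₀ * y₁)).add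
      (tendsto_const_nhds (x := K').div_atTop tendsto_id)
    simpa using this
  have hpos : ∀ᶠ l in atTop, 0 < n l ∧ 0 < N l :=
    (hn.eventually_gt_atTop 0).and (hN.eventually_gt_atTop 0)
  refine tendsto_order.2 ⟨fun a ha => ?_, fun ε hε => ?_⟩
  · filter_upwards [hpos] with l hl
    exact ha.trans_le (mul_nonneg hl.1.le (integral_nonneg fun T =>
      Finset.sum_nonneg fun i _ => mul_nonneg (both_nonneg _) (abs_nonneg _)))
  obtain ⟨R, hRε, hR⟩ := ((hR0.eventually_lt_const (half_pos hε)).and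
    (eventually_gt_atTop (0 : ℝ))).exists
  have hlin : Tendsto (fun l => K * (2 * R * linErr P₂ (2 * R / n l))) atTop (𝓝 0) := by
    have h1 : Tendsto (fun l => 2 * R / n l) atTop (𝓝 0) := tendsto_const_nhds.div_atTop hn
    have h2 := tendsto_linErr hP₂ hY (by
      filter_upwards [hpos] with l hl
      exact div_nonneg (by positivity) hl.1.le) h1
    simpa using (h2.const_mul (2 * R)).const_mul K
  filter_upwards [hpos, hlin.eventually_lt_const (half_pos hε),
    hc.eventually_lt_const (lt_add_one c)] with l hl h1 h2
  refine (mul_sum_integral_both_mul_abs_le hP₁ hP₂ hX hY h₀ h₁ hs hs1 ht ht1 hR hl.1 hl.2 (hnm l)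
    (hkn l)).trans_lt ?_
  have h3 : ∫ x, x ^ 2 * (if R < n l / N l * x then 1 else 0) ∂P₁ ≤
      ∫ x, x ^ 2 * (if R < (c + 1) * x then 1 else 0) ∂P₁ := by
    have hint : ∀ C : ℝ, Integrable (fun x => x ^ 2 * (if R < C * x then (1 : ℝ) else 0)) P₁ := by
      intro C
      refine hX.mono ((measurable_id.pow_const 2).mul (Measurable.ite (measurableSet_lt
        measurable_const (measurable_id.const_mul _)) measurable_const
        measurable_const)).aestronglyMeasurable (Eventually.of_forall fun x => ?_)
      rw [norm_mul]
      refine mul_le_of_le_one_right (norm_nonneg _) ?_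
      split_ifs <;> simp
    refine integral_mono_ae (hint _) (hint _) ?_
    filter_upwards [hP₁] with x hx
    refine mul_le_mul_of_nonneg_left ?_ (sq_nonneg x)
    split_ifs with ha hb
    · exact le_rfl
    · exact absurd (ha.trans_le (mul_le_mul_of_nonneg_right h2.le hx)) hb
    · exact zero_le_one
    · exact le_rfl
  have h4 := mul_le_mul_of_nonneg_left h3 (mul_nonneg h₀ h₁)
  linarith

/-- The limit for given weights of the two actors: the factor `limA` stems from the one common
attribute, the exponential from the attributes linked to one of the two actors only. -/
theorem tendsto_mul_integral_common {P₁ P₂ : Measure ℝ} [IsProbabilityMeasure P₁]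
    [IsProbabilityMeasure P₂] (hP₁ : ∀ᵐ x ∂P₁, 0 ≤ x) (hP₂ : ∀ᵐ y ∂P₂, 0 ≤ y)
    (hX : Integrable (fun x : ℝ => x ^ 2) P₁) (hY : Integrable (fun y : ℝ => y) P₂)
    {y₀ y₁ s t : ℝ} (h₀ : 0 ≤ y₀) (h₁ : 0 ≤ y₁) (hs : 0 ≤ s) (hs1 : s ≤ 1) (ht : 0 ≤ t)
    (ht1 : t ≤ 1) {m k : ℕ → ℕ} {n N : ℕ → ℝ} {c κ : ℝ} (hm : Tendsto m atTop atTop)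
    (hn : Tendsto n atTop atTop) (hN0 : ∀ l, 0 ≤ N l)
    (hN : Tendsto N atTop atTop) (hnm : ∀ l, N l ^ 2 = n l * m l) (hkn : ∀ l, n l = k l + 2)
    (hc : Tendsto (fun l => n l / N l) atTop (𝓝 c)) (hκ : κ = c * moment P₂ 1) :
    Tendsto (fun l => n l * ∫ T : Fin (m l) → ℝ × Bool × Bool,
        common T * meanGF P₂ (N l) s t T ^ k l
        ∂(Measure.pi fun _ : Fin (m l) => attrLaw P₁ (N l) y₀ y₁)) atTop
      (𝓝 (y₀ * y₁ * limA P₁ κ (s * t) *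
        Real.exp (-(y₀ * limRate P₁ (moment P₂ 1) κ s + y₁ * limRate P₁ (moment P₂ 1) κ t)))) := by
  have hb := moment_one_nonneg hP₂
  set θ : ℕ → ℝ := fun l => k l * moment P₂ 1 / N l with hθdef
  have hθ0 : ∀ l, 0 ≤ θ l := fun l => div_nonneg (mul_nonneg (Nat.cast_nonneg _) hb) (hN0 l)
  have hpos : ∀ᶠ l in atTop, 0 < n l ∧ 0 < N l :=
    (hn.eventually_gt_atTop 0).and (hN.eventually_gt_atTop 0)
  have hkn1 : Tendsto (fun l => (k l : ℝ) / n l) atTop (𝓝 1) := by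
    have h1 : Tendsto (fun l => 1 - 2 / n l) atTop (𝓝 (1 - 0)) :=
      (tendsto_const_nhds.div_atTop hn).const_sub 1
    rw [sub_zero] at h1
    refine h1.congr' ?_
    filter_upwards [hpos] with l hl
    have := hl.1.ne'
    rw [eq_div_iff this, sub_mul, div_mul_cancel₀ _ this, hkn l]
    ring
  have hθ : Tendsto θ atTop (𝓝 κ) := by
    have h1 := (hc.mul hkn1).mul_const (moment P₂ 1)
    rw [mul_one, ← hκ] at h1
    refine h1.congr' ?_
    filter_upwards [hpos] with l hl
    have := hl.1.ne'
    simp only [hθdef]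
    field_simp
  have hmθ : Tendsto (fun l => (m l : ℝ) / N l * θ l) atTop (𝓝 (moment P₂ 1)) := by
    have h1 := hkn1.mul_const (moment P₂ 1)
    rw [one_mul] at h1
    refine h1.congr' ?_
    filter_upwards [hpos] with l hl
    have e1 := hl.1.ne'
    have e2 := hl.2.ne'
    have e3 := hnm l
    simp only [hθdef]
    rw [div_mul_div_comm, ← sq, e3]
    have e4 : (m l : ℝ) ≠ 0 := by
      intro h0
      rw [h0, mul_zero] at e3
      exact e2 (pow_eq_zero_iff two_ne_zero |>.1 e3)
    field_simp
  -- the linearized expectation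
  have hJ := tendsto_one_sub_integral_exp hP₁ hX h₀ h₁ hs1 ht ht1 hN
    (fun l => Nat.cast_nonneg (m l)) hθ0 hθ hmθ
  have hI := tendsto_integral_both_mul_exp hP₁ hX h₀ h₁ hs1 ht ht1 hN hθ0 hθ
  have hJ1 : ∀ l, ∫ z, Real.exp (-(θ l * (z.1 * gap s t z.2))) ∂(attrLaw P₁ (N l) y₀ y₁) ≤ 1 := by
    intro l
    have hi := integrable_attrLaw (N l) y₀ y₁ (measurable_exp_gap (θ l) s t) fun d =>
      integrable_exp_neg hP₁ (hθ0 l) (gap_nonneg hs1 ht ht1 d)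
    calc _ ≤ ∫ _, (1 : ℝ) ∂(attrLaw P₁ (N l) y₀ y₁) := by
          refine integral_mono_ae hi (integrable_const 1) ?_
          filter_upwards [ae_tagLaw_of_ae (p := fun x : ℝ => 0 ≤ x) measurableSet_Ici hP₁] with z hz
          exact Real.exp_le_one_iff.2 (neg_nonpos.2 (mul_nonneg (hθ0 l)
            (mul_nonneg hz (gap_nonneg hs1 ht ht1 _))))
      _ = 1 := by simp
  have hpow := tendsto_pow_pred_exp hm
    (fun l => integral_nonneg fun z => (Real.exp_pos _).le) hJ1 hJ
  have hmain := hI.mul hpow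
  -- the two errors
  have herr2 := tendsto_mul_sum_integral_both_mul_abs hP₁ hP₂ hX hY h₀ h₁ hs hs1 ht ht1 hn hN hnm
    (k := k) (fun l => by rw [hkn l]; linarith) hc
  have herr1 : Tendsto (fun l => (y₀ * y₁ * moment P₁ 2) ^ 2 / n l) atTop (𝓝 0) :=
    tendsto_const_nhds.div_atTop hn
  have hdiff : Tendsto (fun l => n l * ∫ T : Fin (m l) → ℝ × Bool × Bool,
        common T * meanGF P₂ (N l) s t T ^ k l
        ∂(Measure.pi fun _ : Fin (m l) => attrLaw P₁ (N l) y₀ y₁) -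
      N l ^ 2 * (∫ z, both z * Real.exp (-(θ l * (z.1 * gap s t z.2)))
        ∂(attrLaw P₁ (N l) y₀ y₁)) *
        (∫ z, Real.exp (-(θ l * (z.1 * gap s t z.2))) ∂(attrLaw P₁ (N l) y₀ y₁)) ^ (m l - 1))
      atTop (𝓝 0) := by
    refine squeeze_zero_norm' ?_ (by simpa using herr1.add herr2)
    filter_upwards [hpos] with l hl
    set μ := Measure.pi fun _ : Fin (m l) => attrLaw P₁ (N l) y₀ y₁ with hμ
    have hS := integral_sum_both_mul_exp (N l) y₀ y₁ (θ l) s t hP₁ hs1 ht ht1 (hθ0 l) (m l)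
    have hg0 := fun T : Fin (m l) → ℝ × Bool × Bool => meanGF_nonneg P₂ (N l) hs hs1 ht ht1 T
    have hg1 := fun T : Fin (m l) → ℝ × Bool × Bool => meanGF_le_one P₂ (N l) hs hs1 ht ht1 T
    have hi1 : Integrable (fun T : Fin (m l) → ℝ × Bool × Bool =>
        common T * meanGF P₂ (N l) s t T ^ k l) μ :=
      integrable_of_measurable_of_bound
        (measurable_common.mul ((measurable_meanGF (N l) s t).pow_const _)) (C := 1) fun T => by
        rw [abs_of_nonneg (mul_nonneg (common_nonneg T) (pow_nonneg (hg0 T) _))]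
        exact mul_le_one₀ (common_le_one T) (pow_nonneg (hg0 T) _) (pow_le_one₀ (hg0 T) (hg1 T))
    have hi2 : Integrable (fun T : Fin (m l) → ℝ × Bool × Bool => ∑ i, both (T i) *
        Real.exp (-(θ l * ∑ i, (T i).1 * gap s t (T i).2))) μ :=
      integrable_finsetSum _ fun i _ =>
        integrable_both_mul_exp hP₁ (N l) y₀ y₁ hs1 ht ht1 (hθ0 l) i
    have hi3 : Integrable (fun T : Fin (m l) → ℝ × Bool × Bool =>
        ∑ i, ∑ j ∈ Finset.univ.erase i, both (T i) * both (T j)) μ :=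
      integrable_finsetSum _ fun i _ => integrable_finsetSum _ fun j hj =>
        integrable_pi_eval_mul_eval measurable_both measurable_both (integrable_both P₁ _ y₀ y₁)
          (integrable_both P₁ _ y₀ y₁) (Finset.ne_of_mem_erase hj).symm
    have hi4 : Integrable (fun T : Fin (m l) → ℝ × Bool × Bool => ∑ i, both (T i) *
        |meanGF P₂ (N l) s t T ^ k l -
          Real.exp (-(θ l * ∑ i, (T i).1 * gap s t (T i).2))|) μ :=
      integrable_finsetSum _ fun i _ =>
        integrable_both_mul_abs_sub hP₁ (N l) y₀ y₁ hs hs1 ht ht1 (hθ0 l) (k l) i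
    have e : n l * ∫ T, common T * meanGF P₂ (N l) s t T ^ k l ∂μ -
        N l ^ 2 * (∫ z, both z * Real.exp (-(θ l * (z.1 * gap s t z.2)))
          ∂(attrLaw P₁ (N l) y₀ y₁)) *
        (∫ z, Real.exp (-(θ l * (z.1 * gap s t z.2))) ∂(attrLaw P₁ (N l) y₀ y₁)) ^ (m l - 1) =
        n l * ∫ T, (common T * meanGF P₂ (N l) s t T ^ k l - ∑ i, both (T i) *
          Real.exp (-(θ l * ∑ i, (T i).1 * gap s t (T i).2))) ∂μ := by
      rw [integral_sub hi1 hi2, hS, hnm l]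
      ring
    rw [e, norm_mul, Real.norm_of_nonneg hl.1.le]
    have hle : ‖∫ T, (common T * meanGF P₂ (N l) s t T ^ k l - ∑ i, both (T i) *
          Real.exp (-(θ l * ∑ i, (T i).1 * gap s t (T i).2))) ∂μ‖ ≤
        ∫ T, ((∑ i, ∑ j ∈ Finset.univ.erase i, both (T i) * both (T j)) + ∑ i, both (T i) *
        |meanGF P₂ (N l) s t T ^ k l -
          Real.exp (-(θ l * ∑ i, (T i).1 * gap s t (T i).2))|) ∂μ := by
      refine (norm_integral_le_integral_norm _).trans
        (integral_mono (hi1.sub hi2).norm (hi3.add hi4) fun T => ?_)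
      simp only [Real.norm_eq_abs]
      set g := meanGF P₂ (N l) s t T ^ k l with hg
      set E := Real.exp (-(θ l * ∑ i, (T i).1 * gap s t (T i).2)) with hE
      have e2 : common T * g - ∑ i, both (T i) * E =
          (common T - ∑ i, both (T i)) * g + ∑ i, both (T i) * (g - E) := by
        rw [← Finset.sum_mul, ← Finset.sum_mul]; ring
      rw [e2]
      refine (abs_add_le _ _).trans (add_le_add ?_ ?_)
      · rw [abs_mul, abs_of_nonneg (pow_nonneg (hg0 T) _)]
        exact (mul_le_of_le_one_right (abs_nonneg _) (pow_le_one₀ (hg0 T) (hg1 T))).trans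
          (abs_common_sub_sum_le T)
      · refine (Finset.abs_sum_le_sum_abs _ _).trans (le_of_eq (Finset.sum_congr rfl fun i _ => ?_))
        rw [abs_mul, abs_of_nonneg (both_nonneg _)]
    rw [integral_add hi3 hi4] at hle
    refine (mul_le_mul_of_nonneg_left hle hl.1.le).trans ?_
    rw [mul_add]
    exact add_le_add (mul_integral_sum_both_mul_both_le hP₁ hX h₀ h₁ hl.1 hl.2 (hnm l)) le_rfl
  have := hdiff.add hmain
  rw [zero_add] at this
  exact this.congr fun l => by ring

/-! ### From generating functions to degrees -/

/-- The limit of the joint generating function of the degrees of two adjacent actors, times `n`. The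
weights of the two actors are integrated out by dominated convergence. -/
theorem tendsto_mul_integral_hitGF {P₁ P₂ : Measure ℝ} [IsProbabilityMeasure P₁]
    [IsProbabilityMeasure P₂] (hP₁ : ∀ᵐ x ∂P₁, 0 ≤ x) (hP₂ : ∀ᵐ y ∂P₂, 0 ≤ y)
    (hX : Integrable (fun x : ℝ => x ^ 2) P₁) (hY : Integrable (fun y : ℝ => y) P₂) {s t : ℝ}
    (hs : 0 ≤ s) (hs1 : s ≤ 1) (ht : 0 ≤ t) (ht1 : t ≤ 1) {m k : ℕ → ℕ}
    (hm : Tendsto m atTop atTop) (hk : Tendsto k atTop atTop) {c κ : ℝ}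
    (hc : Tendsto (fun l => ((k l + 2 : ℕ) : ℝ) / √(((k l + 2 : ℕ) : ℝ) * m l)) atTop (𝓝 c))
    (hκ : κ = c * moment P₂ 1) :
    Tendsto (fun l => ((k l + 2 : ℕ) : ℝ) * ∫ h : Bipartite (m l) (k l + 2),
        (if ∃ i, h i 0 = true ∧ h i 1 = true then (1 : ℝ) else 0) *
          ∏ j : Fin (k l), hitGF s t (col h 0) (col h 1) (col h j.succ.succ)
          ∂(bipartiteLaw P₁ P₂ (m l) (k l + 2))) atTop
      (𝓝 (limA P₁ κ (s * t) * limB P₁ P₂ (moment P₂ 1) κ s *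
        limB P₁ P₂ (moment P₂ 1) κ t)) := by
  set n : ℕ → ℝ := fun l => ((k l + 2 : ℕ) : ℝ) with hn
  set N : ℕ → ℝ := fun l => √(n l * m l) with hN
  have hn_pos : ∀ l, 0 < n l := fun l => by simp only [hn]; positivity
  have hn_top : Tendsto n atTop atTop :=
    tendsto_natCast_atTop_atTop.comp ((tendsto_add_atTop_nat 2).comp hk)
  have hmR : Tendsto (fun l => (m l : ℝ)) atTop atTop := tendsto_natCast_atTop_atTop.comp hm
  have hN_top : Tendsto N atTop atTop :=
    Real.tendsto_sqrt_atTop.comp (hn_top.atTop_mul_atTop₀ hmR)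
  have hN0 : ∀ l, 0 ≤ N l := fun l => Real.sqrt_nonneg _
  have hnm : ∀ l, N l ^ 2 = n l * m l := fun l =>
    Real.sq_sqrt (mul_nonneg (hn_pos l).le (Nat.cast_nonneg _))
  have hg0 := fun l (T : Fin (m l) → ℝ × Bool × Bool) => meanGF_nonneg P₂ (N l) hs hs1 ht ht1 T
  have hg1 := fun l (T : Fin (m l) → ℝ × Bool × Bool) => meanGF_le_one P₂ (N l) hs hs1 ht ht1 T
  have hmeas := fun l => measurable_meanGF (P₂ := P₂) (N l) s t (m := m l)
  have hy : ∀ᵐ y ∂(P₂.prod P₂), 0 ≤ y.1 ∧ 0 ≤ y.2 :=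
    (Measure.quasiMeasurePreserving_fst.ae hP₂).and (Measure.quasiMeasurePreserving_snd.ae hP₂)
  have hlim : Tendsto (fun l => ∫ y, n l * ∫ T, common T * meanGF P₂ (N l) s t T ^ k l
        ∂(Measure.pi fun _ : Fin (m l) => attrLaw P₁ (N l) y.1 y.2) ∂(P₂.prod P₂)) atTop
      (𝓝 (∫ y : ℝ × ℝ, y.1 * y.2 * limA P₁ κ (s * t) *
        Real.exp (-(y.1 * limRate P₁ (moment P₂ 1) κ s + y.2 * limRate P₁ (moment P₂ 1) κ t))
        ∂(P₂.prod P₂))) := by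
    refine tendsto_integral_filter_of_dominated_convergence
      (fun y : ℝ × ℝ => y.1 * y.2 * moment P₁ 2) ?_ ?_ ?_ ?_
    · refine Eventually.of_forall fun l => ?_
      refine ((stronglyMeasurable_integral_pi_attrLaw (N l)
        (measurable_common.mul ((hmeas l).pow_const (k l))) (C := 1) fun T => ?_).const_mul
          (n l)).aestronglyMeasurable
      rw [Pi.mul_apply, abs_of_nonneg (mul_nonneg (common_nonneg T) (pow_nonneg (hg0 l T) _))]
      exact mul_le_one₀ (common_le_one T) (pow_nonneg (hg0 l T) _) (pow_le_one₀ (hg0 l T) (hg1 l T))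
    · filter_upwards [hN_top.eventually_gt_atTop 0] with l hl
      filter_upwards [hy] with y hy
      rw [Real.norm_of_nonneg (mul_nonneg (hn_pos l).le (integral_nonneg fun T =>
        mul_nonneg (common_nonneg T) (pow_nonneg (hg0 l T) _)))]
      exact mul_integral_common_mul_le hP₁ hX hy.1 hy.2 (hn_pos l).le hl (hnm l)
        ((hmeas l).pow_const (k l)) (fun T => pow_nonneg (hg0 l T) _)
        fun T => pow_le_one₀ (hg0 l T) (hg1 l T)
    · exact (hY.mul_prod hY).mul_const _
    · filter_upwards [hy] with y hy
      exact tendsto_mul_integral_common hP₁ hP₂ hX hY hy.1 hy.2 hs hs1 ht ht1 hm hn_top hN0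
        hN_top hnm (fun l => by simp [hn]) hc hκ
  have hval : ∫ y : ℝ × ℝ, y.1 * y.2 * limA P₁ κ (s * t) *
        Real.exp (-(y.1 * limRate P₁ (moment P₂ 1) κ s + y.2 * limRate P₁ (moment P₂ 1) κ t))
        ∂(P₂.prod P₂) =
      limA P₁ κ (s * t) * limB P₁ P₂ (moment P₂ 1) κ s * limB P₁ P₂ (moment P₂ 1) κ t := by
    unfold limB
    rw [mul_assoc, ← integral_prod_mul, ← integral_const_mul]
    refine integral_congr_ae (Eventually.of_forall fun y => ?_)
    simp only
    rw [neg_add, Real.exp_add]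
    ring
  rw [hval] at hlim
  refine hlim.congr fun l => ?_
  rw [integral_const_mul, integral_bipartiteLaw_hitGF hs hs1 ht ht1]

section Degree

variable {m k : ℕ} {h : Bipartite m (k + 2)}

theorem deg_eq_sum {n : ℕ} (h : Bipartite m n) (v : Fin n)
    [DecidablePred fun w => (intersectionGraph h).Adj v w] :
    deg h v = ∑ w, if (intersectionGraph h).Adj v w then 1 else 0 := by
  classical
  rw [← Finset.card_filter, deg, Set.ncard_eq_toFinset_card']
  congr 1
  ext w
  simp

/-- If `v₁` and `v₂` are adjacent, each of them has one neighbour besides those among the other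
actors. -/
theorem deg_zero_eq (hA : ∃ i, h i 0 = true ∧ h i 1 = true) :
    deg h 0 = {j : Fin k | ∃ i, h i 0 = true ∧ h i j.succ.succ = true}.ncard + 1 := by
  classical
  rw [deg_eq_sum, Fin.sum_univ_succ, Fin.sum_univ_succ, Set.ncard_eq_toFinset_card',
    Set.toFinset_ofPred, Finset.card_filter, if_neg (SimpleGraph.irrefl _), if_pos, zero_add,
    add_comm]
  · congr 1
    refine Finset.sum_congr rfl fun j _ => ?_
    simp [intersectionGraph, (Fin.succ_ne_zero _).symm]
  · exact ⟨by simp, by simpa using hA⟩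

theorem deg_one_eq (hA : ∃ i, h i 0 = true ∧ h i 1 = true) :
    deg h 1 = {j : Fin k | ∃ i, h i 1 = true ∧ h i j.succ.succ = true}.ncard + 1 := by
  classical
  rw [deg_eq_sum, Fin.sum_univ_succ, Fin.sum_univ_succ, Set.ncard_eq_toFinset_card',
    Set.toFinset_ofPred, Finset.card_filter, if_pos, if_neg, zero_add, add_comm]
  · congr 1
    refine Finset.sum_congr rfl fun j _ => ?_
    have : (1 : Fin (k + 2)) ≠ j.succ.succ := by
      rw [← Fin.succ_zero_eq_one]
      exact fun e => (Fin.succ_ne_zero j).symm (Fin.succ_injective _ e)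
    simp [intersectionGraph, this]
  · exact SimpleGraph.irrefl _
  · obtain ⟨i, h0, h1⟩ := hA
    exact ⟨by simp, i, h1, h0⟩

theorem prod_hitGF (s t : ℝ) (hA : ∃ i, h i 0 = true ∧ h i 1 = true) :
    ∏ j : Fin k, hitGF s t (col h 0) (col h 1) (col h j.succ.succ) =
      s ^ (deg h 0 - 1) * t ^ (deg h 1 - 1) := by
  have key (p : Fin k → Prop) [DecidablePred p] (r : ℝ) :
      (∏ j, if p j then r else 1) = r ^ {j | p j}.ncard := by
    rw [Finset.prod_ite, Finset.prod_const, Finset.prod_const_one, mul_one,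
      Set.ncard_eq_toFinset_card', Set.toFinset_ofPred]
  rw [deg_zero_eq hA, deg_one_eq hA, Nat.add_sub_cancel, Nat.add_sub_cancel, ← key, ← key,
    ← Finset.prod_mul_distrib]
  rfl

end Degree

theorem measureReal_eq_sum {Ω : Type*} [MeasurableSpace Ω] [Fintype Ω]
    [MeasurableSingletonClass Ω] (μ : Measure Ω) [IsFiniteMeasure μ] (p : Ω → Prop)
    [DecidablePred p] : μ.real {ω | p ω} = ∑ ω, μ.real {ω} * if p ω then 1 else 0 := by
  rw [← integral_indicator_one (Set.toFinite _).measurableSet,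
    integral_fintype Integrable.of_finite]
  simp [Set.indicator_apply]

/-- The generating function of two integer valued variables on a finite probability space, over
an event `p`. -/
theorem tsum_tsum_measureReal {Ω : Type*} [MeasurableSpace Ω] [Fintype Ω]
    [MeasurableSingletonClass Ω] (μ : Measure Ω) [IsFiniteMeasure μ] (p : Ω → Prop)
    [DecidablePred p] (d e : Ω → ℕ) (s t : ℝ) :
    ∑' j, (∑' k, μ.real {ω | p ω ∧ d ω = j ∧ e ω = k} * t ^ k) * s ^ j =
      ∫ ω, (if p ω then 1 else 0) * (s ^ d ω * t ^ e ω) ∂μ := by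
  have h1 : ∀ j, HasSum (fun k => μ.real {ω | p ω ∧ d ω = j ∧ e ω = k} * t ^ k)
      (∑ ω, μ.real {ω} * (if p ω then 1 else 0) * (if d ω = j then 1 else 0) * t ^ e ω) := by
    intro j
    simp only [measureReal_eq_sum, Finset.sum_mul]
    refine hasSum_sum fun ω _ => ?_
    convert hasSum_single (f := fun k => μ.real {ω} *
      (if p ω ∧ d ω = j ∧ e ω = k then 1 else 0) * t ^ k) (e ω) ?_ using 1
    · by_cases hp : p ω <;> by_cases hd : d ω = j <;> simp [hp, hd]
    · intro k hk
      simp [Ne.symm hk]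
  have h2 : HasSum (fun j => (∑ ω, μ.real {ω} * (if p ω then 1 else 0) *
      (if d ω = j then 1 else 0) * t ^ e ω) * s ^ j)
      (∑ ω, μ.real {ω} * ((if p ω then 1 else 0) * (s ^ d ω * t ^ e ω))) := by
    simp only [Finset.sum_mul]
    refine hasSum_sum fun ω _ => ?_
    convert hasSum_single (f := fun j => μ.real {ω} * (if p ω then 1 else 0) *
      (if d ω = j then 1 else 0) * t ^ e ω * s ^ j) (d ω) ?_ using 1
    · by_cases hp : p ω <;> simp [hp, mul_assoc, mul_comm (s ^ d ω)]
    · intro k hk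
      simp [Ne.symm hk]
  rw [integral_fintype Integrable.of_finite]
  simp only [(h1 _).tsum_eq, h2.tsum_eq, smul_eq_mul]

theorem limRate_one (P₁ : Measure ℝ) (b κ : ℝ) : limRate P₁ b κ 1 = 0 := by
  simp [limRate]

theorem limB_one (P₁ P₂ : Measure ℝ) (b κ : ℝ) : limB P₁ P₂ b κ 1 = moment P₂ 1 := by
  simp [limB, limRate_one, moment]

theorem limA_one (P₁ : Measure ℝ) (κ : ℝ) : limA P₁ κ 1 = moment P₁ 2 := by
  simp [limA, moment]

theorem adj_zero_one_iff {m k : ℕ} (h : Bipartite m (k + 2)) :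
    (intersectionGraph h).Adj 0 1 ↔ ∃ i, h i 0 = true ∧ h i 1 = true := by
  simp [intersectionGraph]

/-- The limit of the degree-degree probabilities, as the coefficients of the limiting generating
function, which are supplied by `α` and `θ`. -/
theorem tendsto_degreeDegree {P₁ P₂ : Measure ℝ} [IsProbabilityMeasure P₁]
    [IsProbabilityMeasure P₂] (hP₁ : ∀ᵐ x ∂P₁, 0 ≤ x) (hP₂ : ∀ᵐ y ∂P₂, 0 ≤ y)
    (hX : Integrable (fun x : ℝ => x ^ 2) P₁) (hY : Integrable (fun y : ℝ => y) P₂)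
    (ha : 0 < moment P₁ 2) (hb : 0 < moment P₂ 1) {m k : ℕ → ℕ}
    (hm : Tendsto m atTop atTop) (hk : Tendsto k atTop atTop) {c κ : ℝ}
    (hc : Tendsto (fun l => ((k l + 2 : ℕ) : ℝ) / √(((k l + 2 : ℕ) : ℝ) * m l)) atTop (𝓝 c))
    (hκ : κ = c * moment P₂ 1) {α θ : ℕ → ℝ} (hα0 : ∀ r, 0 ≤ α r) (hθ0 : ∀ r, 0 ≤ θ r)
    (hα : ∀ s, 0 < s → s ≤ 1 → HasSum (fun r => α r * s ^ r) (limA P₁ κ s))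
    (hθ : ∀ s, 0 < s → s ≤ 1 → HasSum (fun r => θ r * s ^ r) (limB P₁ P₂ (moment P₂ 1) κ s))
    (k₁ k₂ : ℕ) :
    Tendsto (fun l => degreeDegree P₁ P₂ (m l) (k l + 2) 0 1 k₁ k₂) atTop
      (𝓝 ((∑ r ∈ Finset.range (min k₁ k₂ + 1), α r * θ (k₁ - r) * θ (k₂ - r)) /
        (moment P₁ 2 * moment P₂ 1 * moment P₂ 1))) := by
  classical
  set μ := fun l => bipartiteLaw P₁ P₂ (m l) (k l + 2) with hμ
  set E := fun l => {h : Bipartite (m l) (k l + 2) | (intersectionGraph h).Adj 0 1} with hE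
  set n : ℕ → ℝ := fun l => ((k l + 2 : ℕ) : ℝ) with hn
  have hn_pos : ∀ l, 0 < n l := fun l => by simp only [hn]; positivity
  set u := fun (l j i : ℕ) => n l * (μ l).real {h | (intersectionGraph h).Adj 0 1 ∧
    deg h 0 - 1 = j ∧ deg h 1 - 1 = i} with hu
  have hgf : ∀ s t : ℝ, 0 ≤ s → s ≤ 1 → 0 ≤ t → t ≤ 1 → Tendsto
      (fun l => n l * ∫ h, (if (intersectionGraph h).Adj 0 1 then 1 else 0) *
        (s ^ (deg h 0 - 1) * t ^ (deg h 1 - 1)) ∂(μ l)) atTop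
      (𝓝 (limA P₁ κ (s * t) * limB P₁ P₂ (moment P₂ 1) κ s *
        limB P₁ P₂ (moment P₂ 1) κ t)) := by
    intro s t hs hs1 ht ht1
    refine (tendsto_mul_integral_hitGF hP₁ hP₂ hX hY hs hs1 ht ht1 hm hk hc hκ).congr fun l => ?_
    congr 1
    refine integral_congr_ae (Eventually.of_forall fun h => ?_)
    simp only [adj_zero_one_iff]
    by_cases hA : ∃ i, h i 0 = true ∧ h i 1 = true
    · rw [if_pos hA, prod_hitGF s t hA]
    · rw [if_neg hA, zero_mul, zero_mul]
  have hadj : Tendsto (fun l => n l * (μ l).real (E l)) atTop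
      (𝓝 (moment P₁ 2 * moment P₂ 1 * moment P₂ 1)) := by
    have h1 := hgf 1 1 zero_le_one le_rfl zero_le_one le_rfl
    rw [mul_one, limA_one, limB_one] at h1
    refine h1.congr fun l => ?_
    rw [integral_fintype Integrable.of_finite, measureReal_eq_sum]
    simp
  obtain ⟨C, hC⟩ := hadj.bddAbove_range
  have hlim := tendsto_coeff_of_tendsto_tsum_tsum (F := atTop) (u := u) (C := C)
    (fun l j i => mul_nonneg (hn_pos l).le measureReal_nonneg)
    (fun l j i => (mul_le_mul_of_nonneg_left (measureReal_mono fun h hh => hh.1)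
      (hn_pos l).le).trans (hC ⟨l, rfl⟩)) hα0 hθ0 hα hθ
    (fun s t hs hs1 ht ht1 => by
      refine (hgf s t hs.le hs1.le ht.le ht1.le).congr fun l => ?_
      rw [← tsum_tsum_measureReal, ← tsum_mul_left]
      refine tsum_congr fun j => ?_
      rw [← mul_assoc, ← tsum_mul_left]
      simp only [hu, mul_assoc]) k₁ k₂
  refine (hlim.div hadj (by positivity)).congr fun l => ?_
  have hset : E l ∩ {h | deg h 0 = k₁ + 1 ∧ deg h 1 = k₂ + 1} =
      {h | (intersectionGraph h).Adj 0 1 ∧ deg h 0 - 1 = k₁ ∧ deg h 1 - 1 = k₂} := by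
    ext h
    simp only [hE, Set.mem_inter_iff, Set.mem_ofPred_eq]
    refine and_congr_right fun hA => ?_
    rw [deg_zero_eq ((adj_zero_one_iff h).1 hA), deg_one_eq ((adj_zero_one_iff h).1 hA)]
    simp
  rw [degreeDegree, measureReal_def, cond_apply (Set.toFinite _).measurableSet, ENNReal.toReal_mul,
    ENNReal.toReal_inv, ← measureReal_def, ← measureReal_def, hset, Pi.div_apply]
  simp only [hu]
  rw [mul_div_mul_left _ _ (hn_pos l).ne', div_eq_inv_mul]

/-! ### The two limiting regimes -/

theorem moment_pos {P : Measure ℝ} (hP : ∀ᵐ x ∂P, 0 ≤ x) (hne : ¬ ∀ᵐ x ∂P, x = 0) {i : ℕ}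
    (hi : i ≠ 0) (hint : Integrable (fun x : ℝ => x ^ i) P) : 0 < moment P i := by
  have h0 : 0 ≤ᵐ[P] fun x : ℝ => x ^ i := by
    filter_upwards [hP] with x hx using pow_nonneg hx i
  refine lt_of_le_of_ne (integral_nonneg_of_ae h0) fun h => hne ?_
  filter_upwards [(integral_eq_zero_iff_of_nonneg_ae h0 hint).1 h.symm] with x hx
  exact pow_eq_zero_iff hi |>.1 hx

theorem div_sqrt_mul_eq {n : ℝ} (m : ℝ) (hn : 0 < n) : n / √(n * m) = (√(m / n))⁻¹ := by
  rw [show n * m = n ^ 2 * (m / n) by field_simp, Real.sqrt_mul (sq_nonneg n), Real.sqrt_sq hn.le,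
    div_mul_eq_div_div, div_self hn.ne', one_div]

end RandomIntersection

theorem theorem2
    (P₁ P₂ : Measure ℝ) [IsProbabilityMeasure P₁] [IsProbabilityMeasure P₂]
    (hX_nonneg : ∀ᵐ x ∂P₁, 0 ≤ x) (hY_nonneg : ∀ᵐ y ∂P₂, 0 ≤ y)
    (hX_sq : Integrable (fun x : ℝ => x ^ 2) P₁) (hY : Integrable (fun y : ℝ => y) P₂)
    (hX_ne : ¬ ∀ᵐ x ∂P₁, x = 0) (hY_ne : ¬ ∀ᵐ y ∂P₂, y = 0)
    (m n : ℕ → ℕ) (hn2 : ∀ l, 2 ≤ n l)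
    (hm : Tendsto m atTop atTop) (hn : Tendsto n atTop atTop) :
    (∀ β : ℝ, 0 < β →
      Tendsto (fun l => (m l : ℝ) / (n l : ℝ)) atTop (𝓝 β) →
      ∀ k₁ k₂ : ℕ,
        Tendsto (fun l => RandomIntersection.degreeDegree P₁ P₂ (m l) (n l)
            ⟨0, lt_of_lt_of_le Nat.zero_lt_two (hn2 l)⟩
            ⟨1, lt_of_lt_of_le Nat.one_lt_two (hn2 l)⟩ k₁ k₂)
          atTop (𝓝 (RandomIntersection.pBeta P₁ P₂ β k₁ k₂))) ∧
    (Tendsto (fun l => (m l : ℝ) / (n l : ℝ)) atTop atTop →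
      ∀ k₁ k₂ : ℕ,
        Tendsto (fun l => RandomIntersection.degreeDegree P₁ P₂ (m l) (n l)
            ⟨0, lt_of_lt_of_le Nat.zero_lt_two (hn2 l)⟩
            ⟨1, lt_of_lt_of_le Nat.one_lt_two (hn2 l)⟩ k₁ k₂)
          atTop (𝓝 (RandomIntersection.pInfty P₁ P₂ k₁ k₂))) := by
  have hX := RandomIntersection.integrable_id_of_sq hX_sq
  have ha1 : 0 < RandomIntersection.moment P₁ 1 :=
    RandomIntersection.moment_pos hX_nonneg hX_ne one_ne_zero (by simpa using hX)
  have ha2 : 0 < RandomIntersection.moment P₁ 2 :=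
    RandomIntersection.moment_pos hX_nonneg hX_ne two_ne_zero hX_sq
  have hb : 0 < RandomIntersection.moment P₂ 1 :=
    RandomIntersection.moment_pos hY_nonneg hY_ne one_ne_zero (by simpa using hY)
  obtain ⟨k, rfl⟩ : ∃ k : ℕ → ℕ, n = fun l => k l + 2 :=
    ⟨fun l => n l - 2, funext fun l => (Nat.sub_add_cancel (hn2 l)).symm⟩
  have hk : Tendsto k atTop atTop :=
    tendsto_atTop_atTop.2 fun b => by
      obtain ⟨i, hi⟩ := tendsto_atTop_atTop.1 hn (b + 2)
      exact ⟨i, fun a ha => Nat.le_of_add_le_add_right (hi a ha)⟩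
  -- `n / √(n m) = (m / n) ^ (-1/2)`, which tends to `β ^ (-1/2)` and to `0`, respectively
  have hratio : ∀ l, (√((m l : ℝ) / ((k l + 2 : ℕ) : ℝ)))⁻¹ =
      ((k l + 2 : ℕ) : ℝ) / √(((k l + 2 : ℕ) : ℝ) * m l) := fun l =>
    (RandomIntersection.div_sqrt_mul_eq _ (by positivity)).symm
  refine ⟨fun β hβ hmn k₁ k₂ => ?_, fun hmn k₁ k₂ => ?_⟩
  · have hc : 0 < RandomIntersection.moment P₂ 1 / √β := div_pos hb (Real.sqrt_pos.2 hβ)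
    have hlim := RandomIntersection.tendsto_degreeDegree hX_nonneg hY_nonneg hX_sq hY ha2 hb hm hk
      (c := (√β)⁻¹)
      ((((Real.continuous_sqrt.tendsto β).comp hmn).inv₀ (Real.sqrt_pos.2 hβ).ne').congr hratio)
      (div_eq_inv_mul _ _) (fun r => by
        have := RandomIntersection.probΛ₀_nonneg (P₂ := P₂) (β := β) hX_nonneg hb (r + 2)
        positivity)
      (fun r => RandomIntersection.q_nonneg hX_nonneg hY_nonneg hX hc ha1 r)
      (fun s hs hs1 => RandomIntersection.hasSum_probΛ₀ hX_nonneg hX_sq hβ hb hs hs1)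
      (fun s hs hs1 => RandomIntersection.hasSum_q hX_nonneg hY_nonneg hX hY hβ ha1 hb hs hs1)
      k₁ k₂
    refine Tendsto.mono_right hlim (le_of_eq (congrArg 𝓝 ?_))
    rw [RandomIntersection.pBeta, Finset.mul_sum, Finset.sum_div]
    refine Finset.sum_congr rfl fun r _ => ?_
    field_simp
  · -- `limA` is the constant `a₂`, so that only the term `r = 0` survives
    have hlim := RandomIntersection.tendsto_degreeDegree hX_nonneg hY_nonneg hX_sq hY ha2 hb hm hk
      (c := 0) (κ := 0) ((Real.tendsto_sqrt_atTop.comp hmn).inv_tendsto_atTop.congr hratio)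
      (zero_mul _).symm (α := fun r => if r = 0 then RandomIntersection.moment P₁ 2 else 0)
      (fun r => by
        split_ifs
        exacts [ha2.le, le_rfl])
      (fun r => by
        rw [RandomIntersection.pTilde_succ hY_nonneg hY (mul_pos ha2 hb) hb r]
        exact RandomIntersection.integral_mul_poissonProb_nonneg hY_nonneg hY_nonneg
          (mul_pos ha2 hb).le r)
      (fun s hs hs1 => by
        rw [RandomIntersection.limA_zero]
        convert hasSum_single (f := fun r : ℕ =>
          (if r = 0 then RandomIntersection.moment P₁ 2 else 0) * s ^ r) 0 ?_ using 1
        · simp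
        · intro r hr
          simp [hr])
      (fun s hs hs1 => RandomIntersection.hasSum_pTilde hY_nonneg hY ha2 hb hs hs1) k₁ k₂
    refine Tendsto.mono_right hlim (le_of_eq (congrArg 𝓝 ?_))
    rw [Finset.sum_eq_single 0 (fun r _ hr => by simp [hr]) (fun h => by simp at h), if_pos rfl,
      RandomIntersection.pInfty, Nat.sub_zero, Nat.sub_zero]
    field_simp
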